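/- **Setting.** Consider a finite episodic two-player zero-sum imperfect information game: a finite state space $\mathcal S$; partitions of $\mathcal S$ into information sets, $\mathcal X$ for the max-player and $\mathcal Y$ for the min-player; non-empty finite action sets $\mathcal A(x)$, $x\in\mathcal X$, and $\mathcal B(y)$, $y\in\mathcal Y$; a horizon $H\ge 1$; an initial distribution $p_0$; transition kernels $p_h(\cdot\mid s,a,b)$; and rewards $r_h(s,a,b)\in[0,1]$ of the max-player. Both players have perfect recall: for each information set $x$ there is a unique step $h$ and a unique history $(x_1,a_1,\dots,x_h)$ with $x_h=x$ that can occur in the game. Write $x'\ge x$ if $x$ belongs to the history leading to $x'$ (in particular $x\ge x$), $A(x)=|\mathcal A(x)|$, $A_{\mathcal X}=\sum_x A(x)$, $B_{\mathcal Y}=\sum_y|\mathcal B(y)|$. A policy $\mu$ of the max-player gives a distribution $\mu_h(\cdot\mid x_h)$ on $\mathcal A(x_h)$ for each information set; its realization plan is $\mu_{1:h}(x_h,a_h)=\prod_{h'\le h}\mu_{h'}(a_{h'}\mid x_{h'})$, the product running along the history of $x_h$ and $a_h$. Policies $\nu$ of the min-player are analogous. $V^{\mu,\nu}$ is the expected total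 reward of an episode. In $T$ episodes the players use policies $\mu^t,\nu^t$, chosen before episode $t$ from the information available then (the opponent may be adversarial and randomized); given this information, the trajectory of episode $t$ has the law of an episode played with $(\mu^t,\nu^t)$, and $x_h^t,a_h^t,r_h^t$ denote its information sets and actions of the max-player and its rewards. The regret is $\mathfrak R^T_{\max}=\max_{\mu^\dagger}\sum_{t=1}^T\big(V^{\mu^\dagger,\nu^t}-V^{\mu^t,\nu^t}\big)$. **Adaptive-FTRL** (max-player), with parameters $\eta,\gamma>0$ and base policy $\mu^0$, starts from $\tilde P^0=\tilde L^0=0$ and sets, for $t=1,\dots,T$, $$\gamma^t_h(x_h,a_h)=\frac{\gamma}{1+\tilde P^{t-1}(x_h,a_h)},\qquad \eta^t_h(x_h)=\min_{x'\ge x_h}\frac{\eta}{1+\tilde P^{t-1}(x')},\qquad \tilde P^{t}(x)=\frac1{A(x)}\sum_{a\in\mathcal A(x)}\tilde P^{t}(x,a),$$ $$\mu^t\in\operatorname*{argmin}_{\mu}\ \sum_{h,x_h,a_h}\mu_{1:h}(x_h,a_h)\,\tilde L^{t-1}(x_h,a_h)+\sum_{h,x_h,a_h}\frac{\mu_{1:h}(x_h,a_h)}{\eta^t_h(x_h)}\log\frac{\mu_h(a_h\mid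 x_h)}{\mu^0_h(a_h\mid x_h)},$$ and, after playing $\mu^t$ in episode $t$, $$\tilde P^t(x_h,a_h)=\tilde P^{t-1}(x_h,a_h)+\frac{\mathbf 1\{x_h^t=x_h,a_h^t=a_h\}}{\mu^t_{1:h}(x_h,a_h)+\gamma^t_h(x_h,a_h)},\qquad \tilde L^t(x_h,a_h)=\tilde L^{t-1}(x_h,a_h)+\frac{\mathbf 1\{x_h^t=x_h,a_h^t=a_h\}(1-r_h^t)}{\mu^t_{1:h}(x_h,a_h)+\gamma^t_h(x_h,a_h)}.$$ The min-player's version is the same on its own information sets, with $1-r_h^t$ replaced by $r_h^t$ and $A_{\mathcal X}$ by $B_{\mathcal Y}$ in the parameters below. **Theorem.** Let $\delta\in(0,1)$, $T\ge1$, $\iota'=\log(3A_{\mathcal X}T/\delta)$ and $\lambda=1+\log_2(1+T)$. (1) If the max-player uses Adaptive-FTRL with $\eta=2\sqrt{\iota'T/(\lambda A_{\mathcal X})}$, $\gamma=\sqrt{2\iota'HT/(\lambda A_{\mathcal X})}$ and $\mu^0$ the uniform policy, then, with probability at least $1-\delta$, $$\mathfrak R^T_{\max}\le 6H\sqrt{\iota'\lambda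 A_{\mathcal X}T}.$$ (2) There is an absolute constant $C>0$ such that, if both players use Adaptive-FTRL with these parameters (each with its own number of actions), then for every $\varepsilon>0$ and every $$T\ge 2\quad\text{with}\quad T\ \ge\ C\,H^2(A_{\mathcal X}+B_{\mathcal Y})\log(1/\delta+T)\log(T)/\varepsilon^2,$$ with probability at least $1-\delta$ a time-averaged profile $(\overline\mu,\overline\nu)$, i.e. policies with $\overline\mu_{1:}=\frac1T\sum_{t\le T}\mu^t_{1:}$ and $\overline\nu_{1:}=\frac1T\sum_{t\le T}\nu^t_{1:}$, exists, and every such profile is $\varepsilon$-optimal: $\max_{\mu}V^{\mu,\overline\nu}-\min_{\nu}V^{\overline\mu,\nu}\le\varepsilon$. -/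

import Mathlib

open MeasureTheory ProbabilityTheory

/-- Behavioural policies of one player: `μ x a` is the probability of playing `a` at the information
set `x`. The information set determines the time step, so no separate step index is needed. -/
abbrev Policy {X : Type*} (A : X → Type*) [∀ x, Fintype (A x)] : Type _ :=
  (x : X) → stdSimplex ℝ (A x)

/-- A finite episodic two-player zero-sum imperfect information game. The partitions of the state
space `S` into information sets are the maps `xOf`, `yOf`. Steps are `0, …, H - 1`; the kernel `p h`
leads from step `h` to step `h + 1` (the value at the last step is never used). -/
structure Game (S : Type*) {X Y : Type*} (A : X → Type*) (B : Y → Type*) [Fintype S] where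
  /-- information set of the max-player -/
  xOf : S → X
  /-- information set of the min-player -/
  yOf : S → Y
  /-- length of an episode -/
  H : ℕ
  H_pos : 0 < H
  /-- law of the initial state -/
  p₀ : stdSimplex ℝ S
  /-- transition kernels -/
  p : Fin H → (s : S) → A (xOf s) → B (yOf s) → stdSimplex ℝ S
  /-- rewards of the max-player -/
  r : Fin H → (s : S) → A (xOf s) → B (yOf s) → Set.Icc (0 : ℝ) 1

namespace Game

variable {S X Y : Type*} {A : X → Type*} {B : Y → Type*} [Fintype S]

/-- The trajectory of an episode: states and actions of both players at every step. -/
abbrev Traj (G : Game S A B) : Type _ := Fin G.H → (s : S) × (A (G.xOf s) × B (G.yOf s))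

/-- Information set and action of the max-player at every step of a trajectory. -/
def maxPath (G : Game S A B) (τ : G.Traj) : Fin G.H → (x : X) × A x :=
  fun h => ⟨G.xOf (τ h).1, (τ h).2.1⟩

/-- Information set and action of the min-player at every step of a trajectory. -/
def minPath (G : Game S A B) (τ : G.Traj) : Fin G.H → (y : Y) × B y :=
  fun h => ⟨G.yOf (τ h).1, (τ h).2.2⟩

/-- Reward `r_h` collected by the max-player at step `h` of a trajectory. -/
def reward (G : Game S A B) (τ : G.Traj) (h : Fin G.H) : ℝ :=
  G.r h (τ h).1 (τ h).2.1 (τ h).2.2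

/-- Probability that the game moves from step `h` to step `h + 1` as the trajectory says
(`1` at the last step). -/
noncomputable def stepProb (G : Game S A B) (τ : G.Traj) (h : Fin G.H) : ℝ :=
  if hh : h.1 + 1 < G.H then G.p h (τ h).1 (τ h).2.1 (τ h).2.2 (τ ⟨h.1 + 1, hh⟩).1 else 1

/-- A trajectory is feasible if it is possible for the game when both players choose its actions. -/
def Feasible (G : Game S A B) (τ : G.Traj) : Prop :=
  0 < G.p₀ (τ ⟨0, G.H_pos⟩).1 ∧ ∀ h, 0 < G.stepProb τ h

/-- `l = [(x₁, a₁), …, (x_{h-1}, a_{h-1})]` is a possible history of the max-player before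
the information set `x` at some step `h`. -/
def IsMaxHistory (G : Game S A B) (x : X) (l : List ((x : X) × A x)) : Prop :=
  ∃ (τ : G.Traj) (h : Fin G.H), G.Feasible τ ∧ G.xOf (τ h).1 = x ∧
    l = (List.ofFn (G.maxPath τ)).take h

/-- `l` is a possible history of the min-player before the information set `y`. -/
def IsMinHistory (G : Game S A B) (y : Y) (l : List ((y : Y) × B y)) : Prop :=
  ∃ (τ : G.Traj) (h : Fin G.H), G.Feasible τ ∧ G.yOf (τ h).1 = y ∧
    l = (List.ofFn (G.minPath τ)).take h

/-- Perfect recall of both players: every information set has exactly one history (whose length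
is the number of steps before the information set, so that the time step is unique as well). -/
def PerfectRecall (G : Game S A B) : Prop :=
  (∀ x, ∃! l, G.IsMaxHistory x l) ∧ (∀ y, ∃! l, G.IsMinHistory y l)

/-- The history of the max-player before `x` (the unique one, under perfect recall). -/
noncomputable def maxHist (G : Game S A B) (x : X) : List ((x : X) × A x) :=
  Classical.epsilon (G.IsMaxHistory x)

/-- The history of the min-player before `y` (the unique one, under perfect recall). -/
noncomputable def minHist (G : Game S A B) (y : Y) : List ((y : Y) × B y) :=
  Classical.epsilon (G.IsMinHistory y)

variable [∀ x, Fintype (A x)] [∀ y, Fintype (B y)]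

/-- Probability of a trajectory when the players use the policies `μ` and `ν`. -/
noncomputable def trajProb (G : Game S A B) (μ : Policy A) (ν : Policy B) (τ : G.Traj) : ℝ :=
  G.p₀ (τ ⟨0, G.H_pos⟩).1 *
    ∏ h, (μ (G.xOf (τ h).1) (τ h).2.1 * ν (G.yOf (τ h).1) (τ h).2.2 * G.stepProb τ h)

open Classical in
/-- Expected total reward `V^{μ,ν}` of the max-player. -/
noncomputable def value (G : Game S A B) (μ : Policy A) (ν : Policy B) : ℝ :=
  ∑ τ : G.Traj, G.trajProb μ ν τ * ∑ h, G.reward τ h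

/-- Regret of the max-player after `T` episodes (numbered `0, …, T - 1`) with policies `μ t`,
`ν t`. The maximum over all policies is a supremum of a bounded family of reals. -/
noncomputable def regretMax (G : Game S A B) (T : ℕ) (μ : ℕ → Policy A) (ν : ℕ → Policy B) : ℝ :=
  ⨆ μ' : Policy A, ∑ t ∈ Finset.range T, (G.value μ' (ν t) - G.value (μ t) (ν t))

/-- `(μ, ν)` is an `ε`-optimal profile: its duality gap
`max_{μ'} V^{μ',ν} - min_{ν'} V^{μ,ν'}` is at most `ε`. -/
def IsOptimalProfile (G : Game S A B) (ε : ℝ) (μ : Policy A) (ν : Policy B) : Prop :=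
  ∀ (μ' : Policy A) (ν' : Policy B), G.value μ' ν - G.value μ ν' ≤ ε

/-- `T` episodes of the game are played: the policies `μ t`, `ν t` of episode `t` are chosen
on the basis of the information `𝓕 t` available before the episode, the trajectory `τ t` is known
after it, and its conditional law given `𝓕 t` is the law of an episode with these policies.
The filtration is arbitrary, so that a player may be adversarial and randomized. -/
structure IsPlay (G : Game S A B) {Ω : Type*} {mΩ : MeasurableSpace Ω} (P : Measure Ω)
    (𝓕 : Filtration ℕ mΩ) (T : ℕ) (μ : ℕ → Ω → Policy A) (ν : ℕ → Ω → Policy B)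
    (τ : ℕ → Ω → G.Traj) : Prop where
  measurable_max : ∀ t < T, Measurable[𝓕 t] (μ t)
  measurable_min : ∀ t < T, Measurable[𝓕 t] (ν t)
  measurable_traj : ∀ t < T, ∀ z, MeasurableSet[𝓕 (t + 1)] (τ t ⁻¹' {z})
  law_traj : ∀ t < T, ∀ z,
    P⟦τ t ⁻¹' {z} | 𝓕 t⟧ =ᵐ[P] fun ω => G.trajProb (μ t ω) (ν t ω) z

end Game

/-! ### The algorithm of one player

Everything here is seen from one player, with information sets `X`, actions `A x` and
histories `hist x = [(x₁, a₁), …, (x_{h-1}, a_{h-1})]`. -/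

namespace AdaptiveFTRL

variable {X : Type*} {A : X → Type*} [Fintype X] [∀ x, Fintype (A x)]

/-- Total number of actions of the player. -/
def totalActions {X : Type*} (A : X → Type*) [Fintype X] [∀ x, Fintype (A x)] : ℕ :=
  ∑ x, Fintype.card (A x)

/-- The realization plan `μ_{1:h}(x_h, a_h)`, the product of the probabilities of the actions
along the history of `x_h` and of `a_h`. -/
noncomputable def plan {X : Type*} {A : X → Type*} [∀ x, Fintype (A x)]
    (hist : X → List ((x : X) × A x)) (μ : Policy A) (z : (x : X) × A x) : ℝ :=
  ((hist z.1).map fun w => μ w.1 w.2).prod * μ z.1 z.2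

/-- The order `x ≤ x'` of the information set tree: `x` belongs to the history leading to `x'`
(which ends with `x'` itself). -/
def Precedes {X : Type*} {A : X → Type*} (hist : X → List ((x : X) × A x)) (x x' : X) : Prop :=
  x = x' ∨ ∃ a : A x, (⟨x, a⟩ : (x : X) × A x) ∈ hist x'

/-- The uniform policy. -/
noncomputable def uniformPolicy {X : Type*} (A : X → Type*) [∀ x, Fintype (A x)]
    [∀ x, Nonempty (A x)] : Policy A :=
  fun x => ⟨fun _ => (Fintype.card (A x) : ℝ)⁻¹, fun _ => by positivity, by simp⟩

section Estimates

/- Data of the run: `μ t` is the policy of episode `t`, `path t h` the information set and action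
of the player at step `h` of episode `t`, `loss t h` the loss observed there, and `γ` the base
parameter of the implicit exploration. -/
variable {H : ℕ} (hist : X → List ((x : X) × A x)) (γ : ℝ) (μ : ℕ → Policy A)
  (path : ℕ → Fin H → (x : X) × A x) (loss : ℕ → Fin H → ℝ)

open Classical in
/-- Cumulative estimated transitions of the episodes `0, …, t - 1`: episode `t` adds
`1{(x_h^t, a_h^t) = z} / (μ^t_{1:h}(z) + γ^t(z))` with `γ^t(z) = γ / (1 + cumTrans t z)`. -/
noncomputable def cumTrans : ℕ → (x : X) × A x → ℝ
  | 0, _ => 0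
  | t + 1, z => cumTrans t z +
      ∑ h : Fin H, if path t h = z then 1 / (plan hist (μ t) z + γ / (1 + cumTrans t z)) else 0

/-- The adaptive parameter of the implicit exploration in episode `t`. -/
noncomputable def ixParam (t : ℕ) (z : (x : X) × A x) : ℝ :=
  γ / (1 + cumTrans hist γ μ path t z)

open Classical in
/-- Cumulative estimated losses of the episodes `0, …, t - 1`. -/
noncomputable def cumLoss (t : ℕ) (z : (x : X) × A x) : ℝ :=
  ∑ k ∈ Finset.range t, ∑ h : Fin H,
    if path k h = z then loss k h / (plan hist (μ k) z + ixParam hist γ μ path k z) else 0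

/-- Cumulative estimated transitions to an information set: the average over its actions. -/
noncomputable def cumTransAvg (t : ℕ) (x : X) : ℝ :=
  (∑ a : A x, cumTrans hist γ μ path t ⟨x, a⟩) / Fintype.card (A x)

/-- The adaptive learning rate of episode `t` at `x`: the minimum of
`η / (1 + cumTransAvg t x')` over the finitely many information sets `x' ≥ x`. -/
noncomputable def learningRate (η : ℝ) (t : ℕ) (x : X) : ℝ :=
  ⨅ x' : {x' : X // Precedes hist x x'}, η / (1 + cumTransAvg hist γ μ path t x')

end Estimates

/-- The dilated Shannon divergence of `m` from `m₀`, weighted by the learning rates `η`. -/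
noncomputable def dilatedDiv (hist : X → List ((x : X) × A x)) (η : X → ℝ) (m m₀ : Policy A) : ℝ :=
  ∑ x, ∑ a : A x, plan hist m ⟨x, a⟩ / η x * Real.log (m x a / m₀ x a)

/-- The scalar product of the realization plan of `m` with a loss vector. -/
noncomputable def planLoss (hist : X → List ((x : X) × A x)) (m : Policy A)
    (L : (x : X) × A x → ℝ) : ℝ :=
  ∑ x, ∑ a : A x, plan hist m ⟨x, a⟩ * L ⟨x, a⟩

/-- The player runs Adaptive-FTRL with learning rate `η`, parameter `γ` and base policy `μ₀` for
`T` episodes: each `μ t` minimizes the estimated cumulative loss plus the dilated divergence from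
`μ₀`, with the learning rates and estimates obtained from the previous episodes. -/
def IsRun {H : ℕ} (hist : X → List ((x : X) × A x)) (η γ : ℝ) (μ₀ : Policy A) (T : ℕ)
    (μ : ℕ → Policy A) (path : ℕ → Fin H → (x : X) × A x) (loss : ℕ → Fin H → ℝ) : Prop :=
  ∀ t < T, IsMinOn (fun m : Policy A => planLoss hist m (cumLoss hist γ μ path loss t) +
    dilatedDiv hist (learningRate hist γ μ path η t) m μ₀) Set.univ (μ t)

/-- `m` is a time average of `μ 0, …, μ (T - 1)`, in the sense of realization plans. -/
def IsAverage (hist : X → List ((x : X) × A x)) (T : ℕ) (μ : ℕ → Policy A) (m : Policy A) : Prop :=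
  ∀ z, plan hist m z = (∑ t ∈ Finset.range T, plan hist (μ t) z) / T

/-- `ι' = log (3 n T / δ)`, for a player with `n` actions in total. -/
noncomputable def iota (n T : ℕ) (δ : ℝ) : ℝ := Real.log (3 * n * T / δ)

/-- `λ = 1 + log₂ (1 + T)`. -/
noncomputable def lam (T : ℕ) : ℝ := 1 + Real.logb 2 (1 + T)

/-- The learning rate `η = 2 √(ι' T / (λ n))`. -/
noncomputable def etaParam (n T : ℕ) (δ : ℝ) : ℝ := 2 * √(iota n T δ * T / (lam T * n))

/-- The implicit exploration parameter `γ = √(2 ι' H T / (λ n))`. -/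
noncomputable def gammaParam (n H T : ℕ) (δ : ℝ) : ℝ := √(2 * iota n T δ * H * T / (lam T * n))

end AdaptiveFTRL

namespace Game

open AdaptiveFTRL

variable {S X Y : Type*} {A : X → Type*} {B : Y → Type*} [Fintype S] [Fintype X] [Fintype Y]
  [∀ x, Fintype (A x)] [∀ y, Fintype (B y)]

/-- The max-player runs Adaptive-FTRL with the tuned parameters and the uniform base policy; its
loss at a step is `1 - r_h`. -/
def MaxRunsAdaptiveFTRL [∀ x, Nonempty (A x)] (G : Game S A B) (T : ℕ) (δ : ℝ)
    (μ : ℕ → Policy A) (τ : ℕ → G.Traj) : Prop :=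
  IsRun G.maxHist (etaParam (totalActions A) T δ) (gammaParam (totalActions A) G.H T δ)
    (uniformPolicy A) T μ (fun t => G.maxPath (τ t)) (fun t h => 1 - G.reward (τ t) h)

/-- The min-player runs Adaptive-FTRL with the tuned parameters and the uniform base policy; its
loss at a step is `r_h`. -/
def MinRunsAdaptiveFTRL [∀ y, Nonempty (B y)] (G : Game S A B) (T : ℕ) (δ : ℝ)
    (ν : ℕ → Policy B) (τ : ℕ → G.Traj) : Prop :=
  IsRun G.minHist (etaParam (totalActions B) T δ) (gammaParam (totalActions B) G.H T δ)
    (uniformPolicy B) T ν (fun t => G.minPath (τ t)) (fun t h => G.reward (τ t) h)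

end Game

/-! By perfect recall the probability of a step factors into the max-player's realization plan and a
weight that depends only on nature and the opponent (`PerfectRecall.chainMarginal_eq`). The value is
therefore affine in the plan (`PerfectRecall.value_eq`), and the regret is that of online linear
optimization over plans, with loss vectors observed only along the played path.

Regret on the estimates. Log-partition functions, computed from the leaves of the tree, rewrite the
regularized loss as a constant plus the dilated divergence from one fully mixed policy. So the
minimizer is fully mixed, and the excess of any other policy is its divergence from the minimizer
(`isMinOn_regularizedLoss`). One episode changes the losses along one path only, and there the
change of the optimal value obeys a scalar backward recursion. As plan times estimated loss is at
most 1, instability costs at most `H` times the sum of learning rate times estimated loss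
(`path_stability`). This needs rates that do not decrease down the tree, which the minimum over
descendants provides. Induction on the episodes gives `regret_lossEst_le`. With P the cumulative
estimated transitions, the adaptive parameters turn the stability cost and the exploration bias into
sums of ΔP / (1 + P), hence into log₂ (1 + P).

From the estimates to the game. Implicit exploration makes the exponential of the sum of 2γᵗ times
the estimation errors a supermartingale, so the tail sums are at most L from every starting episode.
Abel summation against the increasing weights 1/γᵗ = (1 + P)/γ bounds the total error by L/(2γ) · (1
+ P). Applied to P itself, this yields 1 + P ≤ (8/7)(1 + Q), where Q is the true cumulative reach
weight. Q does not increase down the tree, so the minimum over descendants does no harm, and the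
plan-weighted sum of Q is exactly HT. For the played policy, the estimated loss plus the exploration
bias lies in [0, H], and its conditional mean is at least the true loss, so an Azuma-type bound
suffices.

With R = √(ι'λnT), where n is the player's number of actions, all terms are multiples of HR. For
self-play the players are exchanged by `Game.swap`. Concentration is used at level 2ι' instead of
ι', which leaves the parameters unchanged, doubles the regret bound and makes the failure
probability of each player at most δ/2. -/

/-! ### Scalar inequalities and summation by parts. -/

section Scalar

/-- Bernoulli's inequality for the exponent `u` reads 2^u ≤ 1 + u. It is the source of the base 2 in
λ. -/
lemma le_logb_two_one_add {u : ℝ} (h0 : 0 ≤ u) (h1 : u ≤ 1) : u ≤ Real.logb 2 (1 + u) := by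
  rw [Real.le_logb_iff_rpow_le (by norm_num) (by linarith)]
  have := rpow_one_add_le_one_add_mul_self (s := 1) (by norm_num) h0 h1
  norm_num at this
  linarith

/-- Invert the quadratic lower bound of exp x: (1 + x + x²/2)(1 - x + x²/2) = 1 + x⁴/4 ≥ 1. -/
lemma exp_neg_le_quadratic {x : ℝ} (hx : 0 ≤ x) : Real.exp (-x) ≤ 1 - x + x ^ 2 / 2 := by
  have h := Real.quadratic_le_exp_of_nonneg hx
  have hpos : 0 < 1 + x + x ^ 2 / 2 := by positivity
  rw [Real.exp_neg]
  calc (Real.exp x)⁻¹ ≤ (1 + x + x ^ 2 / 2)⁻¹ := inv_anti₀ hpos h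
    _ ≤ 1 - x + x ^ 2 / 2 := by
      rw [inv_le_iff_one_le_mul₀ hpos]
      nlinarith [sq_nonneg (x ^ 2)]

/-- Sums of relative increments of a slowly growing sequence are logarithmic. -/
lemma sum_relative_increments_le {P : ℕ → ℝ} (h0 : P 0 = 0) (hmono : ∀ t, P t ≤ P (t + 1)) (T : ℕ)
    (hinc : ∀ t < T, P (t + 1) - P t ≤ 1 + P t) :
    ∑ t ∈ Finset.range T, (P (t + 1) - P t) / (1 + P t) ≤ Real.logb 2 (1 + P T) := by
  have hnn : ∀ t, 0 ≤ P t := fun t => by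
    induction t with
    | zero => exact h0.ge
    | succ t ih => exact ih.trans (hmono t)
  induction T with
  | zero => simp [h0]
  | succ T ih =>
    rw [Finset.sum_range_succ]
    have h1 := ih fun t ht => hinc t (by omega)
    have hpos : 0 < 1 + P T := by linarith [hnn T]
    -- The relative increment lies in [0, 1], so it is at most the base 2 logarithm of (1 + P (T+1))
    -- / (1 + P T), and these telescope.
    have h2 : (P (T + 1) - P T) / (1 + P T) ≤ Real.logb 2 (1 + (P (T + 1) - P T) / (1 + P T)) :=
      le_logb_two_one_add (div_nonneg (by linarith [hmono T]) hpos.le)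
        ((div_le_one hpos).2 (hinc T (by omega)))
    have h3 : 1 + P (T + 1) = (1 + P T) * (1 + (P (T + 1) - P T) / (1 + P T)) := by
      field_simp; ring
    rw [h3, Real.logb_mul hpos.ne']
    · linarith
    · have : 0 ≤ (P (T + 1) - P T) / (1 + P T) := div_nonneg (by linarith [hmono T]) hpos.le
      linarith

/-- Summation by parts: bounded tail sums of `e` control the sum of `c k * e k` for monotone `c`. -/
lemma sum_mul_le_of_tail_le {c e : ℕ → ℝ} (hc : Monotone c) (hc0 : 0 ≤ c 0) {T : ℕ} {B : ℝ}
    (hB : ∀ s < T, ∑ k ∈ Finset.Ico s T, e k ≤ B) (hT : 0 < T) :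
    ∑ k ∈ Finset.range T, c k * e k ≤ B * c (T - 1) := by
  -- Downward induction on the starting index, written as T - 1 - d.
  have key : ∀ d, d < T → ∑ k ∈ Finset.Ico (T - 1 - d) T, c k * e k ≤
      c (T - 1 - d) * ∑ k ∈ Finset.Ico (T - 1 - d) T, e k + B * (c (T - 1) - c (T - 1 - d)) := by
    intro d
    induction d with
    | zero =>
      intro _
      obtain ⟨T, rfl⟩ : ∃ n, T = n + 1 := ⟨T - 1, by omega⟩
      simp
    | succ d ih =>
      intro hd
      have ih := ih (by omega)
      obtain ⟨s, hs⟩ : ∃ s, s = T - 1 - (d + 1) := ⟨_, rfl⟩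
      have hs1 : T - 1 - d = s + 1 := by omega
      rw [hs1] at ih
      have hsT : s < T := by omega
      rw [← hs, Finset.sum_eq_sum_Ico_succ_bot hsT e,
        Finset.sum_eq_sum_Ico_succ_bot hsT fun k => c k * e k]
      have h1 := hB (s + 1) (by omega)
      have h2 := hc (Nat.le_succ s)
      simp only [Nat.succ_eq_add_one] at h2
      nlinarith [mul_le_mul_of_nonneg_left h1 (sub_nonneg.2 h2)]
  have h := key (T - 1) (by omega)
  simp only [Nat.sub_self] at h
  rw [Finset.range_eq_Ico]
  nlinarith [hB 0 hT, mul_le_mul_of_nonneg_left (hB 0 hT) hc0]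

end Scalar

/-! ### Marginals of finite Markov chains. -/

section Chain

variable {Z : Type*} [Fintype Z]

/-- Marginals of the chain with initial weights `w` and transition weights `K`. -/
def chainMarginal (w : Z → ℝ) (K : ℕ → Z → Z → ℝ) : ℕ → Z → ℝ
  | 0 => w
  | j + 1 => fun z' => ∑ z, chainMarginal w K j z * K j z z'

/-- Weight of a path of the chain. -/
def chainWeight {n : ℕ} (w : Z → ℝ) (K : ℕ → Z → Z → ℝ) (τ : Fin (n + 1) → Z) : ℝ :=
  w (τ 0) * ∏ j : Fin n, K j (τ j.castSucc) (τ j.succ)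

lemma chainMarginal_shift (w : Z → ℝ) (K : ℕ → Z → Z → ℝ) (j : ℕ) :
    chainMarginal (chainMarginal w K 1) (fun i => K (i + 1)) j = chainMarginal w K (j + 1) := by
  induction j with
  | zero => rfl
  | succ j ih =>
    funext z'
    simp only [chainMarginal] at ih ⊢
    simp [ih]

lemma sum_cons {n : ℕ} (F : (Fin (n + 1) → Z) → ℝ) :
    ∑ τ, F τ = ∑ σ : Fin n → Z, ∑ z, F (Fin.cons z σ) := by
  rw [← (Fin.consEquiv fun _ : Fin (n + 1) => Z).sum_comp, Fintype.sum_prod_type_right]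
  rfl

omit [Fintype Z] in
lemma chainWeight_cons {n : ℕ} (w : Z → ℝ) (K : ℕ → Z → Z → ℝ) (z : Z) (σ : Fin (n + 1) → Z) :
    chainWeight w K (Fin.cons z σ : Fin (n + 2) → Z) =
      w z * K 0 z (σ 0) * ∏ j : Fin n, K (j + 1) (σ j.castSucc) (σ j.succ) := by
  unfold chainWeight
  rw [Fin.prod_univ_succ]
  simp [mul_assoc]

/-- The start weights `w` need not be normalized: a function of the first step can be absorbed into
them, which is how the marginal formulas below begin their inductions. -/
lemma sum_chainWeight {n : ℕ} (w : Z → ℝ) (K : ℕ → Z → Z → ℝ)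
    (hK : ∀ j < n, ∀ z, ∑ z', K j z z' = 1) :
    ∑ τ : Fin (n + 1) → Z, chainWeight w K τ = ∑ z, w z := by
  induction n generalizing w K with
  | zero =>
    rw [sum_cons]
    simp [chainWeight]
  | succ n ih =>
    rw [sum_cons]
    simp_rw [chainWeight_cons, ← Finset.sum_mul]
    have := ih (fun z' => ∑ z, w z * K 0 z z') (fun j => K (j + 1))
      fun j hj => hK (j + 1) (by omega)
    simp only [chainWeight] at this
    rw [this, Finset.sum_comm]
    simp_rw [← Finset.mul_sum, hK 0 (by omega), mul_one]

lemma sum_chainWeight_mul_apply {n : ℕ} (w : Z → ℝ) (K : ℕ → Z → Z → ℝ)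
    (hK : ∀ j < n, ∀ z, ∑ z', K j z z' = 1) (h : ℕ) (hn : h < n + 1) (f : Z → ℝ) :
    ∑ τ : Fin (n + 1) → Z, chainWeight w K τ * f (τ ⟨h, hn⟩) =
      ∑ z, chainMarginal w K h z * f z := by
  induction h generalizing n w K with
  | zero =>
    have := sum_chainWeight (n := n) (fun z => w z * f z) K hK
    rw [chainMarginal, ← this]
    refine Finset.sum_congr rfl fun τ _ => ?_
    simp only [chainWeight, Fin.zero_eta]
    ring
  | succ h ih =>
    obtain ⟨n, rfl⟩ : ∃ m, n = m + 1 := ⟨n - 1, by omega⟩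
    rw [sum_cons, ← chainMarginal_shift, ← ih (n := n) _ _ (fun j hj => hK (j + 1) (by omega)) (by omega)]
    refine Finset.sum_congr rfl fun σ _ => ?_
    rw [Finset.sum_congr rfl fun z _ => by rw [chainWeight_cons]]
    simp only [chainWeight, chainMarginal, Finset.sum_mul]
    rfl

lemma sum_chainWeight_mul_apply₂ {n : ℕ} (w : Z → ℝ) (K : ℕ → Z → Z → ℝ)
    (hK : ∀ j < n, ∀ z, ∑ z', K j z z' = 1) (h : ℕ) (hn : h + 1 < n + 1) (f : Z → Z → ℝ) :
    ∑ τ : Fin (n + 1) → Z, chainWeight w K τ * f (τ ⟨h, by omega⟩) (τ ⟨h + 1, hn⟩) =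
      ∑ z, ∑ z', chainMarginal w K h z * K h z z' * f z z' := by
  induction h generalizing n w K with
  | zero =>
    obtain ⟨n, rfl⟩ : ∃ m, n = m + 1 := ⟨n - 1, by omega⟩
    have := sum_chainWeight (n := n) (fun z' => ∑ z, w z * K 0 z z' * f z z') (fun j => K (j + 1))
      fun j hj => hK (j + 1) (by omega)
    rw [Finset.sum_comm, chainMarginal, ← this, sum_cons]
    refine Finset.sum_congr rfl fun σ _ => ?_
    rw [Finset.sum_congr rfl fun z _ => by rw [chainWeight_cons]]
    simp only [chainWeight, Finset.sum_mul]
    refine Finset.sum_congr rfl fun z _ => ?_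
    change _ * f z (σ 0) = _
    ring_nf
  | succ h ih =>
    obtain ⟨n, rfl⟩ : ∃ m, n = m + 1 := ⟨n - 1, by omega⟩
    rw [sum_cons, ← chainMarginal_shift, ← ih (n := n) _ _ (fun j hj => hK (j + 1) (by omega)) (by omega)]
    refine Finset.sum_congr rfl fun σ _ => ?_
    rw [Finset.sum_congr rfl fun z _ => by rw [chainWeight_cons]]
    simp only [chainWeight, chainMarginal, Finset.sum_mul]
    rfl

end Chain

/-! ### The information set tree and realization plans. -/

namespace AdaptiveFTRL

section Tree

variable {X : Type*} {A : X → Type*}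

/-- The histories form a tree: every prefix of a history is the history of the information set
that follows it. -/
def IsTree (hist : X → List ((x : X) × A x)) : Prop :=
  ∀ x l w l', hist x = l ++ w :: l' → hist w.1 = l

lemma IsTree.eq_nil_or_append {hist : X → List ((x : X) × A x)} (ht : IsTree hist) (x : X) :
    hist x = [] ∨ ∃ w, hist x = hist w.1 ++ [w] := by
  rcases List.eq_nil_or_concat (hist x) with h | ⟨l, w, h⟩
  · exact Or.inl h
  · refine Or.inr ⟨w, ?_⟩
    rw [List.concat_eq_append] at h
    rw [ht x l w [] h, h]

lemma IsTree.induction {hist : X → List ((x : X) × A x)} (ht : IsTree hist) {p : X → Prop}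
    (root : ∀ x, hist x = [] → p x) (step : ∀ x w, hist x = hist w.1 ++ [w] → p w.1 → p x) (x : X) :
    p x := by
  obtain ⟨n, hn⟩ : ∃ n, (hist x).length = n := ⟨_, rfl⟩
  induction n using Nat.strong_induction_on generalizing x with
  | _ n ih =>
    rcases ht.eq_nil_or_append x with h | ⟨w, h⟩
    · exact root x h
    · exact step x w h (ih _ (by rw [← hn, h]; simp) w.1 rfl)

variable [∀ x, Fintype (A x)]

/-- The probability that the player contributes to reaching `x`. -/
noncomputable def reachPlan (hist : X → List ((x : X) × A x)) (m : Policy A) (x : X) : ℝ :=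
  ((hist x).map fun w => m w.1 w.2).prod

lemma plan_eq (hist : X → List ((x : X) × A x)) (m : Policy A) (x : X) (a : A x) :
    plan hist m ⟨x, a⟩ = reachPlan hist m x * m x a := rfl

lemma reachPlan_root {hist : X → List ((x : X) × A x)} (m : Policy A) {x : X} (h : hist x = []) :
    reachPlan hist m x = 1 := by simp [reachPlan, h]

lemma reachPlan_child {hist : X → List ((x : X) × A x)} (m : Policy A) {x : X} {w : (x : X) × A x}
    (h : hist x = hist w.1 ++ [w]) : reachPlan hist m x = plan hist m w := by
  simp [reachPlan, plan, h]

lemma policy_nonneg (m : Policy A) (x : X) (a : A x) : 0 ≤ m x a := (m x).2.1 a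

lemma policy_sum (m : Policy A) (x : X) : ∑ a, m x a = 1 := (m x).2.2

lemma policy_le_one (m : Policy A) (x : X) (a : A x) : m x a ≤ 1 :=
  (mem_Icc_of_mem_stdSimplex (m x).2 a).2

lemma reachPlan_nonneg (hist : X → List ((x : X) × A x)) (m : Policy A) (x : X) :
    0 ≤ reachPlan hist m x := by
  refine List.prod_nonneg fun r hr => ?_
  obtain ⟨w, -, rfl⟩ := List.mem_map.1 hr
  exact policy_nonneg m _ _

lemma reachPlan_le_one (hist : X → List ((x : X) × A x)) (m : Policy A) (x : X) :
    reachPlan hist m x ≤ 1 := by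
  unfold reachPlan
  generalize hist x = l
  induction l with
  | nil => simp
  | cons w l ih =>
    simp only [List.map_cons, List.prod_cons]
    refine mul_le_one₀ (policy_le_one m _ _) (List.prod_nonneg fun r hr => ?_) ih
    obtain ⟨w, -, rfl⟩ := List.mem_map.1 hr
    exact policy_nonneg m _ _

lemma plan_nonneg (hist : X → List ((x : X) × A x)) (m : Policy A) (z : (x : X) × A x) :
    0 ≤ plan hist m z := mul_nonneg (reachPlan_nonneg hist m z.1) (policy_nonneg m _ _)

lemma plan_le_one (hist : X → List ((x : X) × A x)) (m : Policy A) (z : (x : X) × A x) :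
    plan hist m z ≤ 1 :=
  mul_le_one₀ (reachPlan_le_one hist m z.1) (policy_nonneg m _ _) (policy_le_one m _ _)

lemma sum_plan (hist : X → List ((x : X) × A x)) (m : Policy A) (x : X) :
    ∑ a, plan hist m ⟨x, a⟩ = reachPlan hist m x := by
  simp_rw [plan_eq, ← Finset.mul_sum, policy_sum, mul_one]

lemma reachPlan_pos {hist : X → List ((x : X) × A x)} {m : Policy A} (hm : ∀ x a, 0 < m x a)
    (x : X) : 0 < reachPlan hist m x := by
  refine List.prod_pos fun r hr => ?_
  obtain ⟨w, -, rfl⟩ := List.mem_map.1 hr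
  exact hm _ _

lemma uniformPolicy_pos [∀ x, Nonempty (A x)] (x : X) (a : A x) : 0 < uniformPolicy A x a := by
  change 0 < (Fintype.card (A x) : ℝ)⁻¹
  positivity

end Tree

/-! ### Relative entropy and exponential tilting. -/

section RelEntropy

variable {α : Type*} [Fintype α]

/-- Relative entropy of finite distributions. -/
noncomputable def relEntropy (p q : α → ℝ) : ℝ := ∑ a, p a * Real.log (p a / q a)

/-- The linear terms of `klFun` cancel because both masses are 1. In this form every summand is
nonnegative, which gives both nonnegativity and the equality case. -/
lemma relEntropy_eq_sum_klFun {p q : α → ℝ} (hq : ∀ a, 0 < q a) (hp1 : ∑ a, p a = 1)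
    (hq1 : ∑ a, q a = 1) :
    relEntropy p q = ∑ a, q a * InformationTheory.klFun (p a / q a) := by
  have : ∀ a, q a * InformationTheory.klFun (p a / q a) =
      p a * Real.log (p a / q a) + (q a - p a) := fun a => by
    have := (hq a).ne'
    rw [InformationTheory.klFun_apply]
    field_simp
    ring
  simp_rw [this, Finset.sum_add_distrib, Finset.sum_sub_distrib, hp1, hq1]
  simp [relEntropy]

lemma relEntropy_nonneg {p q : α → ℝ} (hp : ∀ a, 0 ≤ p a) (hq : ∀ a, 0 < q a)
    (hp1 : ∑ a, p a = 1) (hq1 : ∑ a, q a = 1) : 0 ≤ relEntropy p q := by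
  rw [relEntropy_eq_sum_klFun hq hp1 hq1]
  exact Finset.sum_nonneg fun a _ =>
    mul_nonneg (hq a).le (InformationTheory.klFun_nonneg (div_nonneg (hp a) (hq a).le))

lemma eq_of_relEntropy_eq_zero {p q : α → ℝ} (hp : ∀ a, 0 ≤ p a) (hq : ∀ a, 0 < q a)
    (hp1 : ∑ a, p a = 1) (hq1 : ∑ a, q a = 1) (h : relEntropy p q = 0) : p = q := by
  rw [relEntropy_eq_sum_klFun hq hp1 hq1, Finset.sum_eq_zero_iff_of_nonneg fun a _ =>
    mul_nonneg (hq a).le (InformationTheory.klFun_nonneg (div_nonneg (hp a) (hq a).le))] at h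
  funext a
  have := h a (Finset.mem_univ a)
  rw [mul_eq_zero, or_iff_right (hq a).ne',
    InformationTheory.klFun_eq_zero_iff (div_nonneg (hp a) (hq a).le)] at this
  exact (div_eq_one_iff_eq (hq a).ne').1 this

/-- The exponential tilt `q a * exp (- c * U a) / Z` of a distribution. -/
noncomputable def tilt (q : α → ℝ) (c : ℝ) (U : α → ℝ) (a : α) : ℝ :=
  q a * Real.exp (-c * U a) / ∑ b, q b * Real.exp (-c * U b)

variable {q : α → ℝ} (hq : ∀ a, 0 < q a) (hq1 : ∑ a, q a = 1)

include hq hq1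

lemma tilt_normalizer_pos (c : ℝ) (U : α → ℝ) : 0 < ∑ b, q b * Real.exp (-c * U b) := by
  refine Finset.sum_pos (fun b _ => mul_pos (hq b) (Real.exp_pos _)) ?_
  by_contra h
  rw [Finset.not_nonempty_iff_eq_empty] at h
  simp [h] at hq1

lemma tilt_pos (c : ℝ) (U : α → ℝ) (a : α) : 0 < tilt q c U a :=
  div_pos (mul_pos (hq a) (Real.exp_pos _)) (tilt_normalizer_pos hq hq1 c U)

lemma tilt_sum (c : ℝ) (U : α → ℝ) : ∑ a, tilt q c U a = 1 := by
  unfold tilt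
  rw [← Finset.sum_div, div_self (tilt_normalizer_pos hq hq1 c U).ne']

/-- The variational formula of Donsker and Varadhan, with its remainder. -/
lemma sum_mul_add_relEntropy {p : α → ℝ} (hp : ∀ a, 0 ≤ p a) (hp1 : ∑ a, p a = 1) {c : ℝ}
    (hc : 0 < c) (U : α → ℝ) :
    ∑ a, p a * U a + relEntropy p q / c =
      -(1 / c) * Real.log (∑ b, q b * Real.exp (-c * U b)) + relEntropy p (tilt q c U) / c := by
  have hZ := tilt_normalizer_pos hq hq1 c U
  have key : ∀ a, p a * Real.log (p a / tilt q c U a) = p a * Real.log (p a / q a) + c * (p a * U a) +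
      p a * Real.log (∑ b, q b * Real.exp (-c * U b)) := fun a => by
    rcases (hp a).eq_or_lt with h | h
    · simp [← h]
    · have h1 : p a / tilt q c U a =
          p a / q a * Real.exp (c * U a) * ∑ b, q b * Real.exp (-c * U b) := by
        have := (hq a).ne'
        have h2 : Real.exp (-c * U a) = (Real.exp (c * U a))⁻¹ := by
          rw [← Real.exp_neg]; ring_nf
        unfold tilt
        rw [h2]
        field_simp
      rw [h1, Real.log_mul (by have := hq a; positivity) hZ.ne',
        Real.log_mul (by have := hq a; positivity) (Real.exp_pos _).ne', Real.log_exp]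
      ring
  have : relEntropy p (tilt q c U) = relEntropy p q + c * ∑ a, p a * U a +
      Real.log (∑ b, q b * Real.exp (-c * U b)) := by
    unfold relEntropy
    simp_rw [key, Finset.sum_add_distrib, ← Finset.mul_sum, ← Finset.sum_mul, hp1, one_mul]
  rw [this]
  field_simp
  ring

/-- Lower bound for a linear loss on one action plus a relative entropy. -/
lemma neg_log_le_relEntropy_add {p : α → ℝ} (hp : ∀ a, 0 ≤ p a) (hp1 : ∑ a, p a = 1) {c : ℝ}
    (hc : 0 < c) (a : α) (v : ℝ) :
    -(1 / c) * Real.log (1 - q a + q a * Real.exp (-c * v)) ≤ relEntropy p q / c + p a * v := by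
  classical
  have h := sum_mul_add_relEntropy hq hq1 hp hp1 hc fun b => if b = a then v else 0
  have h1 : ∑ b, q b * Real.exp (-c * if b = a then v else 0) =
      1 - q a + q a * Real.exp (-c * v) := by
    have : ∀ b, q b * Real.exp (-c * if b = a then v else 0) =
        q b + if b = a then q a * Real.exp (-c * v) - q a else 0 := fun b => by
      split_ifs with hb
      · subst hb; ring
      · simp
    simp_rw [this, Finset.sum_add_distrib, hq1, Finset.sum_ite_eq', Finset.mem_univ, if_true]
    ring
  rw [h1] at h
  simp only [mul_ite, mul_zero, Finset.sum_ite_eq', Finset.mem_univ, if_true] at h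
  have h2 : 0 ≤ relEntropy p (tilt q c fun b => if b = a then v else 0) / c :=
    div_nonneg (relEntropy_nonneg hp (tilt_pos hq hq1 _ _) hp1 (tilt_sum hq hq1 _ _)) hc.le
  linarith

end RelEntropy

/-! ### The minimizer of the regularized loss. -/

section Minimizer

variable {X : Type*} {A : X → Type*} [Fintype X] [∀ x, Fintype (A x)]

open Classical in
/-- Sum of `F` over the information sets that directly follow `w`. -/
noncomputable def childSum (hist : X → List ((x : X) × A x)) (F : X → ℝ) (w : (x : X) × A x) : ℝ :=
  ∑ x', if hist x' = hist w.1 ++ [w] then F x' else 0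

omit [∀ x, Fintype (A x)] in
-- Backward recursion from the leaves: histories get longer from parent to child and have bounded
-- length, so the recursion is well founded.
lemma exists_childSum_fixpoint (hist : X → List ((x : X) × A x)) (Φ : (x : X) → (A x → ℝ) → ℝ) :
    ∃ F : X → ℝ, ∀ x, F x = Φ x fun a => childSum hist F ⟨x, a⟩ := by
  classical
  let N := ∑ x, (hist x).length
  have hN : ∀ x, (hist x).length ≤ N := fun x =>
    Finset.single_le_sum (f := fun x => (hist x).length) (fun _ _ => Nat.zero_le _)
      (Finset.mem_univ x)
  have key : ∀ x x' a, hist x' = hist x ++ [⟨x, a⟩] →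
      InvImage (· < ·) (fun x => N - (hist x).length) x' x := fun x x' a h => by
    have h1 := hN x'
    have h2 := congrArg List.length h
    simp only [List.length_append, List.length_singleton] at h2
    simp only [InvImage]
    omega
  let wf : WellFounded (InvImage (· < ·) fun x => N - (hist x).length) :=
    InvImage.wf _ Nat.lt_wfRel.wf
  refine ⟨wf.fix fun x rec => Φ x fun a =>
    ∑ x', if h : hist x' = hist x ++ [⟨x, a⟩] then rec x' (key x x' a h) else 0, fun x => ?_⟩
  rw [wf.fix_eq]
  rfl

open Classical in
-- Telescoping over the tree: every information set other than a root has exactly one parent pair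
-- `w`, and its reach equals the plan at `w`, so only the roots survive.
lemma sum_reachPlan_mul_sub {hist : X → List ((x : X) × A x)} (ht : IsTree hist) (m : Policy A)
    (F : X → ℝ) :
    ∑ x, reachPlan hist m x * (F x - ∑ a, m x a * childSum hist F ⟨x, a⟩) =
      ∑ x, if hist x = [] then F x else 0 := by
  have h1 : ∑ x, reachPlan hist m x * ∑ a, m x a * childSum hist F ⟨x, a⟩ =
      ∑ x', (∑ w : (x : X) × A x, if hist x' = hist w.1 ++ [w] then plan hist m w else 0) * F x' := by
    calc _ = ∑ w : (x : X) × A x, plan hist m w * childSum hist F w := by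
          rw [Fintype.sum_sigma]
          simp_rw [Finset.mul_sum, plan_eq, mul_assoc]
      _ = _ := by
          simp_rw [childSum, Finset.mul_sum, Finset.sum_mul]
          rw [Finset.sum_comm]
          simp
  simp_rw [mul_sub, Finset.sum_sub_distrib]
  rw [h1, ← Finset.sum_sub_distrib]
  refine Finset.sum_congr rfl fun x' _ => ?_
  rcases ht.eq_nil_or_append x' with h | ⟨w, h⟩
  · simp [h, reachPlan_root m h]
  · have h2 : ∀ w' : (x : X) × A x, hist x' = hist w'.1 ++ [w'] ↔ w' = w := fun w' => by
      constructor
      · intro h'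
        rw [h] at h'
        simpa using (congrArg List.getLast? h').symm
      · rintro rfl; exact h
    simp_rw [h2, Finset.sum_ite_eq', Finset.mem_univ, if_true, reachPlan_child m h]
    simp [h]

lemma dilatedDiv_eq_sum_relEntropy (hist : X → List ((x : X) × A x)) (η : X → ℝ) (m m₀ : Policy A) :
    dilatedDiv hist η m m₀ = ∑ x, reachPlan hist m x * (relEntropy (m x) (m₀ x) / η x) := by
  unfold dilatedDiv
  refine Finset.sum_congr rfl fun x _ => ?_
  simp_rw [relEntropy, plan_eq, Finset.sum_div, Finset.mul_sum]
  refine Finset.sum_congr rfl fun a _ => ?_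
  ring

/-- The regularized loss is a constant plus the dilated divergence from an explicit fully mixed
policy. -/
lemma exists_planLoss_add_dilatedDiv_eq {hist : X → List ((x : X) × A x)} (ht : IsTree hist)
    {η : X → ℝ} (hη : ∀ x, 0 < η x) {μ₀ : Policy A} (h₀ : ∀ x a, 0 < μ₀ x a)
    (L : (x : X) × A x → ℝ) :
    ∃ (c : ℝ) (μ' : Policy A), (∀ x a, 0 < μ' x a) ∧ ∀ m : Policy A,
      planLoss hist m L + dilatedDiv hist η m μ₀ = c + dilatedDiv hist η m μ' := by
  classical
  -- `F x` is the optimal regularized loss of the subtree at `x`. The tilt of `μ₀ x` by the loss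
  -- plus the values of the children is the optimal local policy.
  obtain ⟨F, hF⟩ := exists_childSum_fixpoint hist fun x S =>
    -(1 / η x) * Real.log (∑ a, μ₀ x a * Real.exp (-η x * (L ⟨x, a⟩ + S a)))
  have hpos : ∀ x a, 0 < tilt (μ₀ x) (η x) (fun a => L ⟨x, a⟩ + childSum hist F ⟨x, a⟩) a :=
    fun x a => tilt_pos (h₀ x) (policy_sum μ₀ x) _ _ a
  refine ⟨∑ x, if hist x = [] then F x else 0, fun x => ⟨tilt (μ₀ x) (η x) fun a =>
    L ⟨x, a⟩ + childSum hist F ⟨x, a⟩, fun a => (hpos x a).le,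
    tilt_sum (h₀ x) (policy_sum μ₀ x) _ _⟩, hpos, fun m => ?_⟩
  rw [← sum_reachPlan_mul_sub ht m F, dilatedDiv_eq_sum_relEntropy, dilatedDiv_eq_sum_relEntropy,
    planLoss, ← Finset.sum_add_distrib, ← Finset.sum_add_distrib]
  refine Finset.sum_congr rfl fun x _ => ?_
  have h := sum_mul_add_relEntropy (h₀ x) (policy_sum μ₀ x) (policy_nonneg m x) (policy_sum m x)
    (hη x) fun a => L ⟨x, a⟩ + childSum hist F ⟨x, a⟩
  rw [← hF x] at h
  simp_rw [mul_add, Finset.sum_add_distrib] at h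
  simp_rw [plan_eq, mul_assoc, ← Finset.mul_sum, ← mul_add]
  congr 1
  change _ = _ + relEntropy (m x) (tilt (μ₀ x) (η x) _) / η x
  linarith

omit [Fintype X] in
lemma reachPlan_mul_relEntropy_nonneg (hist : X → List ((x : X) × A x)) {η : X → ℝ}
    (hη : ∀ x, 0 < η x) (m : Policy A) {m₀ : Policy A} (h₀ : ∀ x a, 0 < m₀ x a) (x : X) :
    0 ≤ reachPlan hist m x * (relEntropy (m x) (m₀ x) / η x) :=
  mul_nonneg (reachPlan_nonneg hist m x) (div_nonneg (relEntropy_nonneg (policy_nonneg m x) (h₀ x)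
    (policy_sum m x) (policy_sum m₀ x)) (hη x).le)

lemma dilatedDiv_nonneg (hist : X → List ((x : X) × A x)) {η : X → ℝ}
    (hη : ∀ x, 0 < η x) (m : Policy A) {m₀ : Policy A} (h₀ : ∀ x a, 0 < m₀ x a) :
    0 ≤ dilatedDiv hist η m m₀ := by
  rw [dilatedDiv_eq_sum_relEntropy]
  exact Finset.sum_nonneg fun x _ => reachPlan_mul_relEntropy_nonneg hist hη m h₀ x

lemma dilatedDiv_self (hist : X → List ((x : X) × A x)) (η : X → ℝ) {m : Policy A}
    (hm : ∀ x a, 0 < m x a) : dilatedDiv hist η m m = 0 := by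
  unfold dilatedDiv
  simp [div_self (hm _ _).ne']

/-- A vanishing divergence gives agreement only where `m` has positive reach. As `m₀` is fully
mixed, agreement at a parent makes the children reachable, so induction from the roots covers the
whole tree. -/
lemma eq_of_dilatedDiv_eq_zero {hist : X → List ((x : X) × A x)} (ht : IsTree hist) {η : X → ℝ}
    (hη : ∀ x, 0 < η x) {m m₀ : Policy A} (h₀ : ∀ x a, 0 < m₀ x a)
    (h : dilatedDiv hist η m m₀ = 0) : m = m₀ := by
  rw [dilatedDiv_eq_sum_relEntropy, Finset.sum_eq_zero_iff_of_nonneg fun x _ =>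
    reachPlan_mul_relEntropy_nonneg hist hη m h₀ x] at h
  have key : ∀ x, 0 < reachPlan hist m x → m x = m₀ x := fun x hx => by
    have h1 := h x (Finset.mem_univ x)
    rw [mul_eq_zero, or_iff_right hx.ne', div_eq_zero_iff, or_iff_left (hη x).ne'] at h1
    exact DFunLike.coe_injective (eq_of_relEntropy_eq_zero (policy_nonneg m x) (h₀ x)
      (policy_sum m x) (policy_sum m₀ x) h1)
  have pos : ∀ x, 0 < reachPlan hist m x := ht.induction
    (fun x hx => by rw [reachPlan_root m hx]; exact one_pos)
    fun x w hx hw => by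
      rw [reachPlan_child m hx]
      change 0 < reachPlan hist m w.1 * m w.1 w.2
      rw [key _ hw]
      exact mul_pos hw (h₀ _ _)
  exact funext fun x => key x (pos x)

/-- A minimizer of the regularized loss is fully mixed, and the excess of the regularized loss is the
dilated divergence from it. -/
lemma isMinOn_regularizedLoss {hist : X → List ((x : X) × A x)} (ht : IsTree hist)
    {η : X → ℝ} (hη : ∀ x, 0 < η x) {μ₀ : Policy A} (h₀ : ∀ x a, 0 < μ₀ x a)
    {L : (x : X) × A x → ℝ} {μ : Policy A}
    (hμ : IsMinOn (fun m : Policy A => planLoss hist m L + dilatedDiv hist η m μ₀) Set.univ μ) :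
    (∀ x a, 0 < μ x a) ∧ ∀ m : Policy A, planLoss hist m L + dilatedDiv hist η m μ₀ =
      planLoss hist μ L + dilatedDiv hist η μ μ₀ + dilatedDiv hist η m μ := by
  obtain ⟨c, μ', hpos, hc⟩ := exists_planLoss_add_dilatedDiv_eq ht hη h₀ L
  have h1 := hμ (Set.mem_univ μ')
  simp only [Set.mem_ofPred_eq, hc, dilatedDiv_self hist η hpos] at h1
  have h2 : μ = μ' := eq_of_dilatedDiv_eq_zero ht hη hpos
    (le_antisymm (by linarith) (dilatedDiv_nonneg hist hη μ hpos))
  subst h2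
  refine ⟨hpos, fun m => ?_⟩
  rw [hc, hc, dilatedDiv_self hist η hpos]
  ring

end Minimizer

end AdaptiveFTRL

/-! ### Exponential weights along a single path. -/

section PathRecursion

lemma exp_neg_mul_le {q : ℝ} (h0 : 0 ≤ q) (h1 : q ≤ 1) (u : ℝ) :
    Real.exp (-(q * u)) ≤ 1 - q + q * Real.exp (-u) := by
  have h := convexOn_exp.2 (Set.mem_univ 0) (Set.mem_univ (-u)) (sub_nonneg.2 h1) h0 (by ring)
  simp only [smul_eq_mul, mul_zero, zero_add, Real.exp_zero, mul_one] at h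
  rwa [← neg_mul_eq_mul_neg] at h

/-- By concavity of b ↦ 1 - exp (-b g), its secant slope from 0 decreases. This allows the potential
(1 - exp (-η g)) / η to pass from the rate of a child to the smaller rate of its parent. -/
lemma one_sub_exp_neg_div_antitone {a b g : ℝ} (ha : 0 < a) (hab : a ≤ b) :
    (1 - Real.exp (-b * g)) / b ≤ (1 - Real.exp (-a * g)) / a := by
  have hb : 0 < b := ha.trans_le hab
  have h := exp_neg_mul_le (div_nonneg ha.le hb.le) ((div_le_one hb).2 hab) (b * g)
  rw [show a / b * (b * g) = a * g by field_simp] at h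
  rw [div_le_div_iff₀ hb ha, neg_mul, neg_mul]
  have h2 : b * Real.exp (-(a * g)) ≤ b - a + a * Real.exp (-(b * g)) := by
    calc b * Real.exp (-(a * g)) ≤ b * (1 - a / b + a / b * Real.exp (-(b * g))) :=
          mul_le_mul_of_nonneg_left h hb.le
      _ = _ := by field_simp
  nlinarith

lemma one_sub_exp_neg_div_le {a g : ℝ} (ha : 0 < a) : (1 - Real.exp (-a * g)) / a ≤ g := by
  rw [div_le_iff₀ ha]
  have := Real.add_one_le_exp (-a * g)
  nlinarith

/-- One step of the backward recursion for the value of exponential weights along a path. -/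
lemma value_step {η q ℓ g : ℝ} (hη : 0 < η) (hq : 0 < q) (hq1 : q ≤ 1) (hℓ : 0 ≤ ℓ) (hg : 0 ≤ g) :
    ∃ G, G = -(1 / η) * Real.log (1 - q + q * Real.exp (-η * (ℓ + g))) ∧ 0 ≤ G ∧ G ≤ q * (ℓ + g) ∧
      q * (ℓ + (1 - Real.exp (-η * g)) / η - η * ℓ * (ℓ + g)) ≤ (1 - Real.exp (-η * G)) / η := by
  have hv : 0 ≤ η * (ℓ + g) := by positivity
  have h1 := exp_neg_mul_le hq.le hq1 (η * (ℓ + g))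
  have hpos : 0 < 1 - q + q * Real.exp (-(η * (ℓ + g))) := (Real.exp_pos _).trans_le h1
  refine ⟨_, rfl, ?_, ?_, ?_⟩
  · rw [neg_mul η, neg_mul, neg_nonneg]
    refine mul_nonpos_of_nonneg_of_nonpos (by positivity) (Real.log_nonpos hpos.le ?_)
    have := Real.exp_le_one_iff.2 (neg_nonpos.2 hv)
    nlinarith
  · rw [neg_mul η, neg_mul, neg_le]
    have := (Real.le_log_iff_exp_le hpos).2 h1
    rw [one_div, inv_mul_eq_div, le_div_iff₀ hη]
    linarith
  -- The potential undoes the logarithm: 1 - exp (-η G) = q (1 - exp (-η (ℓ + g))), so one step acts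
  -- linearly on it.
  · have e : -η * (-(1 / η) * Real.log (1 - q + q * Real.exp (-η * (ℓ + g)))) =
        Real.log (1 - q + q * Real.exp (-(η * (ℓ + g)))) := by
      rw [neg_mul η (ℓ + g)]; field_simp
    rw [e, Real.exp_log hpos, le_div_iff₀ hη]
    have h2 := exp_neg_le_quadratic (x := η * ℓ) (by positivity)
    have h3 : 1 - η * g ≤ Real.exp (-(η * g)) := Real.one_sub_le_exp_neg _
    have h4 : Real.exp (-(η * (ℓ + g))) = Real.exp (-(η * ℓ)) * Real.exp (-(η * g)) := by
      rw [← Real.exp_add]; ring_nf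
    have h5 : 1 - η * ℓ ≤ Real.exp (-(η * ℓ)) := Real.one_sub_le_exp_neg _
    have h6 : Real.exp (-(η * g)) ≤ 1 := Real.exp_le_one_iff.2 (neg_nonpos.2 (by positivity))
    rw [h4, neg_mul]
    have h7 : q * (ℓ + (1 - Real.exp (-(η * g))) / η - η * ℓ * (ℓ + g)) * η =
        q * (η * ℓ + (1 - Real.exp (-(η * g))) - η * ℓ * (η * ℓ + η * g)) := by field_simp
    rw [h7]
    have h8 : η * ℓ + (1 - Real.exp (-(η * g))) - η * ℓ * (η * ℓ + η * g) ≤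
        1 - Real.exp (-(η * ℓ)) * Real.exp (-(η * g)) := by
      have ha : 0 ≤ η * ℓ := by positivity
      have hb : 0 ≤ η * g := by positivity
      generalize η * ℓ = a at *
      generalize η * g = b at *
      generalize Real.exp (-a) = ea at *
      generalize Real.exp (-b) = eb at *
      nlinarith [mul_nonneg ha (sub_nonneg.2 h3), mul_nonneg (sub_nonneg.2 h5) (sub_nonneg.2 h6)]
    nlinarith

/-- Stability of exponential weights along a path with nondecreasing learning rates: changing the
losses on the path lowers the optimal value by a term of first order in the losses. -/
lemma path_stability (N : ℝ) (n : ℕ) (hN : (n : ℝ) ≤ N) (c : ℝ) (hc : 0 < c) (η q ℓ p K : ℕ → ℝ)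
    (hη : ∀ h < n, 0 < η h) (hmono : ∀ h, h + 1 < n → η h ≤ η (h + 1))
    (hq : ∀ h < n, 0 < q h) (hq1 : ∀ h < n, q h ≤ 1) (hℓ : ∀ h < n, 0 ≤ ℓ h)
    (hp : ∀ h < n, 0 ≤ p h)
    (hqℓ : ∀ h < n, c * (∏ i ∈ Finset.range (h + 1), q i) * ℓ h ≤ 1)
    (hK : ∀ h < n, ∀ v, -(1 / η h) * Real.log (1 - q h + q h * Real.exp (-η h * v)) ≤
      K h / η h + p h * v) :
    ∃ G, 0 ≤ G ∧ G ≤ ∑ h ∈ Finset.range n, (∏ i ∈ Finset.range (h + 1), q i) * ℓ h ∧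
      c * ∑ h ∈ Finset.range n, (∏ i ∈ Finset.range (h + 1), q i) * ℓ h ≤ n ∧
      c * (∑ h ∈ Finset.range n, (∏ i ∈ Finset.range (h + 1), q i) * ℓ h -
        (1 - Real.exp (-η 0 * G)) / η 0) ≤ N * ∑ h ∈ Finset.range n, η h * ℓ h ∧
      G ≤ ∑ h ∈ Finset.range n, ((∏ i ∈ Finset.range h, p i) * (K h / η h) +
        (∏ i ∈ Finset.range (h + 1), p i) * ℓ h) := by
  induction n generalizing c η q ℓ p K with
  | zero => exact ⟨0, by simp⟩
  | succ n ih =>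
    push_cast at hN
    have hq0 := hq 0 (by omega)
    have hη0 := hη 0 (by omega)
    have hℓ0 := hℓ 0 (by omega)
    -- The scale `c` carries the probability of the steps already peeled off; the tail of the path
    -- is handled with c * q 0.
    obtain ⟨g, hg0, hgW, hcW, hstab, hgK⟩ := ih (by linarith) (c * q 0) (by positivity)
      (fun h => η (h + 1)) (fun h => q (h + 1)) (fun h => ℓ (h + 1)) (fun h => p (h + 1))
      (fun h => K (h + 1)) (fun h hh => hη _ (by omega)) (fun h hh => hmono _ (by omega))
      (fun h hh => hq _ (by omega)) (fun h hh => hq1 _ (by omega)) (fun h hh => hℓ _ (by omega))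
      (fun h hh => hp _ (by omega))
      (fun h hh => by
        have := hqℓ (h + 1) (by omega)
        rw [Finset.prod_range_succ'] at this
        convert this using 1
        ring)
      (fun h hh => hK _ (by omega))
    obtain ⟨G, hG, hG0, hGle, hGE⟩ := value_step hη0 hq0 (hq1 0 (by omega)) hℓ0 hg0
    have eW : ∑ h ∈ Finset.range (n + 1), (∏ i ∈ Finset.range (h + 1), q i) * ℓ h =
        q 0 * (ℓ 0 + ∑ h ∈ Finset.range n, (∏ i ∈ Finset.range (h + 1), q (i + 1)) * ℓ (h + 1)) := by
      rw [Finset.sum_range_succ', mul_add, Finset.mul_sum, add_comm]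
      simp only [zero_add, Finset.prod_range_one]
      congr 1
      refine Finset.sum_congr rfl fun h _ => ?_
      rw [Finset.prod_range_succ']
      ring
    have eP : ∑ h ∈ Finset.range (n + 1), ((∏ i ∈ Finset.range h, p i) * (K h / η h) +
        (∏ i ∈ Finset.range (h + 1), p i) * ℓ h) =
        K 0 / η 0 + p 0 * (ℓ 0 + ∑ h ∈ Finset.range n, ((∏ i ∈ Finset.range h, p (i + 1)) *
          (K (h + 1) / η (h + 1)) + (∏ i ∈ Finset.range (h + 1), p (i + 1)) * ℓ (h + 1))) := by
      rw [Finset.sum_range_succ', mul_add, Finset.mul_sum, add_comm]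
      simp only [zero_add, Finset.prod_range_one, Finset.prod_range_zero, one_mul]
      rw [add_assoc]
      congr 2
      refine Finset.sum_congr rfl fun h _ => ?_
      rw [Finset.prod_range_succ' _ (h + 1), Finset.prod_range_succ' _ h]
      ring
    rw [eW, eP, Finset.sum_range_succ' (fun h => η h * ℓ h)]
    set W := ∑ h ∈ Finset.range n, (∏ i ∈ Finset.range (h + 1), q (i + 1)) * ℓ (h + 1)
    have hmul : q 0 * (ℓ 0 + g) ≤ q 0 * (ℓ 0 + W) := by gcongr
    have hcW' : c * (q 0 * (ℓ 0 + W)) ≤ (n : ℝ) + 1 := by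
      have := hqℓ 0 (by omega)
      simp only [zero_add, Finset.prod_range_one] at this
      linarith
    refine ⟨G, hG0, hGle.trans hmul, by push_cast; exact hcW', ?_, ?_⟩
    -- For an empty tail η 1 is unconstrained, but then g = 0.
    · have hE : (1 - Real.exp (-η 1 * g)) / η 1 ≤ (1 - Real.exp (-η 0 * g)) / η 0 := by
        rcases Nat.eq_zero_or_pos n with h | h
        · subst h
          have : g = 0 := le_antisymm (by simpa [W] using hgW) hg0
          simp [this]
        · exact one_sub_exp_neg_div_antitone hη0 (hmono 0 (by omega))
      simp only [zero_add] at hstab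
      -- The second-order error of `value_step` becomes first order in the losses, because the
      -- weighted sum of the remaining losses is at most the number of remaining steps, hence at
      -- most N.
      have h1 : c * (η 0 * ℓ 0 * (q 0 * (ℓ 0 + W))) ≤ N * (η 0 * ℓ 0) := by
        have := mul_le_mul_of_nonneg_left (hcW'.trans hN) (mul_nonneg hη0.le hℓ0)
        linarith
      have h2 : c * (η 0 * ℓ 0 * (q 0 * (ℓ 0 + g))) ≤ c * (η 0 * ℓ 0 * (q 0 * (ℓ 0 + W))) := by
        gcongr
      have h3 := mul_le_mul_of_nonneg_left hGE hc.le
      have h4 := mul_le_mul_of_nonneg_left hE (mul_nonneg hc.le hq0.le)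
      linarith
    · rw [hG]
      refine (hK 0 (by omega) _).trans ?_
      have := hp 0 (by omega)
      gcongr

end PathRecursion

/-! ### Stability for the losses of one episode. -/

namespace AdaptiveFTRL

section Path

variable {X : Type*} {A : X → Type*} {H : ℕ}

/-- The information sets and actions of an episode are compatible with the histories. -/
def IsPath (hist : X → List ((x : X) × A x)) (path : Fin H → (x : X) × A x) : Prop :=
  ∀ h : Fin H, hist (path h).1 = (List.ofFn path).take h

variable {hist : X → List ((x : X) × A x)} {path : Fin H → (x : X) × A x}

lemma IsPath.length_hist (hp : IsPath hist path) (h : Fin H) : (hist (path h).1).length = h := by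
  rw [hp h, List.length_take, List.length_ofFn]
  omega

lemma IsPath.injective (hp : IsPath hist path) : Function.Injective fun h => (path h).1 :=
  fun h h' e => Fin.ext (by rw [← hp.length_hist h, ← hp.length_hist h']; exact congrArg _ (congrArg hist e))

lemma IsPath.hist_succ (hp : IsPath hist path) {h : ℕ} (hh : h + 1 < H) :
    hist (path ⟨h + 1, hh⟩).1 = hist (path ⟨h, by omega⟩).1 ++ [path ⟨h, by omega⟩] := by
  rw [hp, hp, List.take_add_one]
  simp [show h < H by omega]

variable [∀ x, Fintype (A x)]

lemma IsPath.reachPlan_eq_prod (hp : IsPath hist path) (m : Policy A) {h : ℕ} (hh : h < H) :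
    reachPlan hist m (path ⟨h, hh⟩).1 = ∏ i ∈ Finset.range h,
      if hi : i < H then m (path ⟨i, hi⟩).1 (path ⟨i, hi⟩).2 else 1 := by
  induction h with
  | zero => exact reachPlan_root m (by rw [hp]; simp)
  | succ h ih =>
    rw [reachPlan_child m (hp.hist_succ hh), Finset.prod_range_succ, ← ih (by omega),
      dif_pos (show h < H by omega)]
    rfl

lemma IsPath.plan_eq_prod (hp : IsPath hist path) (m : Policy A) {h : ℕ} (hh : h < H) :
    plan hist m (path ⟨h, hh⟩) = ∏ i ∈ Finset.range (h + 1),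
      if hi : i < H then m (path ⟨i, hi⟩).1 (path ⟨i, hi⟩).2 else 1 := by
  rw [Finset.prod_range_succ, ← hp.reachPlan_eq_prod m hh, dif_pos hh]
  rfl

/-- Stability of the dilated divergence with respect to losses on one path. -/
lemma IsPath.stability [Fintype X] (hp : IsPath hist path) {η : X → ℝ} (hη : ∀ x, 0 < η x)
    (hmono : ∀ x w, hist x = hist w.1 ++ [w] → η w.1 ≤ η x) {μ : Policy A}
    (hμ : ∀ x a, 0 < μ x a) {ℓ : Fin H → ℝ} (hℓ : ∀ h, 0 ≤ ℓ h)
    (hμℓ : ∀ h, plan hist μ (path h) * ℓ h ≤ 1) (m : Policy A) :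
    ∑ h, plan hist μ (path h) * ℓ h - H * ∑ h, η (path h).1 * ℓ h ≤
      dilatedDiv hist η m μ + ∑ h, plan hist m (path h) * ℓ h := by
  rcases Nat.eq_zero_or_pos H with h0 | h0
  · subst h0
    simpa using dilatedDiv_nonneg hist hη m hμ
  -- The data along the path are extended to ℕ by the harmless default 1.
  let η' : ℕ → ℝ := fun i => if hi : i < H then η (path ⟨i, hi⟩).1 else 1
  let ℓ' : ℕ → ℝ := fun i => if hi : i < H then ℓ ⟨i, hi⟩ else 1
  let P : Policy A → ℕ → ℝ := fun m i => if hi : i < H then m (path ⟨i, hi⟩).1 (path ⟨i, hi⟩).2 else 1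
  let K : ℕ → ℝ := fun i =>
    if hi : i < H then relEntropy (m (path ⟨i, hi⟩).1) (μ (path ⟨i, hi⟩).1) else 1
  obtain ⟨G, -, -, -, hG, hGm⟩ := path_stability H H le_rfl 1 one_pos η' (P μ) ℓ' (P m) K
    (fun h hh => by simp only [η', dif_pos hh, hη])
    (fun h hh => by
      simp only [η', dif_pos hh, dif_pos (show h < H by omega)]
      exact hmono _ _ (hp.hist_succ hh))
    (fun h hh => by simp only [P, dif_pos hh, hμ])
    (fun h hh => by simp only [P, dif_pos hh, policy_le_one])
    (fun h hh => by simp only [ℓ', dif_pos hh, hℓ])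
    (fun h hh => by simp only [P, dif_pos hh, policy_nonneg])
    (fun h hh => by
      rw [one_mul, ← hp.plan_eq_prod μ hh]
      simp only [ℓ', dif_pos hh, hμℓ])
    (fun h hh v => by
      simp only [P, K, η', dif_pos hh]
      exact neg_log_le_relEntropy_add (hμ _) (policy_sum μ _) (policy_nonneg m _) (policy_sum m _)
        (hη _) _ v)
  have e1 : ∀ m' : Policy A, ∑ h, plan hist m' (path h) * ℓ h =
      ∑ h ∈ Finset.range H, (∏ i ∈ Finset.range (h + 1), P m' i) * ℓ' h := fun m' => by
    rw [Finset.sum_range]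
    refine Finset.sum_congr rfl fun h _ => ?_
    rw [← hp.plan_eq_prod m' h.2]
    simp only [ℓ', dif_pos h.2]
  have e2 : ∑ h, η (path h).1 * ℓ h = ∑ h ∈ Finset.range H, η' h * ℓ' h := by
    rw [Finset.sum_range]
    refine Finset.sum_congr rfl fun h _ => ?_
    simp only [ℓ', η', dif_pos h.2]
  -- The path meets distinct information sets, and the divergence terms of all the others are
  -- nonnegative and can be dropped.
  have e3 : ∑ h ∈ Finset.range H, (∏ i ∈ Finset.range h, P m i) * (K h / η' h) ≤
      dilatedDiv hist η m μ := by
    classical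
    rw [dilatedDiv_eq_sum_relEntropy, Finset.sum_range]
    calc _ = ∑ h : Fin H, reachPlan hist m (path h).1 *
          (relEntropy (m (path h).1) (μ (path h).1) / η (path h).1) := by
          refine Finset.sum_congr rfl fun h _ => ?_
          rw [← hp.reachPlan_eq_prod m h.2]
          simp only [K, η', dif_pos h.2]
      _ = ∑ x ∈ Finset.univ.image fun h => (path h).1,
          reachPlan hist m x * (relEntropy (m x) (μ x) / η x) := by
          rw [Finset.sum_image fun _ _ _ _ e => hp.injective e]
      _ ≤ _ := Finset.sum_le_univ_sum_of_nonneg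
          fun x => reachPlan_mul_relEntropy_nonneg hist hη m hμ x
  rw [Finset.sum_add_distrib, ← e1 m] at hGm
  rw [one_mul, ← e1 μ, ← e2] at hG
  have hη0 : 0 < η' 0 := by simp only [η', dif_pos h0, hη]
  have := one_sub_exp_neg_div_le (g := G) hη0
  linarith

end Path

end AdaptiveFTRL

/-! ### Regret of the algorithm on its own estimates. -/

namespace AdaptiveFTRL

section Run

variable {X : Type*} {A : X → Type*}

lemma IsTree.precedes_of_child {hist : X → List ((x : X) × A x)} (ht : IsTree hist) {x : X}
    {w : (x : X) × A x} (h : hist x = hist w.1 ++ [w]) {x' : X} (hx : Precedes hist x x') :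
    Precedes hist w.1 x' := by
  rcases hx with rfl | ⟨a, ha⟩
  · exact Or.inr ⟨w.2, by rw [h]; simp⟩
  · obtain ⟨l, l', hl⟩ := List.append_of_mem ha
    refine Or.inr ⟨w.2, ?_⟩
    rw [hl, ← ht _ _ _ _ hl, h]
    simp

variable [Fintype X] [∀ x, Fintype (A x)]

lemma planLoss_eq_sum (hist : X → List ((x : X) × A x)) (m : Policy A) (L : (x : X) × A x → ℝ) :
    planLoss hist m L = ∑ z, plan hist m z * L z := by
  rw [Fintype.sum_sigma]; rfl

omit [Fintype X] [∀ x, Fintype (A x)] in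
lemma sum_mul_sum_ite {Z : Type*} [Fintype Z] [DecidableEq Z] {H : ℕ} (path : Fin H → Z) (f : Z → ℝ)
    (g : Fin H → Z → ℝ) :
    ∑ z, f z * ∑ h, (if path h = z then g h z else 0) = ∑ h, f (path h) * g h (path h) := by
  simp_rw [Finset.mul_sum]
  rw [Finset.sum_comm]
  simp

variable {H : ℕ} (hist : X → List ((x : X) × A x)) {γ : ℝ} (μ : ℕ → Policy A)
  (path : ℕ → Fin H → (x : X) × A x) (loss : ℕ → Fin H → ℝ)

variable (γ) in
/-- Estimated loss of step `h` of episode `t`. -/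
noncomputable def lossEst (t : ℕ) (h : Fin H) : ℝ :=
  loss t h / (plan hist (μ t) (path t h) + ixParam hist γ μ path t (path t h))

omit [Fintype X] in
lemma cumTrans_nonneg (hγ : 0 ≤ γ) (t : ℕ) (z : (x : X) × A x) :
    0 ≤ cumTrans hist γ μ path t z := by
  induction t with
  | zero => exact le_rfl
  | succ t ih =>
    refine add_nonneg ih (Finset.sum_nonneg fun h _ => ?_)
    split_ifs
    · exact div_nonneg zero_le_one (add_nonneg (plan_nonneg _ _ _) (by positivity))
    · exact le_rfl

variable (γ) in
omit [Fintype X] in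
open Classical in
lemma cumTrans_succ (t : ℕ) (z : (x : X) × A x) :
    cumTrans hist γ μ path (t + 1) z = cumTrans hist γ μ path t z + ∑ h : Fin H,
      if path t h = z then 1 / (plan hist (μ t) z + ixParam hist γ μ path t z) else 0 := rfl

omit [Fintype X] in
lemma ixParam_pos (hγ : 0 < γ) (t : ℕ) (z : (x : X) × A x) : 0 < ixParam hist γ μ path t z :=
  div_pos hγ (by have := cumTrans_nonneg hist μ path hγ.le t z; linarith)

omit [Fintype X] in
lemma plan_add_ixParam_pos (hγ : 0 < γ) (t : ℕ) (m : Policy A) (z : (x : X) × A x) :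
    0 < plan hist m z + ixParam hist γ μ path t z :=
  add_pos_of_nonneg_of_pos (plan_nonneg _ _ _) (ixParam_pos hist μ path hγ t z)

omit [Fintype X] in
lemma cumTrans_le_succ (hγ : 0 < γ) (t : ℕ) (z : (x : X) × A x) :
    cumTrans hist γ μ path t z ≤ cumTrans hist γ μ path (t + 1) z := by
  rw [cumTrans_succ]
  refine le_add_of_nonneg_right (Finset.sum_nonneg fun h _ => ?_)
  split_ifs
  · exact div_nonneg zero_le_one (plan_add_ixParam_pos hist μ path hγ t _ z).le
  · exact le_rfl

omit [Fintype X] in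
lemma cumTrans_mono (hγ : 0 < γ) (z : (x : X) × A x) :
    Monotone fun t => cumTrans hist γ μ path t z :=
  monotone_nat_of_le_succ fun t => cumTrans_le_succ hist μ path hγ t z

omit [Fintype X] in
lemma cumTransAvg_nonneg (hγ : 0 ≤ γ) (t : ℕ) (x : X) : 0 ≤ cumTransAvg hist γ μ path t x :=
  div_nonneg (Finset.sum_nonneg fun _ _ => cumTrans_nonneg hist μ path hγ _ _) (Nat.cast_nonneg _)

omit [Fintype X] in
lemma cumTransAvg_mono (hγ : 0 < γ) (x : X) : Monotone fun t => cumTransAvg hist γ μ path t x :=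
  fun _ _ h => div_le_div_of_nonneg_right
    (Finset.sum_le_sum fun _ _ => cumTrans_mono hist μ path hγ _ h) (Nat.cast_nonneg _)

instance (x : X) : Nonempty {x' : X // Precedes hist x x'} := ⟨⟨x, Or.inl rfl⟩⟩

lemma exists_learningRate_eq (η : ℝ) (t : ℕ) (x : X) : ∃ x', Precedes hist x x' ∧
    learningRate hist γ μ path η t x = η / (1 + cumTransAvg hist γ μ path t x') := by
  obtain ⟨⟨x', hx⟩, h⟩ := exists_eq_ciInf_of_finite
    (f := fun x' : {x' : X // Precedes hist x x'} => η / (1 + cumTransAvg hist γ μ path t x'))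
  exact ⟨x', hx, h.symm⟩

lemma learningRate_le {x x' : X} (hx : Precedes hist x x') (η : ℝ) (t : ℕ) :
    learningRate hist γ μ path η t x ≤ η / (1 + cumTransAvg hist γ μ path t x') :=
  ciInf_le (Set.finite_range
    fun x' : {x' : X // Precedes hist x x'} => η / (1 + cumTransAvg hist γ μ path t x')).bddBelow
    ⟨x', hx⟩

lemma learningRate_pos (hγ : 0 < γ) {η : ℝ} (hη : 0 < η) (t : ℕ) (x : X) :
    0 < learningRate hist γ μ path η t x := by
  obtain ⟨x', -, h⟩ := exists_learningRate_eq hist (γ := γ) μ path η t x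
  rw [h]
  have := cumTransAvg_nonneg hist μ path hγ.le t x'
  positivity

lemma learningRate_antitone (hγ : 0 < γ) {η : ℝ} (hη : 0 < η) (x : X) :
    Antitone fun t => learningRate hist γ μ path η t x := fun s t hst => by
  obtain ⟨x', hx, h⟩ := exists_learningRate_eq hist (γ := γ) μ path η s x
  change _ ≤ learningRate hist γ μ path η s x
  rw [h]
  refine (learningRate_le hist μ path hx η t).trans ?_
  have h1 := cumTransAvg_nonneg hist μ path hγ.le s x'
  have h2 := cumTransAvg_mono hist μ path hγ x' hst
  simp only at h2
  gcongr

variable {hist}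

/-- The descendants of a child are among those of its parent, so the parent's minimum runs over a
larger set. -/
lemma learningRate_le_child (ht : IsTree hist) (η : ℝ) (t : ℕ) {x : X} {w : (x : X) × A x}
    (h : hist x = hist w.1 ++ [w]) :
    learningRate hist γ μ path η t w.1 ≤ learningRate hist γ μ path η t x := by
  obtain ⟨x', hx, e⟩ := exists_learningRate_eq hist (γ := γ) μ path η t x
  rw [e]
  exact learningRate_le hist μ path (ht.precedes_of_child h hx) η t

variable (hist)

lemma planLoss_cumLoss_succ (m : Policy A) (t : ℕ) :
    planLoss hist m (cumLoss hist γ μ path loss (t + 1)) =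
      planLoss hist m (cumLoss hist γ μ path loss t) +
        ∑ h, plan hist m (path t h) * lossEst hist γ μ path loss t h := by
  classical
  simp only [planLoss_eq_sum, cumLoss, Finset.sum_range_succ, mul_add, Finset.sum_add_distrib]
  rw [sum_mul_sum_ite (path t) (plan hist m) fun h z =>
    loss t h / (plan hist (μ t) z + ixParam hist γ μ path t z)]
  rfl

/-- Learning rates decrease with time, so the regularizer only grows; this lets the leader argument
pass from one episode to the next. -/
lemma dilatedDiv_learningRate_mono [∀ x, Nonempty (A x)] (hγ : 0 < γ) {η : ℝ} (hη : 0 < η)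
    (m : Policy A) : Monotone fun t =>
      dilatedDiv hist (learningRate hist γ μ path η t) m (uniformPolicy A) := fun s t hst => by
  simp only [dilatedDiv_eq_sum_relEntropy]
  refine Finset.sum_le_sum fun x _ => mul_le_mul_of_nonneg_left ?_ (reachPlan_nonneg _ _ _)
  exact div_le_div_of_nonneg_left (relEntropy_nonneg (policy_nonneg m x) (uniformPolicy_pos x)
    (policy_sum m x) (policy_sum _ x)) (learningRate_pos hist μ path hγ hη t x)
    (learningRate_antitone hist μ path hγ hη x hst)

variable {hist}

omit [Fintype X] in
lemma plan_mul_lossEst_le (hγ : 0 < γ) {loss : ℕ → Fin H → ℝ} {t : ℕ} {h : Fin H}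
    (h1 : loss t h ≤ 1) :
    plan hist (μ t) (path t h) * lossEst hist γ μ path loss t h ≤ 1 := by
  have h2 := plan_nonneg hist (μ t) (path t h)
  have h3 := ixParam_pos hist μ path hγ t (path t h)
  rw [lossEst, mul_div_assoc', div_le_one (by linarith)]
  nlinarith

/-- The regret of follow the regularized leader on the estimated losses. -/
lemma regret_lossEst_le [∀ x, Nonempty (A x)] (ht : IsTree hist) (hγ : 0 < γ) {η : ℝ} (hη : 0 < η)
    {T : ℕ} (hpath : ∀ t < T, IsPath hist (path t)) (hloss0 : ∀ t < T, ∀ h, 0 ≤ loss t h)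
    (hloss1 : ∀ t < T, ∀ h, loss t h ≤ 1)
    (hrun : IsRun hist η γ (uniformPolicy A) T μ path loss) (m : Policy A) :
    ∑ t ∈ Finset.range T, (∑ h, plan hist (μ t) (path t h) * lossEst hist γ μ path loss t h -
      H * ∑ h, learningRate hist γ μ path η t (path t h).1 * lossEst hist γ μ path loss t h) ≤
      planLoss hist m (cumLoss hist γ μ path loss T) +
        dilatedDiv hist (learningRate hist γ μ path η (T - 1)) m (uniformPolicy A) := by
  induction T generalizing m with
  | zero =>
    have := dilatedDiv_nonneg hist (learningRate_pos hist μ path hγ hη 0) m uniformPolicy_pos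
    simpa [planLoss, cumLoss] using this
  | succ T ih =>
    -- The induction hypothesis is used with the next leader μ T as comparator. The gap from μ T to
    -- `m` in the regularized loss is then the divergence that pays for stability.
    have ih := ih (fun t h => hpath t (by omega)) (fun t h => hloss0 t (by omega))
      (fun t h => hloss1 t (by omega)) (fun t h => hrun t (by omega)) (μ T)
    obtain ⟨hpos, heq⟩ := isMinOn_regularizedLoss ht (learningRate_pos hist μ path hγ hη T)
      uniformPolicy_pos (hrun T (by omega))
    have hst := (hpath T (by omega)).stability (learningRate_pos hist μ path hγ hη T)
      (fun x w h => learningRate_le_child μ path ht η T h) hpos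
      (ℓ := lossEst hist γ μ path loss T)
      (fun h => div_nonneg (hloss0 T (by omega) h) (plan_add_ixParam_pos hist μ path hγ T _ _).le)
      (fun h => plan_mul_lossEst_le μ path hγ (hloss1 T (by omega) h)) m
    -- For T = 0 truncated subtraction gives the rate of episode 0 on both sides.
    have hmono := dilatedDiv_learningRate_mono hist μ path hγ hη (μ T) (Nat.sub_le T 1)
    simp only at hmono
    rw [Finset.sum_range_succ, planLoss_cumLoss_succ, Nat.add_sub_cancel]
    have := heq m
    linarith

omit [Fintype X] [∀ x, Fintype (A x)] in
lemma sum_ite_le_of_injective {H : ℕ} {p : Fin H → Prop} [DecidablePred p]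
    (hp : ∀ h h', p h → p h' → h = h') {f : Fin H → ℝ} {B : ℝ} (hB : 0 ≤ B) (hf : ∀ h, p h → f h ≤ B) :
    ∑ h, (if p h then f h else 0) ≤ B := by
  by_cases hex : ∃ h, p h
  · obtain ⟨h, hh⟩ := hex
    rw [Finset.sum_eq_single h (fun h' _ hne => if_neg fun h2 => hne (hp _ _ h2 hh)) (by simp),
      if_pos hh]
    exact hf h hh
  · rw [Finset.sum_eq_zero fun h _ => if_neg fun h2 => hex ⟨h, h2⟩]
    exact hB

omit [Fintype X] in
-- A pair is visited at most once per episode, and a visit adds at most 1/γᵗ = (1 + P)/γ. The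
-- condition γ ≥ 1 is what keeps the relative increments below 1.
lemma cumTrans_increment_le (hγ : 1 ≤ γ) {t : ℕ} (hpath : IsPath hist (path t))
    (z : (x : X) × A x) : cumTrans hist γ μ path (t + 1) z - cumTrans hist γ μ path t z ≤
      1 + cumTrans hist γ μ path t z := by
  classical
  have h0 := cumTrans_nonneg hist μ path (zero_le_one.trans hγ) t z
  rw [cumTrans_succ, add_sub_cancel_left]
  refine sum_ite_le_of_injective (fun h h' e e' => hpath.injective (by simp only [e, e']))
    (by linarith) fun h _ => ?_
  rw [div_le_iff₀ (plan_add_ixParam_pos hist μ path (by linarith) t _ z)]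
  have h1 := plan_nonneg hist (μ t) z
  have h2 : (1 + cumTrans hist γ μ path t z) * ixParam hist γ μ path t z = γ := by
    rw [ixParam]; field_simp
  nlinarith

omit [Fintype X] in
lemma cumTransAvg_increment_le (hγ : 1 ≤ γ) {t : ℕ} (hpath : IsPath hist (path t))
    (x : X) : cumTransAvg hist γ μ path (t + 1) x - cumTransAvg hist γ μ path t x ≤
      1 + cumTransAvg hist γ μ path t x := by
  classical
  rcases isEmpty_or_nonempty (A x) with hA | hA
  · simp [cumTransAvg]
  have hcard : (1 : ℝ) ≤ Fintype.card (A x) := by exact_mod_cast Fintype.card_pos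
  have h0 := fun z => cumTrans_nonneg hist μ path (zero_le_one.trans hγ) t z
  unfold cumTransAvg
  rw [← sub_div, ← Finset.sum_sub_distrib, div_le_iff₀ (by linarith), add_mul,
    div_mul_cancel₀ _ (by linarith : (Fintype.card (A x) : ℝ) ≠ 0), one_mul]
  -- Summing over the actions leaves one term for each step at `x`, and an episode has at most one
  -- such step.
  have key : ∑ a, (cumTrans hist γ μ path (t + 1) ⟨x, a⟩ - cumTrans hist γ μ path t ⟨x, a⟩) =
      ∑ h, if (path t h).1 = x then
        1 / (plan hist (μ t) (path t h) + ixParam hist γ μ path t (path t h)) else 0 := by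
    simp_rw [cumTrans_succ, add_sub_cancel_left]
    rw [Finset.sum_comm]
    refine Finset.sum_congr rfl fun h _ => ?_
    split_ifs with hx
    · subst hx
      rw [Finset.sum_eq_single (path t h).2 (fun a _ ha => if_neg fun e => ha ?_) (by simp),
        if_pos rfl]
      exact (eq_of_heq (Sigma.mk.inj_iff.1 e).2).symm
    · exact Finset.sum_eq_zero fun a _ => if_neg fun e => hx (by rw [e])
  rw [key]
  refine sum_ite_le_of_injective (fun h h' e e' => hpath.injective (by simp only [e, e']))
    (add_nonneg (by linarith) (Finset.sum_nonneg fun _ _ => h0 _)) fun h hx => ?_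
  subst hx
  rw [div_le_iff₀ (plan_add_ixParam_pos hist μ path (by linarith) t _ _)]
  have h1 := plan_nonneg hist (μ t) (path t h)
  have h2 : (1 + cumTrans hist γ μ path t (path t h)) * ixParam hist γ μ path t (path t h) = γ := by
    have := h0 (path t h)
    rw [ixParam]; field_simp
  have h3 : cumTrans hist γ μ path t (path t h) ≤ ∑ a, cumTrans hist γ μ path t ⟨(path t h).1, a⟩ :=
    Finset.single_le_sum (f := fun a => cumTrans hist γ μ path t ⟨(path t h).1, a⟩)
      (fun _ _ => h0 _) (Finset.mem_univ (path t h).2)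
  have h4 := ixParam_pos hist μ path (by linarith : 0 < γ) t (path t h)
  have h5 := h0 (path t h)
  nlinarith

/-- The weighted learning rates sum to a logarithm of the estimated transitions. -/
lemma sum_learningRate_mul_lossEst_le (hγ : 1 ≤ γ) {η : ℝ} (hη : 0 < η)
    {T : ℕ} (hpath : ∀ t < T, IsPath hist (path t)) (hloss0 : ∀ t < T, ∀ h, 0 ≤ loss t h)
    (hloss1 : ∀ t < T, ∀ h, loss t h ≤ 1) :
    ∑ t ∈ Finset.range T, ∑ h, learningRate hist γ μ path η t (path t h).1 *
      lossEst hist γ μ path loss t h ≤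
    η * ∑ x, Fintype.card (A x) * Real.logb 2 (1 + cumTransAvg hist γ μ path T x) := by
  classical
  have hγ0 : 0 < γ := by linarith
  have step : ∀ t < T, ∑ h, learningRate hist γ μ path η t (path t h).1 *
      lossEst hist γ μ path loss t h ≤ η * ∑ x, Fintype.card (A x) *
        ((cumTransAvg hist γ μ path (t + 1) x - cumTransAvg hist γ μ path t x) /
          (1 + cumTransAvg hist γ μ path t x)) := fun t ht => by
    -- The minimum defining the rate is bounded by its term at `x` itself, and the estimated loss by
    -- the increment of the estimated transitions.
    calc _ ≤ ∑ h, η / (1 + cumTransAvg hist γ μ path t (path t h).1) *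
          (1 / (plan hist (μ t) (path t h) + ixParam hist γ μ path t (path t h))) := by
          refine Finset.sum_le_sum fun h _ => ?_
          have hd := plan_add_ixParam_pos hist μ path hγ0 t (μ t) (path t h)
          have h2 : 0 ≤ η / (1 + cumTransAvg hist γ μ path t (path t h).1) := by
            have := cumTransAvg_nonneg hist μ path hγ0.le t (path t h).1
            positivity
          exact mul_le_mul (learningRate_le hist μ path (Or.inl rfl) η t)
            (div_le_div_of_nonneg_right (hloss1 t ht h) hd.le)
            (div_nonneg (hloss0 t ht h) hd.le) h2
      _ = ∑ z : (x : X) × A x, η / (1 + cumTransAvg hist γ μ path t z.1) *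
          (cumTrans hist γ μ path (t + 1) z - cumTrans hist γ μ path t z) := by
          simp_rw [cumTrans_succ, add_sub_cancel_left]
          rw [sum_mul_sum_ite (path t) (fun z => η / (1 + cumTransAvg hist γ μ path t z.1))
            fun _ z => 1 / (plan hist (μ t) z + ixParam hist γ μ path t z)]
      _ = _ := by
          rw [Fintype.sum_sigma, Finset.mul_sum]
          refine Finset.sum_congr rfl fun x _ => ?_
          change ∑ a, η / (1 + cumTransAvg hist γ μ path t x) * _ = _
          rw [← Finset.mul_sum, Finset.sum_sub_distrib]
          rcases isEmpty_or_nonempty (A x) with hA | hA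
          · simp
          have hcard : (Fintype.card (A x) : ℝ) ≠ 0 := by
            exact_mod_cast Fintype.card_ne_zero
          rw [show cumTransAvg hist γ μ path (t + 1) x - cumTransAvg hist γ μ path t x =
            (∑ a, cumTrans hist γ μ path (t + 1) ⟨x, a⟩ - ∑ a, cumTrans hist γ μ path t ⟨x, a⟩) /
              Fintype.card (A x) by rw [cumTransAvg, cumTransAvg, sub_div]]
          have := cumTransAvg_nonneg hist μ path hγ0.le t x
          field_simp
  refine (Finset.sum_le_sum fun t ht => step t (Finset.mem_range.1 ht)).trans ?_
  rw [← Finset.mul_sum, Finset.sum_comm]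
  refine mul_le_mul_of_nonneg_left (Finset.sum_le_sum fun x _ => ?_) hη.le
  rw [← Finset.mul_sum]
  refine mul_le_mul_of_nonneg_left ?_ (Nat.cast_nonneg _)
  exact sum_relative_increments_le (P := fun t => cumTransAvg hist γ μ path t x)
    (by simp [cumTransAvg, cumTrans]) (fun t => cumTransAvg_mono hist μ path hγ0 x (Nat.le_succ t)) T
    fun t ht => cumTransAvg_increment_le μ path hγ (hpath t ht) x

/-- The bias of the implicit exploration sums to a logarithm of the estimated transitions. -/
lemma sum_ixParam_div_le (hγ : 1 ≤ γ) {T : ℕ} (hpath : ∀ t < T, IsPath hist (path t)) :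
    ∑ t ∈ Finset.range T, ∑ h, ixParam hist γ μ path t (path t h) /
      (plan hist (μ t) (path t h) + ixParam hist γ μ path t (path t h)) ≤
    γ * ∑ z, Real.logb 2 (1 + cumTrans hist γ μ path T z) := by
  classical
  have hγ0 : 0 < γ := by linarith
  have step : ∀ t, ∑ h, ixParam hist γ μ path t (path t h) /
      (plan hist (μ t) (path t h) + ixParam hist γ μ path t (path t h)) =
      γ * ∑ z, (cumTrans hist γ μ path (t + 1) z - cumTrans hist γ μ path t z) /
          (1 + cumTrans hist γ μ path t z) := fun t => by
    have e : ∀ z, γ * ((cumTrans hist γ μ path (t + 1) z - cumTrans hist γ μ path t z) /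
        (1 + cumTrans hist γ μ path t z)) = γ * (1 + cumTrans hist γ μ path t z)⁻¹ *
        (cumTrans hist γ μ path (t + 1) z - cumTrans hist γ μ path t z) := fun z => by ring
    simp_rw [Finset.mul_sum, e, cumTrans_succ, add_sub_cancel_left, one_div]
    rw [sum_mul_sum_ite (path t) (fun z => γ * (1 + cumTrans hist γ μ path t z)⁻¹)
      fun _ z => (plan hist (μ t) z + ixParam hist γ μ path t z)⁻¹]
    refine Finset.sum_congr rfl fun h _ => ?_
    simp only [ixParam, div_eq_mul_inv]
  simp_rw [step, ← Finset.mul_sum]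
  rw [Finset.sum_comm]
  refine mul_le_mul_of_nonneg_left (Finset.sum_le_sum fun z _ => ?_) hγ0.le
  exact sum_relative_increments_le (P := fun t => cumTrans hist γ μ path t z) rfl
    (fun t => cumTrans_le_succ hist μ path hγ0 t z) T
    fun t ht => cumTrans_increment_le μ path hγ (hpath t ht) z

end Run

end AdaptiveFTRL

/-! ### Episodes as Markov chains, perfect recall and expectations. -/

section ChainOnFin

variable {Z : Type*}

lemma prod_fin_eq_zero_mul_shift {N : ℕ} (hN : 0 < N) (d : Fin N → ℝ) :
    ∏ h, d h = d ⟨0, hN⟩ * ∏ h : Fin N, if hh : h.1 + 1 < N then d ⟨h.1 + 1, hh⟩ else 1 := by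
  obtain ⟨n, rfl⟩ : ∃ n, N = n + 1 := ⟨N - 1, by omega⟩
  rw [Fin.prod_univ_succ, Fin.prod_univ_castSucc (fun h : Fin (n + 1) => dite _ _ _)]
  simp [Fin.succ]

lemma chainWeight_eq_prod_dite {n : ℕ} (w : Z → ℝ) (K : ℕ → Z → Z → ℝ) (τ : Fin (n + 1) → Z) :
    w (τ 0) * ∏ j : Fin (n + 1), (if hj : j.1 + 1 < n + 1 then K j (τ j) (τ ⟨j.1 + 1, hj⟩) else 1) =
      chainWeight w K τ := by
  rw [Fin.prod_univ_castSucc, chainWeight]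
  simp [Fin.succ]

end ChainOnFin

namespace Game

open AdaptiveFTRL

variable {S X Y : Type*} {A : X → Type*} {B : Y → Type*} [Fintype S]

/-- State and actions of both players at one step. -/
abbrev Step (G : Game S A B) : Type _ := (s : S) × (A (G.xOf s) × B (G.yOf s))

/-- Information set and action of the max-player at one step. -/
def maxPair (G : Game S A B) (z : G.Step) : (x : X) × A x := ⟨G.xOf z.1, z.2.1⟩

lemma stepProb_nonneg (G : Game S A B) (τ : G.Traj) (h : Fin G.H) : 0 ≤ G.stepProb τ h := by
  unfold stepProb
  split_ifs
  · exact (G.p _ _ _ _).2.1 _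
  · exact zero_le_one

section Histories

variable {G : Game S A B}

lemma PerfectRecall.maxHist_eq (hG : G.PerfectRecall) {x : X} {l : List ((x : X) × A x)}
    (h : G.IsMaxHistory x l) : G.maxHist x = l :=
  (hG.1 x).unique (Classical.epsilon_spec (hG.1 x).exists) h

lemma PerfectRecall.isPath (hG : G.PerfectRecall) {τ : G.Traj} (hτ : G.Feasible τ) :
    IsPath G.maxHist (G.maxPath τ) := fun h => hG.maxHist_eq ⟨τ, h, hτ, rfl, rfl⟩

lemma PerfectRecall.exists_visit (hG : G.PerfectRecall) (x : X) :
    ∃ (τ : G.Traj) (h : Fin G.H), G.Feasible τ ∧ (G.maxPath τ h).1 = x := by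
  obtain ⟨l, ⟨τ, h, hτ, hx, -⟩, -⟩ := hG.1 x
  exact ⟨τ, h, hτ, hx⟩

/-- The existence half of perfect recall provides a feasible trajectory through each information
set. The prefixes of its history are histories of the information sets met earlier on that
trajectory. -/
lemma PerfectRecall.isTree (hG : G.PerfectRecall) : IsTree G.maxHist := fun x l w l' e => by
  obtain ⟨τ, h, hτ, rfl⟩ := hG.exists_visit x
  have hp := hG.isPath hτ
  rw [hp h] at e
  have hl : l.length < h := by
    have := congrArg List.length e
    simp only [List.length_take, List.length_ofFn, List.length_append, List.length_cons] at this
    omega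
  have hw : G.maxPath τ ⟨l.length, by omega⟩ = w := by
    have h1 := congrArg (fun l' => l'[l.length]?) e
    simpa [List.getElem?_take, hl, show l.length < G.H by omega] using h1
  rw [← hw, hp]
  have h2 := congrArg (List.take l.length) e
  rwa [List.take_take, min_eq_left hl.le, List.take_left'] at h2
  rfl

end Histories

variable [∀ x, Fintype (A x)] [∀ y, Fintype (B y)]

section Expectation

variable (G : Game S A B) (μ : Policy A) (ν : Policy B)

lemma trajProb_nonneg (τ : G.Traj) : 0 ≤ G.trajProb μ ν τ :=
  mul_nonneg (G.p₀.2.1 _) (Finset.prod_nonneg fun h _ => mul_nonneg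
    (mul_nonneg (policy_nonneg μ _ _) (policy_nonneg ν _ _)) (G.stepProb_nonneg τ h))

lemma feasible_of_trajProb_ne_zero {τ : G.Traj} (h : G.trajProb μ ν τ ≠ 0) : G.Feasible τ := by
  unfold trajProb at h
  obtain ⟨h0, h1⟩ := mul_ne_zero_iff.1 h
  refine ⟨lt_of_le_of_ne (G.p₀.2.1 _) h0.symm, fun h => ?_⟩
  have h2 := Finset.prod_ne_zero_iff.1 h1 h (Finset.mem_univ h)
  exact lt_of_le_of_ne (G.stepProb_nonneg τ h) (right_ne_zero_of_mul h2).symm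

/-- Probability of the actions of both players at one step. -/
noncomputable def actProb (z : G.Step) : ℝ := μ (G.xOf z.1) z.2.1 * ν (G.yOf z.1) z.2.2

/-- The transition weights of the chain of steps of an episode. -/
noncomputable def stepKernel (h : ℕ) (z z' : G.Step) : ℝ :=
  (if hh : h < G.H then G.p ⟨h, hh⟩ z.1 z.2.1 z.2.2 z'.1 else 0) * G.actProb μ ν z'

/-- The weights of the first step of an episode. -/
noncomputable def startWeight (z : G.Step) : ℝ := G.p₀ z.1 * G.actProb μ ν z

lemma sum_state_mul_actProb (p : S → ℝ) : ∑ z : G.Step, p z.1 * G.actProb μ ν z = ∑ s, p s := by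
  rw [Fintype.sum_sigma]
  refine Finset.sum_congr rfl fun s _ => ?_
  rw [Fintype.sum_prod_type]
  change ∑ a : A (G.xOf s), ∑ b : B (G.yOf s), p s * (μ (G.xOf s) a * ν (G.yOf s) b) = p s
  simp only [← Finset.mul_sum, policy_sum, mul_one]

lemma sum_stepKernel {h : ℕ} (hh : h < G.H) (z : G.Step) : ∑ z', G.stepKernel μ ν h z z' = 1 := by
  simp only [stepKernel, dif_pos hh]
  rw [G.sum_state_mul_actProb μ ν fun s => G.p ⟨h, hh⟩ z.1 z.2.1 z.2.2 s]
  exact (G.p ⟨h, hh⟩ z.1 z.2.1 z.2.2).2.2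

lemma sum_startWeight : ∑ z, G.startWeight μ ν z = 1 :=
  (G.sum_state_mul_actProb μ ν fun s => G.p₀ s).trans G.p₀.2.2

lemma trajProb_eq_prod (τ : G.Traj) : G.trajProb μ ν τ = G.startWeight μ ν (τ ⟨0, G.H_pos⟩) *
    ∏ h : Fin G.H, if hh : h.1 + 1 < G.H then
      G.stepKernel μ ν h (τ h) (τ ⟨h.1 + 1, hh⟩) else 1 := by
  unfold trajProb startWeight
  rw [Finset.prod_mul_distrib, prod_fin_eq_zero_mul_shift G.H_pos fun h =>
    μ (G.xOf (τ h).1) (τ h).2.1 * ν (G.yOf (τ h).1) (τ h).2.2, mul_assoc, mul_assoc, mul_assoc,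
    ← Finset.prod_mul_distrib, ← mul_assoc (μ _ _)]
  congr 2
  refine Finset.prod_congr rfl fun h _ => ?_
  unfold stepProb stepKernel actProb
  split_ifs with h1 h2
  · ring
  · omega
  · simp

open Classical in
/-- Expectation over the trajectory of an episode. -/
noncomputable def expect (f : G.Traj → ℝ) : ℝ := ∑ τ : G.Traj, G.trajProb μ ν τ * f τ

lemma expect_one : G.expect μ ν (fun _ => 1) = 1 := by
  unfold expect
  simp_rw [trajProb_eq_prod, mul_one]
  have hK := fun (h : ℕ) (hh : h < G.H) => G.sum_stepKernel μ ν hh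
  refine Eq.trans ?_ (G.sum_startWeight μ ν)
  generalize G.startWeight μ ν = w, G.stepKernel μ ν = K at hK ⊢
  have := G.H_pos
  revert hK
  unfold Traj
  generalize_proofs h0
  -- The horizon is a field of `G`; it is replaced by a variable so that it can be written n + 1, as
  -- the chain lemmas require.
  generalize G.H = N at *
  obtain ⟨n, rfl⟩ : ∃ n, N = n + 1 := ⟨N - 1, by omega⟩
  intro hK
  refine Eq.trans ?_ (sum_chainWeight (n := n) w K fun j hj => hK j (by omega))
  simp_rw [← chainWeight_eq_prod_dite]
  rfl

lemma expect_apply {h : ℕ} (hh : h < G.H) (f : G.Step → ℝ) :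
    G.expect μ ν (fun τ => f (τ ⟨h, hh⟩)) =
      ∑ z, chainMarginal (G.startWeight μ ν) (G.stepKernel μ ν) h z * f z := by
  unfold expect
  simp_rw [trajProb_eq_prod]
  have hK := fun (h : ℕ) (hh : h < G.H) => G.sum_stepKernel μ ν hh
  generalize G.startWeight μ ν = w, G.stepKernel μ ν = K at hK ⊢
  revert hK
  unfold Traj
  have := G.H_pos
  generalize_proofs h0
  generalize G.H = N at *
  obtain ⟨n, rfl⟩ : ∃ n, N = n + 1 := ⟨N - 1, by omega⟩
  intro hK
  rw [← sum_chainWeight_mul_apply w K (fun j hj => hK j (by omega)) h hh]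
  simp_rw [← chainWeight_eq_prod_dite]
  rfl

lemma expect_apply₂ {h : ℕ} (hh : h + 1 < G.H) (f : G.Step → G.Step → ℝ) :
    G.expect μ ν (fun τ => f (τ ⟨h, by omega⟩) (τ ⟨h + 1, hh⟩)) =
      ∑ z, ∑ z', chainMarginal (G.startWeight μ ν) (G.stepKernel μ ν) h z *
        G.stepKernel μ ν h z z' * f z z' := by
  unfold expect
  simp_rw [trajProb_eq_prod]
  have hK := fun (h : ℕ) (hh : h < G.H) => G.sum_stepKernel μ ν hh
  generalize G.startWeight μ ν = w, G.stepKernel μ ν = K at hK ⊢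
  revert hK
  unfold Traj
  have := G.H_pos
  generalize_proofs h0
  generalize G.H = N at *
  obtain ⟨n, rfl⟩ : ∃ n, N = n + 1 := ⟨N - 1, by omega⟩
  intro hK
  rw [← sum_chainWeight_mul_apply₂ w K (fun j hj => hK j (by omega)) h hh]
  simp_rw [← chainWeight_eq_prod_dite]
  rfl

lemma expect_mono {f g : G.Traj → ℝ} (h : ∀ τ, G.Feasible τ → f τ ≤ g τ) :
    G.expect μ ν f ≤ G.expect μ ν g := by
  refine Finset.sum_le_sum fun τ _ => ?_
  by_cases h0 : G.trajProb μ ν τ = 0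
  · simp [h0]
  · exact mul_le_mul_of_nonneg_left (h τ (G.feasible_of_trajProb_ne_zero μ ν h0))
      (G.trajProb_nonneg μ ν τ)

lemma expect_add (f g : G.Traj → ℝ) :
    G.expect μ ν (fun τ => f τ + g τ) = G.expect μ ν f + G.expect μ ν g := by
  simp only [expect, mul_add, Finset.sum_add_distrib]

lemma expect_const_mul (c : ℝ) (f : G.Traj → ℝ) :
    G.expect μ ν (fun τ => c * f τ) = c * G.expect μ ν f := by
  simp only [expect, Finset.mul_sum]
  exact Finset.sum_congr rfl fun _ _ => by ring

lemma expect_const (c : ℝ) : G.expect μ ν (fun _ => c) = c := by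
  have := G.expect_const_mul μ ν c fun _ => 1
  rw [expect_one] at this
  simpa using this

lemma expect_sum {ι : Type*} (s : Finset ι) (f : ι → G.Traj → ℝ) :
    G.expect μ ν (fun τ => ∑ i ∈ s, f i τ) = ∑ i ∈ s, G.expect μ ν (f i) := by
  simp only [expect, Finset.mul_sum]
  exact Finset.sum_comm

lemma exists_feasible_of_expect_ne_zero {f : G.Traj → ℝ} (h : G.expect μ ν f ≠ 0) :
    ∃ τ, G.Feasible τ ∧ f τ ≠ 0 := by
  obtain ⟨τ, -, hτ⟩ := Finset.exists_ne_zero_of_sum_ne_zero h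
  exact ⟨τ, G.feasible_of_trajProb_ne_zero μ ν (left_ne_zero_of_mul hτ), right_ne_zero_of_mul hτ⟩

end Expectation

/-! ### Factorization of the marginals of an episode. -/

section StateWeight

/-- The contribution of nature and of the min-player to the probability of a state. -/
noncomputable def stateWeight (G : Game S A B) (ν : Policy B) : ℕ → S → ℝ
  | 0, s => G.p₀ s
  | h + 1, s' => ∑ z : G.Step, stateWeight G ν h z.1 * ν (G.yOf z.1) z.2.2 *
      if hh : h < G.H then G.p ⟨h, hh⟩ z.1 z.2.1 z.2.2 s' else 0

variable (G : Game S A B) (ν : Policy B)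

lemma stateWeight_nonneg (h : ℕ) (s : S) : 0 ≤ G.stateWeight ν h s := by
  induction h generalizing s with
  | zero => exact G.p₀.2.1 s
  | succ h ih =>
    refine Finset.sum_nonneg fun z _ => mul_nonneg (mul_nonneg (ih _) (policy_nonneg ν _ _)) ?_
    split_ifs
    · exact (G.p _ _ _ _).2.1 _
    · exact le_rfl

variable [∀ x, Nonempty (A x)] [∀ y, Nonempty (B y)]

/-- Whatever `ν` is, a state with nonzero weight is also reached under uniform play. Full feasible
trajectories through it are extracted from this, and perfect recall speaks about those. -/
lemma chainMarginal_uniform_pos {h : ℕ} (z : G.Step)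
    (hz : G.stateWeight ν h z.1 ≠ 0) : 0 < chainMarginal
      (G.startWeight (uniformPolicy A) (uniformPolicy B))
      (G.stepKernel (uniformPolicy A) (uniformPolicy B)) h z := by
  have hact : ∀ z, 0 < G.actProb (uniformPolicy A) (uniformPolicy B) z := fun z =>
    mul_pos (uniformPolicy_pos _ _) (uniformPolicy_pos _ _)
  have hker : ∀ h z z', 0 ≤ G.stepKernel (uniformPolicy A) (uniformPolicy B) h z z' :=
    fun h z z' => by
      unfold stepKernel
      split_ifs
      · exact mul_nonneg ((G.p _ _ _ _).2.1 _) (hact _).le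
      · simp
  have hnn : ∀ h z, 0 ≤ chainMarginal (G.startWeight (uniformPolicy A) (uniformPolicy B))
      (G.stepKernel (uniformPolicy A) (uniformPolicy B)) h z := fun h => by
    induction h with
    | zero => exact fun z => mul_nonneg (G.p₀.2.1 _) (hact _).le
    | succ h ih => exact fun z => Finset.sum_nonneg fun z' _ => mul_nonneg (ih z') (hker _ _ _)
  induction h generalizing z with
  | zero => exact mul_pos (lt_of_le_of_ne (G.p₀.2.1 _) hz.symm) (hact z)
  | succ h ih =>
    obtain ⟨z', -, hz'⟩ := Finset.exists_ne_zero_of_sum_ne_zero hz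
    have h1 := right_ne_zero_of_mul hz'
    have h2 := ih z' (left_ne_zero_of_mul (left_ne_zero_of_mul hz'))
    refine Finset.sum_pos' (fun z' _ => mul_nonneg (hnn _ _) (hker _ _ _)) ⟨z', Finset.mem_univ _, ?_⟩
    refine mul_pos h2 (lt_of_le_of_ne (hker _ _ _) (Ne.symm ?_))
    exact mul_ne_zero h1 (hact z).ne'

variable {G} in
lemma PerfectRecall.maxHist_of_p₀_ne_zero (hG : G.PerfectRecall) {s : S} (hs : G.p₀ s ≠ 0) :
    G.maxHist (G.xOf s) = [] := by
  classical
  have z : G.Step := ⟨s, Classical.arbitrary _, Classical.arbitrary _⟩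
  have h1 := G.expect_apply (uniformPolicy A) (uniformPolicy B) G.H_pos
    fun z => if z.1 = s then 1 else 0
  have h2 : G.expect (uniformPolicy A) (uniformPolicy B)
      (fun τ => if (τ ⟨0, G.H_pos⟩).1 = s then 1 else 0) = G.p₀ s := by
    rw [h1]
    calc _ = ∑ z : G.Step, (G.p₀ z.1 * if z.1 = s then 1 else 0) *
          G.actProb (uniformPolicy A) (uniformPolicy B) z := by
          refine Finset.sum_congr rfl fun z _ => ?_
          simp only [chainMarginal, startWeight]
          ring
      _ = _ := by
          rw [G.sum_state_mul_actProb _ _ fun s' => G.p₀ s' * if s' = s then 1 else 0]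
          simp
  obtain ⟨τ, hτ, hf⟩ := G.exists_feasible_of_expect_ne_zero _ _ (h2.trans_ne hs)
  have : (τ ⟨0, G.H_pos⟩).1 = s := by
    by_contra h; simp [h] at hf
  rw [← this]
  exact (hG.isPath hτ ⟨0, G.H_pos⟩).trans (by simp)

variable {G ν} in
lemma PerfectRecall.maxHist_of_step (hG : G.PerfectRecall) {h : ℕ} (hh : h + 1 < G.H) {z : G.Step}
    {s' : S} (hz : G.stateWeight ν h z.1 ≠ 0) (hs : G.p ⟨h, by omega⟩ z.1 z.2.1 z.2.2 s' ≠ 0) :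
    G.maxHist (G.xOf s') = G.maxHist (G.maxPair z).1 ++ [G.maxPair z] := by
  classical
  -- The actions at `s'` are irrelevant. Under uniform play the pair (z, z') has positive
  -- probability, so some feasible trajectory passes through it.
  let z' : G.Step := ⟨s', Classical.arbitrary _, Classical.arbitrary _⟩
  have h1 := G.expect_apply₂ (uniformPolicy A) (uniformPolicy B) hh
    fun y y' => if y = z ∧ y' = z' then 1 else 0
  have h2 : ∑ y, ∑ y', chainMarginal (G.startWeight (uniformPolicy A) (uniformPolicy B))
      (G.stepKernel (uniformPolicy A) (uniformPolicy B)) h y *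
        G.stepKernel (uniformPolicy A) (uniformPolicy B) h y y' *
          (if y = z ∧ y' = z' then 1 else 0) = chainMarginal
      (G.startWeight (uniformPolicy A) (uniformPolicy B))
      (G.stepKernel (uniformPolicy A) (uniformPolicy B)) h z *
        G.stepKernel (uniformPolicy A) (uniformPolicy B) h z z' := by
    rw [Finset.sum_eq_single z (fun y _ hy => by simp [hy]) (by simp),
      Finset.sum_eq_single z' (fun y _ hy => by simp [hy]) (by simp)]
    simp
  rw [h2] at h1
  have h3 : G.stepKernel (uniformPolicy A) (uniformPolicy B) h z z' ≠ 0 := by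
    unfold stepKernel
    rw [dif_pos (by omega)]
    exact mul_ne_zero hs (mul_pos (uniformPolicy_pos _ _) (uniformPolicy_pos _ _)).ne'
  obtain ⟨τ, hτ, hf⟩ := G.exists_feasible_of_expect_ne_zero _ _
    (h1.trans_ne (mul_ne_zero (G.chainMarginal_uniform_pos ν z hz).ne' h3))
  obtain ⟨e1, e2⟩ : τ ⟨h, by omega⟩ = z ∧ τ ⟨h + 1, hh⟩ = z' := by
    by_contra h; simp [h] at hf
  have h4 := (hG.isPath hτ).hist_succ hh
  unfold maxPath at h4
  rw [e1, e2] at h4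
  exact h4

variable {G} in
/-- The marginals of an episode factor into the contributions of the players. -/
lemma PerfectRecall.chainMarginal_eq (hG : G.PerfectRecall) (μ : Policy A) {h : ℕ} (hh : h < G.H)
    (z : G.Step) : chainMarginal (G.startWeight μ ν) (G.stepKernel μ ν) h z =
      reachPlan G.maxHist μ (G.xOf z.1) * G.stateWeight ν h z.1 * G.actProb μ ν z := by
  induction h generalizing z with
  | zero =>
    simp only [chainMarginal, startWeight, stateWeight]
    by_cases h0 : G.p₀ z.1 = 0
    · simp [h0]
    · rw [reachPlan_root μ (hG.maxHist_of_p₀_ne_zero h0), one_mul]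
  | succ h ih =>
    simp only [chainMarginal, stateWeight, Finset.mul_sum, Finset.sum_mul]
    refine Finset.sum_congr rfl fun z' _ => ?_
    rw [ih (by omega), stepKernel, dif_pos (show h < G.H by omega)]
    by_cases h1 : G.stateWeight ν h z'.1 = 0
    · simp [h1]
    by_cases h2 : G.p ⟨h, by omega⟩ z'.1 z'.2.1 z'.2.2 z.1 = 0
    · simp [h2]
    -- The player's factor at z' is the same for every predecessor of positive weight: this is where
    -- perfect recall makes the marginal a product.
    rw [reachPlan_child μ (hG.maxHist_of_step hh h1 h2)]
    simp only [actProb, maxPair, plan_eq]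
    ring

end StateWeight

end Game

/-! ### Expected visits, change of measure and the value. -/

namespace Game

open AdaptiveFTRL

variable {S X Y : Type*} {A : X → Type*} {B : Y → Type*} [Fintype S]

section Visits

open Classical in
/-- Sum of `f` over the steps of a trajectory at which the max-player is at `z`. -/
noncomputable def visitSum (G : Game S A B) (f : Fin G.H → G.Step → ℝ) (τ : G.Traj)
    (z : (x : X) × A x) : ℝ :=
  ∑ h, if G.maxPath τ h = z then f h (τ h) else 0

/-- The loss `1 - r_h` of the max-player. -/
def maxLoss (G : Game S A B) (h : Fin G.H) (z : G.Step) : ℝ := 1 - G.r h z.1 z.2.1 z.2.2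

lemma maxLoss_nonneg (G : Game S A B) (h : Fin G.H) (z : G.Step) : 0 ≤ G.maxLoss h z :=
  sub_nonneg.2 (G.r h z.1 z.2.1 z.2.2).2.2

lemma maxLoss_le_one (G : Game S A B) (h : Fin G.H) (z : G.Step) : G.maxLoss h z ≤ 1 :=
  sub_le_self _ (G.r h z.1 z.2.1 z.2.2).2.1

variable {G : Game S A B}

lemma visitSum_nonneg {f : Fin G.H → G.Step → ℝ} (hf : ∀ h z, 0 ≤ f h z) (τ : G.Traj)
    (z : (x : X) × A x) : 0 ≤ G.visitSum f τ z :=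
  Finset.sum_nonneg fun h _ => by split_ifs; exacts [hf _ _, le_rfl]

lemma PerfectRecall.visitSum_le_one (hG : G.PerfectRecall) {f : Fin G.H → G.Step → ℝ}
    (hf : ∀ h z, f h z ≤ 1) {τ : G.Traj} (hτ : G.Feasible τ) (z : (x : X) × A x) :
    G.visitSum f τ z ≤ 1 := by
  classical
  exact sum_ite_le_of_injective (fun h h' e e' => (hG.isPath hτ).injective (by simp only [e, e']))
    zero_le_one fun h _ => hf h (τ h)

variable [Fintype X] [∀ x, Fintype (A x)]

lemma sum_mul_visitSum (g : (x : X) × A x → ℝ) (f : Fin G.H → G.Step → ℝ) (τ : G.Traj) :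
    ∑ z, g z * G.visitSum f τ z = ∑ h, g (G.maxPath τ h) * f h (τ h) := by
  classical
  exact sum_mul_sum_ite (G.maxPath τ) g fun h _ => f h (τ h)

omit [Fintype X] in
open Classical in
lemma sum_visitSum_one (τ : G.Traj) (x : X) :
    ∑ a, G.visitSum (fun _ _ => 1) τ ⟨x, a⟩ = ∑ h, if (G.maxPath τ h).1 = x then 1 else 0 := by
  unfold visitSum
  rw [Finset.sum_comm]
  refine Finset.sum_congr rfl fun h _ => ?_
  split_ifs with hx
  · subst hx
    rw [Finset.sum_eq_single (G.maxPath τ h).2 (fun a _ ha => if_neg fun e => ha ?_) (by simp),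
      if_pos rfl]
    exact (eq_of_heq (Sigma.mk.inj_iff.1 e).2).symm
  · exact Finset.sum_eq_zero fun a _ => if_neg fun e => hx (by rw [e])

end Visits

section VisitWeight

variable [∀ x, Fintype (A x)] [∀ y, Fintype (B y)] (G : Game S A B) (ν : Policy B)

open Classical in
/-- The contribution of nature and of the min-player to the expectation of `visitSum`. -/
noncomputable def visitWeight (f : Fin G.H → G.Step → ℝ) (z : (x : X) × A x) : ℝ :=
  ∑ h : Fin G.H, ∑ y : G.Step,
    if G.maxPair y = z then G.stateWeight ν h y.1 * ν (G.yOf y.1) y.2.2 * f h y else 0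

open Classical in
/-- The contribution of nature and of the min-player to the probability of reaching `x`. -/
noncomputable def reachProb (x : X) : ℝ :=
  ∑ h : Fin G.H, ∑ s, if G.xOf s = x then G.stateWeight ν h s else 0

lemma visitWeight_one (z : (x : X) × A x) :
    G.visitWeight ν (fun _ _ => 1) z = G.reachProb ν z.1 := by
  classical
  refine Finset.sum_congr rfl fun h _ => ?_
  rw [Fintype.sum_sigma]
  refine Finset.sum_congr rfl fun s _ => ?_
  rw [Fintype.sum_prod_type]
  have : ∀ a : A (G.xOf s), ∑ b : B (G.yOf s), (if G.maxPair ⟨s, a, b⟩ = z then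
      G.stateWeight ν h s * ν (G.yOf s) b * 1 else 0) =
      if (⟨G.xOf s, a⟩ : (x : X) × A x) = z then G.stateWeight ν h s else 0 := fun a => by
    change ∑ b : B (G.yOf s), (if (⟨G.xOf s, a⟩ : (x : X) × A x) = z then
      G.stateWeight ν h s * ν (G.yOf s) b * 1 else 0) = _
    split_ifs
    · simp_rw [mul_one, ← Finset.mul_sum, policy_sum, mul_one]
    · simp
  refine (Finset.sum_congr rfl fun a _ => this a).trans ?_
  obtain ⟨x, a₀⟩ := z
  split_ifs with hx
  · subst hx
    simp
  · exact Finset.sum_eq_zero fun a _ => if_neg fun e => hx (congrArg Sigma.fst e)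

lemma visitWeight_mono {f g : Fin G.H → G.Step → ℝ} (h : ∀ i z, f i z ≤ g i z)
    (z : (x : X) × A x) : G.visitWeight ν f z ≤ G.visitWeight ν g z := by
  refine Finset.sum_le_sum fun i _ => Finset.sum_le_sum fun y _ => ?_
  split_ifs
  · exact mul_le_mul_of_nonneg_left (h _ _)
      (mul_nonneg (G.stateWeight_nonneg ν _ _) (policy_nonneg ν _ _))
  · exact le_rfl

lemma visitWeight_le_reachProb {f : Fin G.H → G.Step → ℝ} (h : ∀ i z, f i z ≤ 1)
    (z : (x : X) × A x) : G.visitWeight ν f z ≤ G.reachProb ν z.1 :=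
  (G.visitWeight_mono ν h z).trans_eq (G.visitWeight_one ν z)

lemma reachProb_nonneg (x : X) : 0 ≤ G.reachProb ν x := by
  refine Finset.sum_nonneg fun i _ => Finset.sum_nonneg fun y _ => ?_
  split_ifs
  exacts [G.stateWeight_nonneg ν _ _, le_rfl]

variable [∀ x, Nonempty (A x)] [∀ y, Nonempty (B y)]

variable {G}

/-- Change of measure: the policy of the max-player enters the expected visits only through its
realization plan. -/
lemma PerfectRecall.expect_visitSum (hG : G.PerfectRecall) (μ : Policy A)
    (f : Fin G.H → G.Step → ℝ) (z : (x : X) × A x) :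
    G.expect μ ν (fun τ => G.visitSum f τ z) = plan G.maxHist μ z * G.visitWeight ν f z := by
  classical
  unfold visitSum visitWeight
  rw [expect_sum, Finset.mul_sum]
  refine Finset.sum_congr rfl fun h _ => ?_
  have h1 := G.expect_apply μ ν h.2 fun y => if G.maxPair y = z then f h y else 0
  refine h1.trans ?_
  rw [Finset.mul_sum]
  refine Finset.sum_congr rfl fun y _ => ?_
  rw [hG.chainMarginal_eq ν μ h.2]
  split_ifs with hy
  · subst hy
    rw [maxPair, plan_eq, actProb]
    ring
  · simp

variable [Fintype X]

/-- Each episode visits exactly `H` pairs. This identity turns comparator sums over all information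
sets into HT. -/
lemma PerfectRecall.sum_plan_mul_reachProb (hG : G.PerfectRecall) (μ : Policy A) :
    ∑ z : (x : X) × A x, plan G.maxHist μ z * G.reachProb ν z.1 = G.H := by
  simp_rw [← G.visitWeight_one ν, ← hG.expect_visitSum ν μ]
  rw [← expect_sum]
  have : ∀ τ : G.Traj, ∑ z, G.visitSum (fun _ _ => 1) τ z = G.H := fun τ => by
    have := sum_mul_visitSum (fun _ => 1) (fun _ _ => 1) τ
    simpa using this
  simp_rw [this]
  exact G.expect_const μ ν _

omit [Fintype X] in
lemma PerfectRecall.expect_reach (hG : G.PerfectRecall) (μ : Policy A) (x : X) :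
    G.expect μ ν (fun τ => ∑ a, G.visitSum (fun _ _ => 1) τ ⟨x, a⟩) =
      reachPlan G.maxHist μ x * G.reachProb ν x := by
  rw [expect_sum, ← sum_plan, Finset.sum_mul]
  refine Finset.sum_congr rfl fun a _ => ?_
  rw [hG.expect_visitSum, visitWeight_one]

omit [Fintype X] in
-- A feasible trajectory that visits `x` has taken the pair `w` just before. Taking expectations
-- under the uniform policy, both sides carry the positive factor plan(w), which cancels.
lemma PerfectRecall.reachProb_child_le (hG : G.PerfectRecall) {x : X} {w : (x : X) × A x}
    (h : G.maxHist x = G.maxHist w.1 ++ [w]) : G.reachProb ν x ≤ G.reachProb ν w.1 := by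
  classical
  have h1 : G.expect (uniformPolicy A) ν (fun τ => ∑ a, G.visitSum (fun _ _ => 1) τ ⟨x, a⟩) ≤
      G.expect (uniformPolicy A) ν (fun τ => G.visitSum (fun _ _ => 1) τ w) := by
    refine G.expect_mono _ _ fun τ hτ => ?_
    have hp := hG.isPath hτ
    rw [sum_visitSum_one]
    by_cases hx : ∃ k, (G.maxPath τ k).1 = x
    · obtain ⟨k, hk⟩ := hx
      have hlen := hp.length_hist k
      rw [hk, h, List.length_append, List.length_singleton] at hlen
      obtain ⟨j, hj⟩ : ∃ j, k.1 = j + 1 := ⟨_, hlen.symm⟩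
      have hjH : j + 1 < G.H := hj ▸ k.2
      have hs := hp.hist_succ hjH
      rw [show (⟨j + 1, hjH⟩ : Fin G.H) = k from Fin.ext hj.symm, hk, h] at hs
      have hw : w = G.maxPath τ ⟨j, by omega⟩ := by
        simpa using congrArg List.getLast? hs
      calc _ ≤ (1 : ℝ) := sum_ite_le_of_injective
            (fun h h' e e' => hp.injective (by simp only [e, e'])) zero_le_one fun _ _ => le_rfl
        _ = if G.maxPath τ ⟨j, by omega⟩ = w then 1 else 0 := by rw [if_pos hw.symm]
        _ ≤ _ := Finset.single_le_sum (f := fun i => if G.maxPath τ i = w then (1 : ℝ) else 0)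
            (fun i _ => by split_ifs <;> norm_num) (Finset.mem_univ _)
    · rw [Finset.sum_eq_zero fun k _ => if_neg fun e => hx ⟨k, e⟩]
      exact visitSum_nonneg (fun _ _ => zero_le_one) τ w
  rw [hG.expect_reach, hG.expect_visitSum, visitWeight_one, reachPlan_child _ h] at h1
  exact le_of_mul_le_mul_left h1 (mul_pos (reachPlan_pos uniformPolicy_pos _) (uniformPolicy_pos _ _))

omit [Fintype X] in
lemma PerfectRecall.reachProb_le_one (hG : G.PerfectRecall) (x : X) : G.reachProb ν x ≤ 1 := by
  classical
  refine hG.isTree.induction (p := fun x => G.reachProb ν x ≤ 1) (fun x hx => ?_) (fun x w hx ih => ?_) x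
  · have h := hG.expect_reach ν (uniformPolicy A) x
    rw [reachPlan_root _ hx, one_mul] at h
    rw [← h]
    refine (G.expect_mono _ _ (g := fun _ => 1) fun τ hτ => ?_).trans (G.expect_one _ _).le
    rw [sum_visitSum_one]
    exact sum_ite_le_of_injective
      (fun h h' e e' => (hG.isPath hτ).injective (by simp only [e, e'])) zero_le_one fun _ _ => le_rfl
  · exact (hG.reachProb_child_le ν hx).trans ih

omit [Fintype X] in
lemma PerfectRecall.reachProb_anti (hG : G.PerfectRecall) {x x' : X}
    (h : Precedes G.maxHist x x') : G.reachProb ν x' ≤ G.reachProb ν x := by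
  revert h
  refine hG.isTree.induction (p := fun x' => Precedes G.maxHist x x' →
    G.reachProb ν x' ≤ G.reachProb ν x) (fun x' hx' h => ?_) (fun x' w hw ih h => ?_) x'
  · rcases h with rfl | ⟨a, ha⟩
    · exact le_rfl
    · simp [hx'] at ha
  · rcases h with rfl | ⟨a, ha⟩
    · exact le_rfl
    · refine (hG.reachProb_child_le ν hw).trans (ih ?_)
      rw [hw, List.mem_append, List.mem_singleton] at ha
      rcases ha with ha | rfl
      · exact Or.inr ⟨a, ha⟩
      · exact Or.inl rfl

/-- The expected total reward in terms of the realization plan. -/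
lemma PerfectRecall.value_eq (hG : G.PerfectRecall) (μ : Policy A) :
    G.value μ ν = G.H - ∑ z, plan G.maxHist μ z * G.visitWeight ν G.maxLoss z := by
  simp_rw [← hG.expect_visitSum ν μ]
  rw [← expect_sum]
  have h1 : ∀ τ : G.Traj, ∑ z, G.visitSum G.maxLoss τ z = ∑ h, G.maxLoss h (τ h) := fun τ => by
    have := sum_mul_visitSum (fun _ => 1) G.maxLoss τ
    simpa using this
  simp_rw [h1]
  have h2 : G.value μ ν = G.expect μ ν fun τ => ∑ h, G.reward τ h := rfl
  rw [h2, eq_sub_iff_add_eq, ← expect_add]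
  have h3 : ∀ τ : G.Traj, ∑ h, G.reward τ h + ∑ h, G.maxLoss h (τ h) = G.H := fun τ => by
    rw [← Finset.sum_add_distrib]
    simp [maxLoss, reward]
  simp_rw [h3]
  exact G.expect_const μ ν _

end VisitWeight

end Game

/-! ### Cardinalities and entropy of the uniform policy. -/

namespace AdaptiveFTRL

lemma relEntropy_uniformPolicy_le {X : Type*} {A : X → Type*} [∀ x, Fintype (A x)]
    [∀ x, Nonempty (A x)] (m : Policy A) (x : X) :
    relEntropy (m x) (uniformPolicy A x) ≤ Real.log (Fintype.card (A x)) := by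
  have hc : (0 : ℝ) < Fintype.card (A x) := by exact_mod_cast Fintype.card_pos
  have : ∀ a, m x a * Real.log (m x a / uniformPolicy A x a) ≤
      m x a * Real.log (Fintype.card (A x)) := fun a => by
    rcases (policy_nonneg m x a).eq_or_lt with h | h
    · simp [← h]
    · refine mul_le_mul_of_nonneg_left (Real.log_le_log (div_pos h (uniformPolicy_pos x a)) ?_) h.le
      change m x a / (Fintype.card (A x) : ℝ)⁻¹ ≤ _
      rw [div_inv_eq_mul]
      have := policy_le_one m x a
      nlinarith
  refine (Finset.sum_le_sum fun a _ => this a).trans_eq ?_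
  rw [← Finset.sum_mul, policy_sum, one_mul]

lemma card_sigma_eq_totalActions {X : Type*} (A : X → Type*) [Fintype X] [∀ x, Fintype (A x)] :
    Fintype.card ((x : X) × A x) = totalActions A := Fintype.card_sigma

lemma card_le_totalActions {X : Type*} (A : X → Type*) [Fintype X] [∀ x, Fintype (A x)] (x : X) :
    Fintype.card (A x) ≤ totalActions A :=
  Finset.single_le_sum (f := fun x => Fintype.card (A x)) (fun _ _ => Nat.zero_le _)
    (Finset.mem_univ x)

end AdaptiveFTRL

/-! ### Regret on the concentration event. -/

namespace Game

open AdaptiveFTRL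

variable {S X Y : Type*} {A : X → Type*} {B : Y → Type*} [Fintype S] [Fintype X]
  [∀ x, Fintype (A x)] [∀ y, Fintype (B y)] (G : Game S A B)

section Estimates

variable (γ : ℝ) (μ : ℕ → Policy A) (ν : ℕ → Policy B) (τ : ℕ → G.Traj)

/-- Implicit exploration of the max-player. -/
noncomputable def maxIx (t : ℕ) (z : (x : X) × A x) : ℝ :=
  ixParam G.maxHist γ μ (fun t => G.maxPath (τ t)) t z

/-- Error of the importance weighted estimate of a visit weight in episode `t`. -/
noncomputable def estError (f : Fin G.H → G.Step → ℝ) (t : ℕ) (z : (x : X) × A x) : ℝ :=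
  G.visitSum f (τ t) z / (plan G.maxHist (μ t) z + G.maxIx γ μ τ t z) - G.visitWeight (ν t) f z

/-- Estimated loss of the policy of episode `t`, raised by the bias of the implicit exploration. -/
noncomputable def optimisticLoss (t : ℕ) : ℝ :=
  ∑ h, (plan G.maxHist (μ t) (G.maxPath (τ t) h) * G.maxLoss h (τ t h) +
      G.maxIx γ μ τ t (G.maxPath (τ t) h)) /
    (plan G.maxHist (μ t) (G.maxPath (τ t) h) + G.maxIx γ μ τ t (G.maxPath (τ t) h))

/-- Cumulative probability, up to the contribution of the max-player, of reaching `x`. -/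
noncomputable def cumReach (T : ℕ) (x : X) : ℝ := ∑ t ∈ Finset.range T, G.reachProb (ν t) x

omit [Fintype X] in
lemma cumTrans_eq_sum (T : ℕ) (z : (x : X) × A x) :
    cumTrans G.maxHist γ μ (fun t => G.maxPath (τ t)) T z =
      ∑ t ∈ Finset.range T, G.estError γ μ ν τ (fun _ _ => 1) t z + G.cumReach ν T z.1 := by
  classical
  rw [cumReach, ← Finset.sum_add_distrib]
  induction T with
  | zero => rfl
  | succ T ih =>
    rw [Finset.sum_range_succ, ← ih, cumTrans_succ, estError, visitWeight_one, sub_add_cancel,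
      visitSum, Finset.sum_div]
    congr 1
    refine Finset.sum_congr rfl fun h _ => ?_
    split_ifs
    · rfl
    · simp

omit [Fintype X] in
lemma cumLoss_eq_sum (T : ℕ) (z : (x : X) × A x) :
    cumLoss G.maxHist γ μ (fun t => G.maxPath (τ t)) (fun t h => 1 - G.reward (τ t) h) T z =
      ∑ t ∈ Finset.range T, G.estError γ μ ν τ G.maxLoss t z +
        ∑ t ∈ Finset.range T, G.visitWeight (ν t) G.maxLoss z := by
  classical
  rw [← Finset.sum_add_distrib]
  refine Finset.sum_congr rfl fun t _ => ?_
  rw [estError, sub_add_cancel, visitSum, Finset.sum_div]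
  refine Finset.sum_congr rfl fun h _ => ?_
  split_ifs
  · rfl
  · simp

/-- The concentration event: tail sums of the errors of the estimates of transitions and losses,
and the sum of the errors of the optimistic losses, are small. -/
structure Concentrated (T : ℕ) (L : ℝ) : Prop where
  trans : ∀ z, ∀ s < T, ∑ t ∈ Finset.Ico s T,
    2 * G.maxIx γ μ τ t z * G.estError γ μ ν τ (fun _ _ => 1) t z ≤ L
  loss : ∀ z, ∀ s < T, ∑ t ∈ Finset.Ico s T,
    2 * G.maxIx γ μ τ t z * G.estError γ μ ν τ G.maxLoss t z ≤ L
  policy : ∑ t ∈ Finset.range T, (∑ z, plan G.maxHist (μ t) z * G.visitWeight (ν t) G.maxLoss z -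
    G.optimisticLoss γ μ τ t) ≤ G.H * √(2 * L * T)

variable {G γ μ ν τ}

omit [Fintype X] in
-- The error is (1 + P t)/γ times γᵗ error, and these weights increase with `t`. This is why tail
-- sums from every starting episode must be controlled rather than the full sum alone.
lemma sum_estError_le (hγ : 0 < γ) {T : ℕ} (hT : 0 < T) {L : ℝ} {f : Fin G.H → G.Step → ℝ}
    {z : (x : X) × A x} (h : ∀ s < T, ∑ t ∈ Finset.Ico s T,
      2 * G.maxIx γ μ τ t z * G.estError γ μ ν τ f t z ≤ L) :
    ∑ t ∈ Finset.range T, G.estError γ μ ν τ f t z ≤ L / (2 * γ) *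
      (1 + cumTrans G.maxHist γ μ (fun t => G.maxPath (τ t)) (T - 1) z) := by
  set P := fun t => cumTrans G.maxHist γ μ (fun t => G.maxPath (τ t)) t z with hP
  have hP0 : ∀ t, 0 ≤ P t := fun t => cumTrans_nonneg _ _ _ hγ.le t z
  have hPm : Monotone P := cumTrans_mono _ _ _ hγ z
  have key := sum_mul_le_of_tail_le (c := fun t => (1 + P t) / γ)
    (e := fun t => G.maxIx γ μ τ t z * G.estError γ μ ν τ f t z) (B := L / 2)
    (fun s t hst => by have := hPm hst; simp only; gcongr) (by have := hP0 0; positivity)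
    (fun s hs => by
      have := h s hs
      simp_rw [mul_assoc, ← Finset.mul_sum] at this
      linarith) hT
  have h1 : ∀ t, (1 + P t) / γ * (G.maxIx γ μ τ t z * G.estError γ μ ν τ f t z) =
      G.estError γ μ ν τ f t z := fun t => by
    have := hP0 t
    rw [← mul_assoc, maxIx, ixParam]
    change (1 + P t) / γ * (γ / (1 + P t)) * _ = _
    field_simp
  simp_rw [h1] at key
  refine key.trans_eq ?_
  rw [hP]
  field_simp

/-- Self-bounding: P is its error plus the true cumulative reach weight, and the error is at most (1
+ P)/8. Solving for 1 + P gives the factor 8/7. -/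
lemma Concentrated.one_add_cumTrans_le {T : ℕ} {L : ℝ} (hE : G.Concentrated γ μ ν τ T L)
    (hγ : 0 < γ) (hT : 0 < T) (hL : L / (2 * γ) ≤ 1 / 8) (z : (x : X) × A x) :
    1 + cumTrans G.maxHist γ μ (fun t => G.maxPath (τ t)) T z ≤
      8 / 7 * (1 + G.cumReach ν T z.1) := by
  have h1 := sum_estError_le hγ hT (hE.trans z)
  have h2 := G.cumTrans_eq_sum γ μ ν τ T z
  have h3 := cumTrans_mono G.maxHist μ (fun t => G.maxPath (τ t)) hγ z (Nat.sub_le T 1)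
  have h4 := cumTrans_nonneg G.maxHist μ (fun t => G.maxPath (τ t)) hγ.le (T - 1) z
  simp only at h3
  have h5 : L / (2 * γ) * (1 + cumTrans G.maxHist γ μ (fun t => G.maxPath (τ t)) (T - 1) z) ≤
      1 / 8 * (1 + cumTrans G.maxHist γ μ (fun t => G.maxPath (τ t)) T z) :=
    mul_le_mul hL (by linarith) (by linarith) (by norm_num)
  linarith

lemma Concentrated.one_add_cumTransAvg_le [∀ x, Nonempty (A x)] {T : ℕ} {L : ℝ}
    (hE : G.Concentrated γ μ ν τ T L) (hγ : 0 < γ) (hT : 0 < T)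
    (hL : L / (2 * γ) ≤ 1 / 8) (x : X) :
    1 + cumTransAvg G.maxHist γ μ (fun t => G.maxPath (τ t)) T x ≤
      8 / 7 * (1 + G.cumReach ν T x) := by
  have hc : (0 : ℝ) < Fintype.card (A x) := by exact_mod_cast Fintype.card_pos
  have : ∑ a, cumTrans G.maxHist γ μ (fun t => G.maxPath (τ t)) T ⟨x, a⟩ ≤
      ∑ _a : A x, (8 / 7 * (1 + G.cumReach ν T x) - 1) :=
    Finset.sum_le_sum fun a _ => by
      have := hE.one_add_cumTrans_le hγ hT hL ⟨x, a⟩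
      simp only at this
      linarith
  rw [Finset.sum_const, Finset.card_univ, nsmul_eq_mul] at this
  have h2 : cumTransAvg G.maxHist γ μ (fun t => G.maxPath (τ t)) T x ≤
      8 / 7 * (1 + G.cumReach ν T x) - 1 := by
    unfold cumTransAvg
    rw [div_le_iff₀ hc]
    linarith
  linarith

variable [∀ x, Nonempty (A x)] [∀ y, Nonempty (B y)]

omit [Fintype X] in
lemma PerfectRecall.cumReach_le (hG : G.PerfectRecall) (T : ℕ) (x : X) : G.cumReach ν T x ≤ T := by
  refine (Finset.sum_le_sum fun t _ => hG.reachProb_le_one (ν t) x).trans_eq ?_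
  simp

omit [Fintype X] [∀ x, Nonempty (A x)] [∀ y, Nonempty (B y)] in
lemma cumReach_nonneg (T : ℕ) (x : X) : 0 ≤ G.cumReach ν T x :=
  Finset.sum_nonneg fun t _ => G.reachProb_nonneg (ν t) x

lemma PerfectRecall.sum_plan_mul_cumReach (hG : G.PerfectRecall) (m : Policy A) (T : ℕ) :
    ∑ z : (x : X) × A x, plan G.maxHist m z * G.cumReach ν T z.1 = G.H * T := by
  simp_rw [cumReach, Finset.mul_sum]
  rw [Finset.sum_comm]
  simp_rw [hG.sum_plan_mul_reachProb]
  simp [mul_comm]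

lemma logb_le_lam {T : ℕ} {P : ℝ} (hP : 0 ≤ P) (h : P ≤ 2 * (1 + T)) : Real.logb 2 P ≤ lam T := by
  have hT : (0 : ℝ) < 1 + T := by positivity
  have e : lam T = Real.logb 2 (2 * (1 + T)) := by
    rw [Real.logb_mul (by norm_num) hT.ne', Real.logb_self_eq_one (by norm_num), lam]
  rw [e]
  rcases hP.eq_or_lt with h0 | h0
  · rw [← h0, Real.logb_zero]
    refine Real.logb_nonneg (by norm_num) ?_
    have : (0 : ℝ) ≤ T := Nat.cast_nonneg T
    linarith
  · exact Real.logb_le_logb_of_le (by norm_num) h0 h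

/-- The divergence of any policy from the uniform one, at the learning rates of the last episode. -/
lemma Concentrated.dilatedDiv_le {T : ℕ} {L η ι : ℝ}
    (hE : G.Concentrated γ μ ν τ T L) (hG : G.PerfectRecall) (hγ : 0 < γ) (hη : 0 < η) (hT : 0 < T)
    (hL : L / (2 * γ) ≤ 1 / 8) (hι : ∀ x, Real.log (Fintype.card (A x)) ≤ ι)
    (m : Policy A) :
    dilatedDiv G.maxHist (learningRate G.maxHist γ μ (fun t => G.maxPath (τ t)) η (T - 1)) m
      (uniformPolicy A) ≤ 8 / 7 * (G.H * T * ι + totalActions A) / η := by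
  rw [dilatedDiv_eq_sum_relEntropy]
  have step : ∀ x, reachPlan G.maxHist m x * (relEntropy (m x) (uniformPolicy A x) /
      learningRate G.maxHist γ μ (fun t => G.maxPath (τ t)) η (T - 1) x) ≤
      8 / 7 / η * (reachPlan G.maxHist m x * G.cumReach ν T x * ι + Fintype.card (A x)) := fun x => by
    obtain ⟨x', hx', e⟩ := exists_learningRate_eq G.maxHist (γ := γ) μ (fun t => G.maxPath (τ t)) η
      (T - 1) x
    have h1 := hE.one_add_cumTransAvg_le hγ hT hL x'
    have h2 := cumTransAvg_mono G.maxHist μ (fun t => G.maxPath (τ t)) hγ x' (Nat.sub_le T 1)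
    -- The minimizing descendant x' is reached no more often than `x`, so the bound at x' transfers
    -- to `x`.
    have h3 : G.cumReach ν T x' ≤ G.cumReach ν T x :=
      Finset.sum_le_sum fun t _ => hG.reachProb_anti (ν t) hx'
    have h4 := relEntropy_uniformPolicy_le m x
    have h5 := cumTransAvg_nonneg G.maxHist μ (fun t => G.maxPath (τ t)) hγ.le (T - 1) x'
    have hc : (1 : ℝ) ≤ Fintype.card (A x) := by exact_mod_cast Fintype.card_pos
    have h6 := Real.log_le_self (by linarith : (0 : ℝ) ≤ Fintype.card (A x))
    have h7 := reachPlan_nonneg G.maxHist m x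
    have h8 := reachPlan_le_one G.maxHist m x
    have h9 : 0 ≤ G.cumReach ν T x := cumReach_nonneg T x
    have h10 := Real.log_nonneg hc
    simp only at h2
    rw [e, div_div_eq_mul_div]
    set P := cumTransAvg G.maxHist γ μ (fun t => G.maxPath (τ t)) (T - 1) x'
    set l := Real.log (Fintype.card (A x))
    set r := reachPlan G.maxHist m x
    set Q := G.cumReach ν T x
    calc r * (relEntropy (m x) (uniformPolicy A x) * (1 + P) / η) ≤
        r * (l * (8 / 7 * (1 + Q)) / η) := by
          gcongr
          linarith
      _ = 8 / 7 / η * (r * Q * l + r * l) := by ring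
      -- The logarithm next to Q is kept as ι; the other one is bounded by the number of actions, so
      -- that it sums to `totalActions`.
      _ ≤ 8 / 7 / η * (r * Q * ι + 1 * Fintype.card (A x)) := by
          have := hι x
          gcongr
      _ = _ := by rw [one_mul]
  refine (Finset.sum_le_sum fun x _ => step x).trans_eq ?_
  rw [← Finset.mul_sum, Finset.sum_add_distrib, ← Finset.sum_mul]
  have h1 : ∑ x, reachPlan G.maxHist m x * G.cumReach ν T x = G.H * T := by
    rw [← hG.sum_plan_mul_cumReach (ν := ν) m T, Fintype.sum_sigma]
    refine Finset.sum_congr rfl fun x _ => ?_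
    rw [← sum_plan, Finset.sum_mul]
  have h2 : ∑ x, (Fintype.card (A x) : ℝ) = totalActions A := by
    unfold totalActions; push_cast; rfl
  rw [h1, h2]
  ring

/-- The estimated loss of a fixed policy exceeds its loss by little. -/
lemma Concentrated.planLoss_le {T : ℕ} {L : ℝ}
    (hE : G.Concentrated γ μ ν τ T L) (hG : G.PerfectRecall) (hγ : 0 < γ) (hT : 0 < T)
    (hL0 : 0 ≤ L) (hL : L / (2 * γ) ≤ 1 / 8) (m : Policy A) :
    planLoss G.maxHist m (cumLoss G.maxHist γ μ (fun t => G.maxPath (τ t))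
      (fun t h => 1 - G.reward (τ t) h) T) ≤
    ∑ t ∈ Finset.range T, ∑ z, plan G.maxHist m z * G.visitWeight (ν t) G.maxLoss z +
      L / (2 * γ) * (8 / 7) * (G.H * T + totalActions A) := by
  rw [planLoss_eq_sum, Finset.sum_comm, ← hG.sum_plan_mul_cumReach (ν := ν) m T,
    ← card_sigma_eq_totalActions, ← Finset.card_univ, Finset.cast_card, ← Finset.sum_add_distrib,
    Finset.mul_sum, ← Finset.sum_add_distrib]
  refine Finset.sum_le_sum fun z _ => ?_
  rw [G.cumLoss_eq_sum γ μ ν τ]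
  have h1 := sum_estError_le hγ hT (hE.loss z)
  have h2 := hE.one_add_cumTrans_le hγ hT hL z
  have h3 := cumTrans_mono G.maxHist μ (fun t => G.maxPath (τ t)) hγ z (Nat.sub_le T 1)
  have h4 := plan_nonneg G.maxHist m z
  have h5 := plan_le_one G.maxHist m z
  have h6 : 0 ≤ L / (2 * γ) := by positivity
  simp only at h3
  rw [← Finset.mul_sum, mul_add]
  have h7 : ∑ t ∈ Finset.range T, G.estError γ μ ν τ G.maxLoss t z ≤
      L / (2 * γ) * (8 / 7 * (1 + G.cumReach ν T z.1)) :=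
    h1.trans (mul_le_mul_of_nonneg_left (by linarith) h6)
  have h8 := mul_le_mul_of_nonneg_left h7 h4
  have h9 := mul_le_mul_of_nonneg_left h5 h6
  linarith

/-- Regret against a fixed policy on the concentration event, for general parameters. -/
lemma Concentrated.regret_le {T : ℕ} {L η ι : ℝ} (hE : G.Concentrated γ μ ν τ T L)
    (hG : G.PerfectRecall) (hγ : 1 ≤ γ) (hη : 0 < η) (hT : 0 < T)
    (hL0 : 0 ≤ L) (hL : L / (2 * γ) ≤ 1 / 8) (hι : ∀ x, Real.log (Fintype.card (A x)) ≤ ι)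
    (hτ : ∀ t < T, G.Feasible (τ t))
    (hrun : IsRun G.maxHist η γ (uniformPolicy A) T μ (fun t => G.maxPath (τ t))
      fun t h => 1 - G.reward (τ t) h) (m : Policy A) :
    ∑ t ∈ Finset.range T, (G.value m (ν t) - G.value (μ t) (ν t)) ≤
      8 / 7 * (G.H * T * ι + totalActions A) / η + G.H * (η * (totalActions A * lam T)) +
      L / (2 * γ) * (8 / 7) * (G.H * T + totalActions A) + γ * (totalActions A * lam T) +
      G.H * √(2 * L * T) := by
  have hγ0 : 0 < γ := by linarith
  have hp : ∀ t < T, IsPath G.maxHist (G.maxPath (τ t)) := fun t ht => hG.isPath (hτ t ht)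
  have hl0 : ∀ t < T, ∀ h, 0 ≤ 1 - G.reward (τ t) h := fun t _ h => G.maxLoss_nonneg h (τ t h)
  have hl1 : ∀ t < T, ∀ h, 1 - G.reward (τ t) h ≤ 1 := fun t _ h => G.maxLoss_le_one h (τ t h)
  have h1 := regret_lossEst_le μ _ _ hG.isTree hγ0 hη hp hl0 hl1 hrun m
  have h2 := sum_learningRate_mul_lossEst_le μ _ (fun t h => 1 - G.reward (τ t) h) hγ hη hp hl0 hl1
  have h3 := sum_ixParam_div_le μ _ hγ hp
  have h4 := hE.dilatedDiv_le hG hγ0 hη hT hL hι m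
  have h5 := hE.planLoss_le hG hγ0 hT hL0 hL m
  have h6 := hE.policy
  have hlog1 : ∑ x, Fintype.card (A x) *
      Real.logb 2 (1 + cumTransAvg G.maxHist γ μ (fun t => G.maxPath (τ t)) T x) ≤
      totalActions A * lam T := by
    unfold totalActions
    push_cast
    rw [Finset.sum_mul]
    refine Finset.sum_le_sum fun x _ => mul_le_mul_of_nonneg_left (logb_le_lam ?_ ?_)
      (Nat.cast_nonneg _)
    · have := cumTransAvg_nonneg G.maxHist μ (fun t => G.maxPath (τ t)) hγ0.le T x
      linarith
    · have := hE.one_add_cumTransAvg_le hγ0 hT hL x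
      have := hG.cumReach_le (ν := ν) T x
      linarith [(Nat.cast_nonneg T : (0 : ℝ) ≤ T)]
  have hlog2 : ∑ z, Real.logb 2 (1 + cumTrans G.maxHist γ μ (fun t => G.maxPath (τ t)) T z) ≤
      totalActions A * lam T := by
    rw [← card_sigma_eq_totalActions, ← Finset.card_univ, Finset.cast_card, Finset.sum_mul]
    refine Finset.sum_le_sum fun z _ => ?_
    rw [one_mul]
    refine logb_le_lam ?_ ?_
    · have := cumTrans_nonneg G.maxHist μ (fun t => G.maxPath (τ t)) hγ0.le T z
      linarith
    · have := hE.one_add_cumTrans_le hγ0 hT hL z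
      have := hG.cumReach_le (ν := ν) T z.1
      linarith [(Nat.cast_nonneg T : (0 : ℝ) ≤ T)]
  -- The optimistic loss splits into the estimated loss, controlled by the leader argument, and the
  -- exploration bias, controlled by a logarithm.
  have h7 : ∀ t, G.optimisticLoss γ μ τ t =
      ∑ h, plan G.maxHist (μ t) (G.maxPath (τ t) h) *
        lossEst G.maxHist γ μ (fun t => G.maxPath (τ t)) (fun t h => 1 - G.reward (τ t) h) t h +
      ∑ h, ixParam G.maxHist γ μ (fun t => G.maxPath (τ t)) t (G.maxPath (τ t) h) /
        (plan G.maxHist (μ t) (G.maxPath (τ t) h) +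
          ixParam G.maxHist γ μ (fun t => G.maxPath (τ t)) t (G.maxPath (τ t) h)) := fun t => by
    rw [← Finset.sum_add_distrib]
    refine Finset.sum_congr rfl fun h _ => ?_
    rw [lossEst, mul_div_assoc', ← add_div]
    rfl
  simp_rw [h7, Finset.sum_sub_distrib, Finset.sum_add_distrib] at h6
  simp_rw [Finset.sum_sub_distrib, ← Finset.mul_sum] at h1
  have h8 : ∑ t ∈ Finset.range T, (G.value m (ν t) - G.value (μ t) (ν t)) =
      ∑ t ∈ Finset.range T, ∑ z, plan G.maxHist (μ t) z * G.visitWeight (ν t) G.maxLoss z -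
      ∑ t ∈ Finset.range T, ∑ z, plan G.maxHist m z * G.visitWeight (ν t) G.maxLoss z := by
    rw [← Finset.sum_sub_distrib]
    refine Finset.sum_congr rfl fun t _ => ?_
    rw [hG.value_eq, hG.value_eq]
    ring
  rw [h8]
  have h9 := mul_le_mul_of_nonneg_left h2 (Nat.cast_nonneg (α := ℝ) G.H)
  have h10 := mul_le_mul_of_nonneg_left (mul_le_mul_of_nonneg_left hlog1 hη.le)
    (Nat.cast_nonneg (α := ℝ) G.H)
  have h11 := mul_le_mul_of_nonneg_left hlog2 hγ0.le
  linarith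

end Estimates

end Game

/-! ### Numerical tuning of the parameters. -/

section Tuning

lemma deviation_term_le {H n T ι l κ R : ℝ} (hH : 1 ≤ H) (hn : 1 ≤ n) (hι : 1 ≤ ι)
    (hl : 2 ≤ l) (hκ : 1 ≤ κ) (hT0 : 0 < T) (hR : 0 < R) (hR2 : R ^ 2 = ι * l * n * T) :
    H * √(2 * (κ * ι) * T) ≤ κ * (H * R) := by
  have : √(2 * (κ * ι) * T) ≤ κ * R := by
    refine Real.sqrt_le_iff.2 ⟨by positivity, ?_⟩
    rw [mul_pow, hR2]
    have hln : 2 ≤ l * n := by nlinarith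
    have h1 : ι * T * 2 ≤ ι * T * (l * n) := mul_le_mul_of_nonneg_left hln (by positivity)
    have h2 : κ * (ι * T * (l * n)) ≤ κ ^ 2 * (ι * T * (l * n)) :=
      mul_le_mul_of_nonneg_right (by nlinarith) (by positivity)
    have h3 := mul_le_mul_of_nonneg_left h1 (by linarith : 0 ≤ κ)
    linarith
  have := mul_le_mul_of_nonneg_left this (by linarith : 0 ≤ H)
  linarith

lemma bias_term_le {H n T ι κ R a s : ℝ} (hH : 1 ≤ H) (hκ : 1 ≤ κ) (hT0 : 0 < T)
    (hT72 : 72 * n ≤ T) (hR : 0 < R) (ha0 : 0 < a) (hιa : ι / a = R / T) (hs1 : 1.4 ≤ s) :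
    κ * ι / (2 * (s * a)) * (8 / 7) * (H * T + n) ≤ 0.415 * κ * (H * R) := by
  have hs0 : 0 < s := by linarith
  have e : κ * ι / (2 * (s * a)) = κ * (R / T) / (2 * s) := by
    rw [← hιa]
    field_simp
  have e2 : R / T * (H * T + n) = R * (H + n / T) := by
    field_simp
  have hnT : n / T ≤ H / 72 := by
    rw [div_le_div_iff₀ hT0 (by norm_num)]
    have : T ≤ H * T := le_mul_of_one_le_left hT0.le hH
    linarith
  have h1 : R * (H + n / T) ≤ R * (H + H / 72) :=
    mul_le_mul_of_nonneg_left (by linarith) hR.le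
  have h2 : κ * (R * (H + n / T)) ≤ κ * (R * (H + H / 72)) :=
    mul_le_mul_of_nonneg_left h1 (by linarith)
  have h3 : κ * (H * R) * 1.4 ≤ κ * (H * R) * s :=
    mul_le_mul_of_nonneg_left hs1 (by positivity)
  calc κ * ι / (2 * (s * a)) * (8 / 7) * (H * T + n) =
      4 / 7 * (κ * (R / T * (H * T + n))) / s := by rw [e]; field_simp; ring
    _ ≤ _ := by
      rw [e2, div_le_iff₀ hs0]
      have : 0 ≤ κ * (H * R) := by positivity
      linarith

lemma penalty_term_le {H n T ι R a : ℝ} (hH : 1 ≤ H) (hι : 1 ≤ ι) (hT0 : 0 < T)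
    (hT72 : 72 * n ≤ T) (hR : 0 < R) (ha : a = ι * T / R) :
    8 / 7 * (H * T * ι + n) / (2 * a) ≤ 0.58 * (H * R) := by
  have e : 8 / 7 * (H * T * ι + n) / (2 * a) = 4 / 7 * (H * R + n / a) := by
    rw [ha]; field_simp; ring
  have : n / a ≤ R / 72 := by
    rw [ha, div_div_eq_mul_div, div_le_div_iff₀ (by positivity) (by norm_num)]
    have h1 := mul_le_mul_of_nonneg_left hT72 hR.le
    have h2 := mul_le_mul_of_nonneg_right hι (mul_pos hR hT0).le
    linarith
  have : R ≤ H * R := le_mul_of_one_le_left hR.le hH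
  rw [e]
  linarith

/-- The terms of the regret bound at the tuned parameters. -/
lemma tuned_bound {H n T ι l κ R a s : ℝ} (hH : 1 ≤ H) (hn : 1 ≤ n) (hι : 1 ≤ ι)
    (hl : 2 ≤ l) (hκ : 1 ≤ κ) (hκ2 : κ ≤ 2) (hT : 36 * (ι * l * n) ≤ T) (hR : 0 < R)
    (hR2 : R ^ 2 = ι * l * n * T) (ha : a = ι * T / R) (hs : 0 ≤ s) (hs2 : s ^ 2 = 2 * H) :
    1 ≤ s * a ∧ κ * ι / (2 * (s * a)) ≤ 1 / 8 ∧
    8 / 7 * (H * T * ι + n) / (2 * a) + H * (2 * a * (n * l)) +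
      κ * ι / (2 * (s * a)) * (8 / 7) * (H * T + n) + s * a * (n * l) + H * √(2 * (κ * ι) * T) ≤
    6 * κ * (H * R) := by
  have hιl : 2 ≤ ι * l := by nlinarith
  have hιln : 2 * n ≤ ι * l * n := mul_le_mul_of_nonneg_right hιl (by linarith)
  have hT72 : 72 * n ≤ T := by linarith
  have hT0 : 0 < T := by linarith
  have h6R : 6 * R ≤ T := by
    refine abs_le_of_sq_le_sq' ?_ hT0.le |>.2
    nlinarith
  have ha6 : 6 * ι ≤ a := by
    rw [ha, le_div_iff₀ hR]
    nlinarith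
  have ha0 : 0 < a := by linarith
  have hs1 : 1.4 ≤ s := by
    refine abs_le_of_sq_le_sq' ?_ hs |>.2
    rw [hs2]; linarith
  have hsH : s ≤ 1.415 * H := by
    refine abs_le_of_sq_le_sq' ?_ (by linarith) |>.2
    rw [hs2]; nlinarith
  have haR : a * (n * l) = R := by
    rw [ha, div_mul_eq_mul_div, div_eq_iff hR.ne', ← sq, hR2]
    ring
  have hιa : ι / a = R / T := by
    rw [ha]; field_simp
  have hsa : 1.4 * (6 * ι) ≤ s * a := mul_le_mul hs1 ha6 (by linarith) hs
  -- Since s * a ≥ 8.4 ι and κ ≤ 2, the ratio κι/(2sa) is at most 2/16.8 < 1/8.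
  refine ⟨by linarith, ?_, ?_⟩
  · rw [div_le_div_iff₀ (by linarith) (by norm_num)]
    have := mul_le_mul_of_nonneg_right hκ2 (by linarith : 0 ≤ ι)
    linarith
  -- In units of κHR the five terms are at most 0.58, 2, 0.415, 1.415 and 1, which add up to less
  -- than 6.
  · have t1 := penalty_term_le hH hι hT0 hT72 hR ha
    have t2 : H * (2 * a * (n * l)) = 2 * (H * R) := by rw [mul_assoc 2, haR]; ring
    have t3 := bias_term_le hH hκ hT0 hT72 hR ha0 hιa hs1
    have t4 : s * a * (n * l) ≤ 1.415 * (H * R) := by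
      rw [mul_assoc, haR]
      have := mul_le_mul_of_nonneg_right hsH hR.le
      linarith
    have t5 := deviation_term_le hH hn hι hl hκ hT0 hR hR2
    have h0 : H * R ≤ κ * (H * R) := le_mul_of_one_le_left (by positivity) hκ
    have h1 : 0 ≤ κ * (H * R) := by positivity
    rw [t2]
    linarith

end Tuning

namespace AdaptiveFTRL

lemma one_le_iota {n T : ℕ} (hn : 1 ≤ n) (hT : 1 ≤ T) {δ : ℝ} (hδ : δ ∈ Set.Ioo (0 : ℝ) 1) :
    1 ≤ iota n T δ := by
  rw [iota, Real.le_log_iff_exp_le (by have := hδ.1; positivity)]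
  have h1 := Real.exp_one_lt_d9
  have hn' : (1 : ℝ) ≤ n := by exact_mod_cast hn
  have hT' : (1 : ℝ) ≤ T := by exact_mod_cast hT
  rw [le_div_iff₀ hδ.1]
  have : 1 ≤ (n : ℝ) * T := by nlinarith
  nlinarith [hδ.1, hδ.2, Real.exp_pos 1]

lemma two_le_lam {T : ℕ} (hT : 1 ≤ T) : 2 ≤ lam T := by
  have h : (1 : ℝ) ≤ Real.logb 2 (1 + T) := by
    rw [Real.le_logb_iff_rpow_le (by norm_num) (by positivity), Real.rpow_one]
    have : (1 : ℝ) ≤ T := by exact_mod_cast hT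
    linarith
  rw [lam]; linarith

lemma log_card_le_iota {X : Type*} {A : X → Type*} [Fintype X] [∀ x, Fintype (A x)]
    [∀ x, Nonempty (A x)] {T : ℕ} (hT : 1 ≤ T) {δ : ℝ} (hδ : δ ∈ Set.Ioo (0 : ℝ) 1) (x : X) :
    Real.log (Fintype.card (A x)) ≤ iota (totalActions A) T δ := by
  have h1 : (1 : ℝ) ≤ Fintype.card (A x) := by exact_mod_cast Fintype.card_pos
  have h2 : (Fintype.card (A x) : ℝ) ≤ totalActions A := by exact_mod_cast card_le_totalActions A x
  have hT' : (1 : ℝ) ≤ T := by exact_mod_cast hT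
  refine Real.log_le_log (by linarith) ?_
  rw [le_div_iff₀ hδ.1]
  have : (totalActions A : ℝ) ≤ totalActions A * T := by nlinarith
  nlinarith [hδ.2, hδ.1]

/-- With R = √(ι'λnT), both parameters are multiples of the single scale a = ι'T/R: η = 2a, and γ =
√(2H) a in the next lemma. The tuning inequalities are stated in this form. -/
lemma etaParam_eq (n T : ℕ) (hn : 1 ≤ n) (hT : 1 ≤ T) {δ : ℝ} (hδ : δ ∈ Set.Ioo (0 : ℝ) 1) :
    etaParam n T δ = 2 * (iota n T δ * T / √(iota n T δ * lam T * n * T)) := by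
  have h1 := one_le_iota hn hT hδ
  have h2 := two_le_lam hT
  have hn' : (1 : ℝ) ≤ n := by exact_mod_cast hn
  have hT' : (1 : ℝ) ≤ T := by exact_mod_cast hT
  rw [etaParam]
  congr 1
  rw [eq_div_iff (by positivity), ← Real.sqrt_mul (by positivity)]
  refine (Real.sqrt_eq_iff_mul_self_eq (by positivity) (by positivity)).2 ?_
  field_simp

lemma gammaParam_eq (n H T : ℕ) (hn : 1 ≤ n) (hT : 1 ≤ T) {δ : ℝ} (hδ : δ ∈ Set.Ioo (0 : ℝ) 1) :
    gammaParam n H T δ = √(2 * H) * (iota n T δ * T / √(iota n T δ * lam T * n * T)) := by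
  have h1 := etaParam_eq n T hn hT hδ
  rw [etaParam, mul_right_inj' (by norm_num)] at h1
  rw [gammaParam, ← h1, ← Real.sqrt_mul (by positivity)]
  congr 1
  ring

end AdaptiveFTRL

namespace Game

open AdaptiveFTRL

variable {S X Y : Type*} {A : X → Type*} {B : Y → Type*} [Fintype S] [Fintype X]
  [∀ x, Fintype (A x)] [∀ y, Fintype (B y)] {G : Game S A B}

omit [Fintype X] in
lemma value_nonneg (μ : Policy A) (ν : Policy B) : 0 ≤ G.value μ ν :=
  Finset.sum_nonneg fun τ _ => mul_nonneg (G.trajProb_nonneg μ ν τ)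
    (Finset.sum_nonneg fun h _ => (G.r h _ _ _).2.1)

omit [Fintype X] in
lemma value_le (μ : Policy A) (ν : Policy B) : G.value μ ν ≤ G.H := by
  rw [← G.expect_const μ ν G.H]
  refine G.expect_mono μ ν (f := fun τ => ∑ h, G.reward τ h) fun τ _ => ?_
  calc ∑ h, G.reward τ h ≤ ∑ _h : Fin G.H, (1 : ℝ) := Finset.sum_le_sum fun h _ => (G.r h _ _ _).2.2
    _ = G.H := by simp

variable [∀ x, Nonempty (A x)]

omit [∀ y, Fintype (B y)] in
lemma one_le_totalActions (G : Game S A B) : 1 ≤ totalActions A := by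
  have hS : Nonempty S := by
    by_contra h
    rw [not_nonempty_iff] at h
    have := G.p₀.2.2
    simp at this
  obtain ⟨s⟩ := hS
  exact Fintype.card_pos.trans_le (card_le_totalActions A (G.xOf s))

variable [∀ y, Nonempty (B y)]

/-- Regret bound on the concentration event at level `κ * ι'`, for the tuned parameters. -/
lemma Concentrated.tuned_regret_le {T : ℕ} {δ κ : ℝ} {μ : ℕ → Policy A} {ν : ℕ → Policy B}
    {τ : ℕ → G.Traj} (hE : G.Concentrated (gammaParam (totalActions A) G.H T δ) μ ν τ T
      (κ * iota (totalActions A) T δ))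
    (hG : G.PerfectRecall) (hT : 1 ≤ T) (hδ : δ ∈ Set.Ioo (0 : ℝ) 1) (hκ : 1 ≤ κ) (hκ2 : κ ≤ 2)
    (hτ : ∀ t < T, G.Feasible (τ t)) (hrun : G.MaxRunsAdaptiveFTRL T δ μ τ) (m : Policy A) :
    ∑ t ∈ Finset.range T, (G.value m (ν t) - G.value (μ t) (ν t)) ≤
      6 * κ * (G.H * √(iota (totalActions A) T δ * lam T * totalActions A * T)) := by
  have hn := G.one_le_totalActions
  have hι := one_le_iota hn hT hδ
  have hl := two_le_lam hT
  have hH : (1 : ℝ) ≤ G.H := by exact_mod_cast G.H_pos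
  have hn' : (1 : ℝ) ≤ totalActions A := by exact_mod_cast hn
  have hT' : (1 : ℝ) ≤ T := by exact_mod_cast hT
  -- If T is below 36 ι'λn, then T ≤ 6R and the trivial regret bound TH suffices.
  rcases le_total (36 * (iota (totalActions A) T δ * lam T * totalActions A)) T with h | h
  · have hR : 0 < √(iota (totalActions A) T δ * lam T * totalActions A * T) := by positivity
    obtain ⟨hγ1, hγ2, hb⟩ := tuned_bound hH hn' hι hl hκ hκ2 h hR
      (Real.sq_sqrt (by positivity)) rfl (Real.sqrt_nonneg (2 * G.H)) (Real.sq_sqrt (by positivity))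
    rw [← gammaParam_eq _ _ _ hn hT hδ] at hγ1 hγ2 hb
    rw [← etaParam_eq _ _ hn hT hδ] at hb
    refine (hE.regret_le hG hγ1 ?_ hT (by positivity) hγ2 (log_card_le_iota hT hδ) hτ hrun m).trans hb
    rw [etaParam]
    positivity
  · have h1 : ∑ t ∈ Finset.range T, (G.value m (ν t) - G.value (μ t) (ν t)) ≤ T * G.H := by
      calc _ ≤ ∑ _t ∈ Finset.range T, (G.H : ℝ) := Finset.sum_le_sum fun t _ => by
            linarith [value_le (G := G) m (ν t), value_nonneg (G := G) (μ t) (ν t)]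
        _ = _ := by simp
    have h2 : (T : ℝ) ≤ 6 * √(iota (totalActions A) T δ * lam T * totalActions A * T) := by
      have h4 : ((T : ℝ) / 6) ≤ √(iota (totalActions A) T δ * lam T * totalActions A * T) := by
        refine Real.le_sqrt_of_sq_le ?_
        nlinarith
      linarith
    refine h1.trans ?_
    have h3 : 0 ≤ G.H * √(iota (totalActions A) T δ * lam T * totalActions A * T) := by positivity
    nlinarith

end Game

/-! ### Exponential deviation inequalities for the play. -/

namespace Game

open AdaptiveFTRL

variable {S X Y : Type*} {A : X → Type*} {B : Y → Type*} [Fintype S]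
  [∀ x, Fintype (A x)] [∀ y, Fintype (B y)] {G : Game S A B}
  {Ω : Type*} {mΩ : MeasurableSpace Ω} {P : Measure Ω} [IsProbabilityMeasure P]
  {𝓕 : Filtration ℕ mΩ} {T : ℕ} {μ : ℕ → Ω → Policy A} {ν : ℕ → Ω → Policy B}
  {τ : ℕ → Ω → G.Traj}

section Law

open scoped ENNReal

lemma IsPlay.lintegral_preimage (hplay : G.IsPlay P 𝓕 T μ ν τ) {t : ℕ} (ht : t < T) (z : G.Traj)
    {g : Ω → ℝ≥0∞} (hg : Measurable[𝓕 t] g) :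
    ∫⁻ ω in τ t ⁻¹' {z}, g ω ∂P =
      ∫⁻ ω, ENNReal.ofReal (G.trajProb (μ t ω) (ν t ω) z) * g ω ∂P := by
  have hs : MeasurableSet (τ t ⁻¹' {z}) := 𝓕.le _ _ (hplay.measurable_traj t ht z)
  set f := P⟦τ t ⁻¹' {z} | 𝓕 t⟧ with hf
  have hlaw := hplay.law_traj t ht z
  have hfm : Measurable f := stronglyMeasurable_condExp.measurable.mono (𝓕.le t) le_rfl
  have hf0 : 0 ≤ᵐ[P] f := by
    filter_upwards [hlaw] with ω hω
    rw [hf, hω]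
    exact G.trajProb_nonneg _ _ _
  -- The defining property of conditional expectation as an identity of measures on `𝓕 t`; it then
  -- integrates every nonnegative `𝓕 t`-measurable function.
  have h1 : (P.restrict (τ t ⁻¹' {z})).trim (𝓕.le t) =
      (P.withDensity fun ω => ENNReal.ofReal (f ω)).trim (𝓕.le t) := by
    refine @Measure.ext _ (𝓕 t) _ _ fun E hE => ?_
    rw [trim_measurableSet_eq _ hE, trim_measurableSet_eq _ hE, Measure.restrict_apply (𝓕.le t _ hE),
      withDensity_apply _ (𝓕.le t _ hE), ← ofReal_integral_eq_lintegral_ofReal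
        integrable_condExp.integrableOn (ae_restrict_of_ae hf0),
      setIntegral_condExp (𝓕.le t) ((integrable_const _).indicator hs) hE,
      setIntegral_indicator hs]
    simp
  calc ∫⁻ ω in τ t ⁻¹' {z}, g ω ∂P = ∫⁻ ω, g ω ∂(P.withDensity fun ω => ENNReal.ofReal (f ω)) := by
        rw [← lintegral_trim (𝓕.le t) hg, h1, lintegral_trim (𝓕.le t) hg]
    _ = ∫⁻ ω, ENNReal.ofReal (f ω) * g ω ∂P :=
        lintegral_withDensity_eq_lintegral_mul _ hfm.ennreal_ofReal (hg.mono (𝓕.le t) le_rfl)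
    _ = _ := by
        refine lintegral_congr_ae ?_
        filter_upwards [hlaw] with ω hω
        rw [hf, hω]

omit [IsProbabilityMeasure P] in
lemma IsPlay.measurable_comp_traj (hplay : G.IsPlay P 𝓕 T μ ν τ) {t : ℕ} (ht : t < T)
    {β : Type*} [MeasurableSpace β] (f : G.Traj → β) :
    Measurable[𝓕 (t + 1)] fun ω => f (τ t ω) := by
  classical
  intro E _
  have : (fun ω => f (τ t ω)) ⁻¹' E = ⋃ z ∈ {z | f z ∈ E}, τ t ⁻¹' {z} := by
    ext ω; simp
  rw [this]
  exact MeasurableSet.biUnion (Set.to_countable _) fun z _ => hplay.measurable_traj t ht z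

lemma IsPlay.ae_feasible (hplay : G.IsPlay P 𝓕 T μ ν τ) :
    ∀ᵐ ω ∂P, ∀ t < T, G.Feasible (τ t ω) := by
  classical
  rw [ae_all_iff]
  intro t
  rw [Filter.eventually_imp_distrib_left]
  intro ht
  have h : ∀ z, ¬ G.Feasible z → ∀ᵐ ω ∂P, τ t ω ≠ z := fun z hz => by
    have h1 := hplay.lintegral_preimage ht z (g := fun _ => 1) measurable_const
    have h2 : ∀ ω, G.trajProb (μ t ω) (ν t ω) z = 0 := fun ω => by
      by_contra h
      exact hz (G.feasible_of_trajProb_ne_zero _ _ h)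
    simp only [h2, ENNReal.ofReal_zero, zero_mul, lintegral_const,
      Measure.restrict_apply MeasurableSet.univ, Set.univ_inter, one_mul] at h1
    simp only [ae_iff, ne_eq, not_not]
    exact h1
  have h3 : ∀ᵐ ω ∂P, ∀ z, ¬ G.Feasible z → τ t ω ≠ z := by
    rw [ae_all_iff]
    intro z
    rw [Filter.eventually_imp_distrib_left]
    exact h z
  filter_upwards [h3] with ω hω
  by_contra hz
  exact hω _ hz rfl

/-- Conditional expectation step for products of nonnegative functions of the past and of the
trajectory. -/
lemma IsPlay.lintegral_mul_le (hplay : G.IsPlay P 𝓕 T μ ν τ) {t : ℕ} (ht : t < T)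
    {W : Ω → ℝ≥0∞} (hW : Measurable[𝓕 t] W) {d : Ω → G.Traj → ℝ}
    (hd : ∀ z, Measurable[𝓕 t] fun ω => d ω z)
    (hexp : ∀ ω, G.expect (μ t ω) (ν t ω) (fun z => Real.exp (d ω z)) ≤ 1) :
    ∫⁻ ω, W ω * ENNReal.ofReal (Real.exp (d ω (τ t ω))) ∂P ≤ ∫⁻ ω, W ω ∂P := by
  classical
  have hg : ∀ z, Measurable[𝓕 t] fun ω => W ω * ENNReal.ofReal (Real.exp (d ω z)) := fun z =>
    hW.mul (Real.measurable_exp.comp (hd z)).ennreal_ofReal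
  have hs : ∀ z, MeasurableSet (τ t ⁻¹' {z}) := fun z => 𝓕.le _ _ (hplay.measurable_traj t ht z)
  calc ∫⁻ ω, W ω * ENNReal.ofReal (Real.exp (d ω (τ t ω))) ∂P =
      ∫⁻ ω, ∑ z : G.Traj, (τ t ⁻¹' {z}).indicator
        (fun ω => W ω * ENNReal.ofReal (Real.exp (d ω z))) ω ∂P := by
        refine lintegral_congr fun ω => ?_
        rw [Finset.sum_eq_single (τ t ω)]
        · simp
        · intro z _ hz
          exact Set.indicator_of_notMem (fun h => hz (by simpa using h.symm)) _
        · simp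
    _ = ∑ z : G.Traj, ∫⁻ ω in τ t ⁻¹' {z}, W ω * ENNReal.ofReal (Real.exp (d ω z)) ∂P := by
        rw [lintegral_finsetSum _ fun z _ => ((hg z).mono (𝓕.le t) le_rfl).indicator (hs z)]
        simp_rw [lintegral_indicator (hs _)]
    -- The conditional expectation stands in for `trajProb` because its measurability is immediate
    -- when sum and integral are exchanged.
    _ = ∑ z : G.Traj, ∫⁻ ω, ENNReal.ofReal ((P⟦τ t ⁻¹' {z} | 𝓕 t⟧) ω) *
          (W ω * ENNReal.ofReal (Real.exp (d ω z))) ∂P := by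
        refine Finset.sum_congr rfl fun z _ => ?_
        rw [hplay.lintegral_preimage ht z (hg z)]
        refine lintegral_congr_ae ?_
        filter_upwards [hplay.law_traj t ht z] with ω hω
        rw [hω]
    _ = ∫⁻ ω, ∑ z : G.Traj, ENNReal.ofReal ((P⟦τ t ⁻¹' {z} | 𝓕 t⟧) ω) *
          (W ω * ENNReal.ofReal (Real.exp (d ω z))) ∂P := by
        rw [lintegral_finsetSum]
        intro z _
        exact (stronglyMeasurable_condExp.measurable.mono (𝓕.le t) le_rfl).ennreal_ofReal.mul
          ((hg z).mono (𝓕.le t) le_rfl)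
    _ ≤ ∫⁻ ω, W ω ∂P := by
        refine lintegral_mono_ae ?_
        have hlaw : ∀ᵐ ω ∂P, ∀ z, (P⟦τ t ⁻¹' {z} | 𝓕 t⟧) ω = G.trajProb (μ t ω) (ν t ω) z :=
          ae_all_iff.2 fun z => hplay.law_traj t ht z
        filter_upwards [hlaw] with ω hω
        calc _ = W ω * ENNReal.ofReal (G.expect (μ t ω) (ν t ω) fun z => Real.exp (d ω z)) := by
              rw [expect, ENNReal.ofReal_sum_of_nonneg fun z _ =>
                mul_nonneg (G.trajProb_nonneg _ _ _) (Real.exp_pos _).le, Finset.mul_sum]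
              refine Finset.sum_congr rfl fun z _ => ?_
              rw [ENNReal.ofReal_mul (G.trajProb_nonneg _ _ _), hω z]
              ring
          _ ≤ W ω * 1 := by
              gcongr
              rw [ENNReal.ofReal_le_one]
              exact hexp ω
          _ = W ω := mul_one _

/-- Exponential deviation inequality for the play of a game: sums of functions of the past and of the
trajectory whose conditional exponential moments are at most one. -/
lemma IsPlay.measure_sum_gt_le (hplay : G.IsPlay P 𝓕 T μ ν τ) {d : ℕ → Ω → G.Traj → ℝ}
    (hd : ∀ t < T, ∀ z, Measurable[𝓕 t] fun ω => d t ω z)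
    (hexp : ∀ t < T, ∀ ω, G.expect (μ t ω) (ν t ω) (fun z => Real.exp (d t ω z)) ≤ 1)
    (s : ℕ) (L : ℝ) :
    P {ω | L < ∑ t ∈ Finset.Ico s T, d t ω (τ t ω)} ≤ ENNReal.ofReal (Real.exp (-L)) := by
  have hdm : ∀ t < T, Measurable[𝓕 (t + 1)] fun ω => d t ω (τ t ω) := fun t ht => by
    classical
    have : (fun ω => d t ω (τ t ω)) = fun ω => ∑ z : G.Traj,
        (if τ t ω = z then (1 : ℝ) else 0) * d t ω z := by
      funext ω; simp
    rw [this]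
    refine Finset.measurable_fun_sum _ fun z _ => ?_
    exact (hplay.measurable_comp_traj ht fun z' => if z' = z then (1 : ℝ) else 0).mul
      ((hd t ht z).mono (𝓕.mono (Nat.le_succ t)) le_rfl)
  have hsm : ∀ k ≤ T, Measurable[𝓕 k] fun ω => ∑ t ∈ Finset.Ico s k, d t ω (τ t ω) :=
    fun k hk => Finset.measurable_fun_sum _ fun t ht => by
      rw [Finset.mem_Ico] at ht
      exact (hdm t (by omega)).mono (𝓕.mono (by omega)) le_rfl
  -- The exponentials form a supermartingale started at episode `s`; Markov's inequality finishes.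
  have key : ∀ k ≤ T, ∫⁻ ω, ENNReal.ofReal (Real.exp (∑ t ∈ Finset.Ico s k, d t ω (τ t ω))) ∂P ≤ 1 := by
    intro k
    induction k with
    | zero => simp
    | succ k ih =>
      intro hk
      rcases le_or_gt s k with hsk | hsk
      · refine le_trans ?_ (ih (by omega))
        refine le_trans (le_of_eq ?_) (hplay.lintegral_mul_le (t := k) (by omega)
          (Real.measurable_exp.comp (hsm k (by omega))).ennreal_ofReal (hd k (by omega))
          (hexp k (by omega)))
        refine lintegral_congr fun ω => ?_
        rw [Finset.sum_Ico_succ_top hsk, Real.exp_add, ENNReal.ofReal_mul (Real.exp_pos _).le]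
        rfl
      · simp [Finset.Ico_eq_empty_of_le (show k + 1 ≤ s by omega)]
  have hm : Measurable fun ω => ENNReal.ofReal (Real.exp (∑ t ∈ Finset.Ico s T, d t ω (τ t ω))) :=
    (Real.measurable_exp.comp ((hsm T le_rfl).mono (𝓕.le T) le_rfl)).ennreal_ofReal
  have hexpL : ENNReal.ofReal (Real.exp L) ≠ 0 := by simp [Real.exp_pos]
  calc P {ω | L < ∑ t ∈ Finset.Ico s T, d t ω (τ t ω)} ≤
      P {ω | ENNReal.ofReal (Real.exp L) ≤
        ENNReal.ofReal (Real.exp (∑ t ∈ Finset.Ico s T, d t ω (τ t ω)))} :=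
        measure_mono fun ω hω => ENNReal.ofReal_le_ofReal (Real.exp_le_exp.2 (le_of_lt hω))
    _ ≤ (∫⁻ ω, ENNReal.ofReal (Real.exp (∑ t ∈ Finset.Ico s T, d t ω (τ t ω))) ∂P) /
        ENNReal.ofReal (Real.exp L) :=
        meas_ge_le_lintegral_div hm.aemeasurable hexpL ENNReal.ofReal_ne_top
    _ ≤ 1 / ENNReal.ofReal (Real.exp L) := by gcongr; exact key T le_rfl
    _ = _ := by
        rw [Real.exp_neg, ENNReal.ofReal_inv_of_pos (Real.exp_pos _), one_div]

end Law

end Game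

/-! ### Measurability and probability of the concentration event. -/

namespace Game

open AdaptiveFTRL

variable {S X Y : Type*} {A : X → Type*} {B : Y → Type*} [Fintype S]
  [∀ x, Fintype (A x)] [∀ y, Fintype (B y)] {G : Game S A B}

section Measurability

variable {Ω : Type*} {m : MeasurableSpace Ω}

lemma measurable_policy_apply {X : Type*} {A : X → Type*} [∀ x, Fintype (A x)] {μ : Ω → Policy A}
    (hμ : Measurable μ) (x : X) (a : A x) : Measurable fun ω => μ ω x a :=
  (measurable_pi_apply a).comp (measurable_subtype_coe.comp ((measurable_pi_apply x).comp hμ))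

lemma measurable_plan {X : Type*} {A : X → Type*} [∀ x, Fintype (A x)] {μ : Ω → Policy A}
    (hμ : Measurable μ) (hist : X → List ((x : X) × A x)) (z : (x : X) × A x) :
    Measurable fun ω => plan hist (μ ω) z := by
  refine Measurable.mul ?_ (measurable_policy_apply hμ _ _)
  generalize hist z.1 = l
  induction l with
  | nil => simp
  | cons w l ih =>
    simp only [List.map_cons, List.prod_cons]
    exact (measurable_policy_apply hμ _ _).mul ih

lemma measurable_stateWeight {ν : Ω → Policy B} (hν : Measurable ν) (h : ℕ) (s : S) :
    Measurable fun ω => G.stateWeight (ν ω) h s := by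
  induction h generalizing s with
  | zero => exact measurable_const
  | succ h ih =>
    exact Finset.measurable_fun_sum _ fun z _ =>
      ((ih _).mul (measurable_policy_apply hν _ _)).mul_const _

lemma measurable_visitWeight {ν : Ω → Policy B} (hν : Measurable ν) (f : Fin G.H → G.Step → ℝ)
    (z : (x : X) × A x) : Measurable fun ω => G.visitWeight (ν ω) f z := by
  classical
  refine Finset.measurable_fun_sum _ fun h _ => Finset.measurable_fun_sum _ fun y _ => ?_
  split_ifs
  · exact ((measurable_stateWeight hν _ _).mul (measurable_policy_apply hν _ _)).mul_const _
  · exact measurable_const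

end Measurability

section Concentration

variable {Ω : Type*} {mΩ : MeasurableSpace Ω} {P : Measure Ω}
  {𝓕 : Filtration ℕ mΩ} {T : ℕ} {μ : ℕ → Ω → Policy A} {ν : ℕ → Ω → Policy B}
  {τ : ℕ → Ω → G.Traj}

lemma IsPlay.measurable_maxIx (hplay : G.IsPlay P 𝓕 T μ ν τ) (γ : ℝ) {t : ℕ} (ht : t ≤ T)
    (z : (x : X) × A x) :
    Measurable[𝓕 t] fun ω => G.maxIx γ (fun t => μ t ω) (fun t => τ t ω) t z := by
  classical
  refine Measurable.const_div (Measurable.const_add ?_ 1) γ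
  induction t with
  | zero => exact measurable_const
  | succ t ih =>
    have ih := (ih (by omega)).mono (𝓕.mono (Nat.le_succ t)) le_rfl
    refine ih.add (Finset.measurable_fun_sum _ fun h _ => Measurable.ite ?_ ?_ measurable_const)
    · exact (@measurableSet_setOfPred Ω (𝓕 (t + 1)) _).2 (hplay.measurable_comp_traj (by omega) fun z' => G.maxPath z' h = z)
    · exact (((measurable_plan (hplay.measurable_max t (by omega)) G.maxHist z).mono
        (𝓕.mono (Nat.le_succ t)) le_rfl).add ((ih.const_add 1).const_div γ)).const_div 1

omit [∀ y, Fintype (B y)] in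
-- The key inequality of implicit exploration. As e ≤ 1, the denominator may be lowered to π + g e,
-- and then log (1 + u) ≥ 2u/(u + 2) with u = 2ge/π gives the claim. The right side is affine in
-- `e`, so its expectation involves only the mean.
lemma exp_mul_div_le {g e π : ℝ} (hg : 0 < g) (he0 : 0 ≤ e) (he1 : e ≤ 1) (hπ : 0 < π) :
    Real.exp (2 * g * (e / (π + g))) ≤ 1 + 2 * g / π * e := by
  have h1 := Real.le_log_one_add_of_nonneg (x := 2 * g / π * e) (by positivity)
  rw [← Real.le_log_iff_exp_le (by positivity)]
  refine le_trans ?_ h1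
  have h2 : 2 * (2 * g / π * e) / (2 * g / π * e + 2) = 2 * g * (e / (π + g * e)) := by
    field_simp
    ring
  rw [h2]
  have : π + g * e ≤ π + g := by nlinarith
  gcongr

variable [∀ x, Nonempty (A x)] [∀ y, Nonempty (B y)]

/-- The exponential moment bound for estimates with implicit exploration. -/
lemma PerfectRecall.expect_exp_estError_le (hG : G.PerfectRecall) {μ : Policy A} (ν : Policy B)
    (hμ : ∀ x a, 0 < μ x a) {f : Fin G.H → G.Step → ℝ} (hf0 : ∀ h z, 0 ≤ f h z)
    (hf1 : ∀ h z, f h z ≤ 1) {g : ℝ} (hg : 0 < g) (z : (x : X) × A x) :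
    G.expect μ ν (fun z' => Real.exp (2 * g * (G.visitSum f z' z / (plan G.maxHist μ z + g) -
      G.visitWeight ν f z))) ≤ 1 := by
  have hπ : 0 < plan G.maxHist μ z := mul_pos (reachPlan_pos hμ z.1) (hμ _ _)
  calc _ ≤ G.expect μ ν (fun z' => Real.exp (-(2 * g * G.visitWeight ν f z)) *
          (1 + 2 * g / plan G.maxHist μ z * G.visitSum f z' z)) := by
        refine G.expect_mono μ ν fun z' hz' => ?_
        rw [mul_sub, sub_eq_neg_add, Real.exp_add]
        exact mul_le_mul_of_nonneg_left (exp_mul_div_le hg (visitSum_nonneg hf0 z' z)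
          (hG.visitSum_le_one hf1 hz' z) hπ) (Real.exp_pos _).le
    _ = Real.exp (-(2 * g * G.visitWeight ν f z)) * (1 + 2 * g * G.visitWeight ν f z) := by
        rw [expect_const_mul, expect_add, expect_const, expect_const_mul, hG.expect_visitSum]
        field_simp
    _ ≤ Real.exp (-(2 * g * G.visitWeight ν f z)) * Real.exp (2 * g * G.visitWeight ν f z) := by
        have := Real.add_one_le_exp (2 * g * G.visitWeight ν f z)
        gcongr
        linarith
    _ = 1 := by rw [← Real.exp_add]; simp

variable [Fintype X]

/-- `optimisticLoss` as a function of the trajectory. -/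
noncomputable def optimisticLossOf (G : Game S A B) (μ : Policy A) (g : (x : X) × A x → ℝ)
    (z' : G.Traj) : ℝ :=
  ∑ h, (plan G.maxHist μ (G.maxPath z' h) * G.maxLoss h (z' h) + g (G.maxPath z' h)) /
    (plan G.maxHist μ (G.maxPath z' h) + g (G.maxPath z' h))

/-- Dividing by plan + g shrinks the mean loss by the factor plan/(plan + g). The added bias
restores at least the missing share, because losses are at most 1. -/
lemma PerfectRecall.le_expect_optimisticLossOf (hG : G.PerfectRecall) (μ : Policy A)
    (ν : Policy B) {g : (x : X) × A x → ℝ} (hg : ∀ z, 0 < g z) :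
    ∑ z, plan G.maxHist μ z * G.visitWeight ν G.maxLoss z ≤
      G.expect μ ν (G.optimisticLossOf μ g) := by
  have e : ∀ z', G.optimisticLossOf μ g z' =
      ∑ z, (plan G.maxHist μ z / (plan G.maxHist μ z + g z) * G.visitSum G.maxLoss z' z +
        g z / (plan G.maxHist μ z + g z) * G.visitSum (fun _ _ => 1) z' z) := fun z' => by
    rw [Finset.sum_add_distrib, sum_mul_visitSum, sum_mul_visitSum, ← Finset.sum_add_distrib]
    refine Finset.sum_congr rfl fun h _ => ?_
    ring
  have e2 : G.expect μ ν (G.optimisticLossOf μ g) =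
      ∑ z, (plan G.maxHist μ z / (plan G.maxHist μ z + g z) *
        (plan G.maxHist μ z * G.visitWeight ν G.maxLoss z) +
        g z / (plan G.maxHist μ z + g z) * (plan G.maxHist μ z * G.reachProb ν z.1)) := by
    rw [show G.optimisticLossOf μ g = fun z' => _ from funext e, expect_sum]
    refine Finset.sum_congr rfl fun z _ => ?_
    rw [expect_add, expect_const_mul, expect_const_mul, hG.expect_visitSum, hG.expect_visitSum,
      visitWeight_one]
  rw [e2]
  refine Finset.sum_le_sum fun z _ => ?_
  have h1 := plan_nonneg G.maxHist μ z
  have h2 := hg z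
  have h3 := G.visitWeight_le_reachProb ν G.maxLoss_le_one z
  have h4 : 0 < plan G.maxHist μ z + g z := by linarith
  have h5 : plan G.maxHist μ z * G.visitWeight ν G.maxLoss z =
      plan G.maxHist μ z / (plan G.maxHist μ z + g z) *
        (plan G.maxHist μ z * G.visitWeight ν G.maxLoss z) +
      g z / (plan G.maxHist μ z + g z) *
        (plan G.maxHist μ z * G.visitWeight ν G.maxLoss z) := by
    field_simp
  refine h5.le.trans ?_
  gcongr

omit [∀ y, Fintype (B y)] [∀ x, Nonempty (A x)] [∀ y, Nonempty (B y)] [Fintype X] in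
lemma optimisticLossOf_mem (μ : Policy A) {g : (x : X) × A x → ℝ}
    (hg : ∀ z, 0 < g z) (z' : G.Traj) : G.optimisticLossOf μ g z' ∈ Set.Icc (0 : ℝ) G.H := by
  have key : ∀ h, (plan G.maxHist μ (G.maxPath z' h) * G.maxLoss h (z' h) + g (G.maxPath z' h)) /
      (plan G.maxHist μ (G.maxPath z' h) + g (G.maxPath z' h)) ∈ Set.Icc (0 : ℝ) 1 := fun h => by
    have h1 := plan_nonneg G.maxHist μ (G.maxPath z' h)
    have h2 := hg (G.maxPath z' h)
    have h3 := G.maxLoss_nonneg h (z' h)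
    have h4 := G.maxLoss_le_one h (z' h)
    refine ⟨by positivity, (div_le_one (by linarith)).2 ?_⟩
    nlinarith
  refine ⟨Finset.sum_nonneg fun h _ => (key h).1, ?_⟩
  refine (Finset.sum_le_sum fun h _ => (key h).2).trans_eq ?_
  simp

/-- One-sided Hoeffding: after division by `H` the optimistic loss lies in [0, 1], and the quadratic
bound of exp (-x) for x ≥ 0 already gives variance proxy 1 without centering. -/
lemma PerfectRecall.expect_exp_optimisticLossOf_le (hG : G.PerfectRecall) (μ : Policy A)
    (ν : Policy B) {g : (x : X) × A x → ℝ} (hg : ∀ z, 0 < g z) {θ : ℝ} (hθ : 0 ≤ θ) :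
    G.expect μ ν (fun z' => Real.exp (θ * ((∑ z, plan G.maxHist μ z * G.visitWeight ν G.maxLoss z -
      G.optimisticLossOf μ g z') / G.H) - θ ^ 2 / 2)) ≤ 1 := by
  have hH : (0 : ℝ) < G.H := by exact_mod_cast G.H_pos
  have hle := hG.le_expect_optimisticLossOf μ ν hg
  set c := ∑ z, plan G.maxHist μ z * G.visitWeight ν G.maxLoss z
  set E := G.expect μ ν (G.optimisticLossOf μ g) with hE
  calc _ ≤ G.expect μ ν (fun z' => Real.exp (θ * (c / G.H) - θ ^ 2 / 2) *
          ((1 + θ ^ 2 / 2) + -(θ / G.H) * G.optimisticLossOf μ g z')) := by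
        refine G.expect_mono μ ν fun z' _ => ?_
        obtain ⟨h0, h1⟩ := optimisticLossOf_mem (G := G) μ hg z'
        rw [show θ * ((c - G.optimisticLossOf μ g z') / G.H) - θ ^ 2 / 2 =
          θ * (c / G.H) - θ ^ 2 / 2 + -(θ * (G.optimisticLossOf μ g z' / G.H)) by ring, Real.exp_add]
        refine mul_le_mul_of_nonneg_left ?_ (Real.exp_pos _).le
        have h2 : 0 ≤ G.optimisticLossOf μ g z' / G.H := by positivity
        have h3 : G.optimisticLossOf μ g z' / G.H ≤ 1 := (div_le_one hH).2 h1
        have h4 := exp_neg_le_quadratic (x := θ * (G.optimisticLossOf μ g z' / G.H)) (by positivity)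
        have h5 : (θ * (G.optimisticLossOf μ g z' / G.H)) ^ 2 ≤ θ ^ 2 := by
          rw [mul_pow]
          exact mul_le_of_le_one_right (sq_nonneg θ) (pow_le_one₀ h2 h3)
        have h6 : -(θ / G.H) * G.optimisticLossOf μ g z' =
          -(θ * (G.optimisticLossOf μ g z' / G.H)) := by ring
        linarith
    _ = Real.exp (θ * (c / G.H) - θ ^ 2 / 2) * ((θ ^ 2 / 2 - θ * (E / G.H)) + 1) := by
        rw [expect_const_mul, expect_add, expect_const, expect_const_mul]
        change _ * (_ + _ * E) = _
        ring
    _ ≤ Real.exp (θ * (c / G.H) - θ ^ 2 / 2) * Real.exp (θ ^ 2 / 2 - θ * (E / G.H)) :=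
        mul_le_mul_of_nonneg_left (Real.add_one_le_exp _) (Real.exp_pos _).le
    _ ≤ 1 := by
        rw [← Real.exp_add, Real.exp_le_one_iff]
        have : θ * (c / G.H) ≤ θ * (E / G.H) := by gcongr
        linarith

/-- The concentration event fails with small probability. -/
lemma IsPlay.measure_not_concentrated_le [IsProbabilityMeasure P] (hplay : G.IsPlay P 𝓕 T μ ν τ)
    (hG : G.PerfectRecall) (hT : 0 < T) {γ L : ℝ} (hγ : 0 < γ) (hL : 0 < L)
    (hμ : ∀ t < T, ∀ ω x a, 0 < μ t ω x a) :
    P {ω | ¬ ((∀ t < T, G.Feasible (τ t ω)) ∧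
        G.Concentrated γ (fun t => μ t ω) (fun t => ν t ω) (fun t => τ t ω) T L)} ≤
      ENNReal.ofReal (3 * totalActions A * T * Real.exp (-L)) := by
  classical
  have hTr : (0 : ℝ) < T := by exact_mod_cast hT
  have hHr : (0 : ℝ) < G.H := by exact_mod_cast G.H_pos
  have hix : ∀ t ω z, 0 < G.maxIx γ (fun t => μ t ω) (fun t => τ t ω) t z :=
    fun t ω z => ixParam_pos _ _ _ hγ t z
  let bad : (Fin G.H → G.Step → ℝ) → (x : X) × A x → ℕ → Set Ω := fun f z s =>
    {ω | L < ∑ t ∈ Finset.Ico s T, 2 * G.maxIx γ (fun t => μ t ω) (fun t => τ t ω) t z *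
      G.estError γ (fun t => μ t ω) (fun t => ν t ω) (fun t => τ t ω) f t z}
  have hbad : ∀ f : Fin G.H → G.Step → ℝ, (∀ h z, 0 ≤ f h z) → (∀ h z, f h z ≤ 1) → ∀ z s,
      P (bad f z s) ≤ ENNReal.ofReal (Real.exp (-L)) := fun f hf0 hf1 z s => by
    refine hplay.measure_sum_gt_le (d := fun t ω z' =>
      2 * G.maxIx γ (fun t => μ t ω) (fun t => τ t ω) t z * (G.visitSum f z' z /
        (plan G.maxHist (μ t ω) z + G.maxIx γ (fun t => μ t ω) (fun t => τ t ω) t z) -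
        G.visitWeight (ν t ω) f z)) (fun t ht z' => ?_) (fun t ht ω => ?_) s L
    · have h1 := hplay.measurable_maxIx γ ht.le z
      exact (h1.const_mul 2).mul ((((measurable_plan (hplay.measurable_max t ht) _ z).add h1).const_div
        _).sub (measurable_visitWeight (hplay.measurable_min t ht) f z))
    · exact hG.expect_exp_estError_le (ν t ω) (hμ t ht ω) hf0 hf1 (hix t ω z) z
  -- This θ minimizes L/θ + Tθ/2, the bound on the normalized deviation; the minimum is θT = √(2LT).
  let θ := √(2 * L / T)
  have hθ : 0 < θ := Real.sqrt_pos.2 (by positivity)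
  have hθ2 : θ ^ 2 = 2 * L / T := Real.sq_sqrt (by positivity)
  let badP : Set Ω := {ω | L < ∑ t ∈ Finset.Ico 0 T,
    (θ * ((∑ z, plan G.maxHist (μ t ω) z * G.visitWeight (ν t ω) G.maxLoss z -
      G.optimisticLossOf (μ t ω) (G.maxIx γ (fun t => μ t ω) (fun t => τ t ω) t) (τ t ω)) / G.H) -
      θ ^ 2 / 2)}
  have hbadP : P badP ≤ ENNReal.ofReal (Real.exp (-L)) := by
    refine hplay.measure_sum_gt_le (d := fun t ω z' =>
      θ * ((∑ z, plan G.maxHist (μ t ω) z * G.visitWeight (ν t ω) G.maxLoss z -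
        G.optimisticLossOf (μ t ω) (G.maxIx γ (fun t => μ t ω) (fun t => τ t ω) t) z') / G.H) -
      θ ^ 2 / 2) (fun t ht z' => ?_) (fun t ht ω => ?_) 0 L
    · have hp := fun z => measurable_plan (hplay.measurable_max t ht) G.maxHist z
      have h1 := fun z => hplay.measurable_maxIx γ ht.le z
      refine ((Measurable.sub ?_ ?_).div_const _ |>.const_mul θ).sub_const _
      · exact Finset.measurable_fun_sum _ fun z _ => (hp z).mul
          (measurable_visitWeight (hplay.measurable_min t ht) _ z)
      · exact Finset.measurable_fun_sum _ fun h _ => (((hp _).mul_const _).add (h1 _)).div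
          ((hp _).add (h1 _))
    · exact hG.expect_exp_optimisticLossOf_le (μ t ω) (ν t ω) (hix t ω) hθ.le
  have hsub : {ω | ¬ ((∀ t < T, G.Feasible (τ t ω)) ∧
      G.Concentrated γ (fun t => μ t ω) (fun t => ν t ω) (fun t => τ t ω) T L)} ⊆
      {ω | ¬ ∀ t < T, G.Feasible (τ t ω)} ∪
      ((⋃ i ∈ (Finset.univ : Finset ((x : X) × A x)) ×ˢ Finset.range T, bad (fun _ _ => 1) i.1 i.2) ∪
      (⋃ i ∈ (Finset.univ : Finset ((x : X) × A x)) ×ˢ Finset.range T, bad G.maxLoss i.1 i.2)) ∪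
      badP := by
    intro ω hω
    by_contra hn
    simp only [Set.mem_union, Set.mem_iUnion, not_or, not_exists, Finset.mem_product,
      Finset.mem_univ, true_and, Finset.mem_range, Prod.forall, Set.mem_ofPred_eq, not_not] at hn
    obtain ⟨⟨h1, h2, h3⟩, h4⟩ := hn
    refine hω ⟨h1, fun z s hs => not_lt.1 (h2 z s hs), fun z s hs => not_lt.1 (h3 z s hs), ?_⟩
    have h5 := not_lt.1 (show ¬ (L < _) from h4)
    rw [← Finset.range_eq_Ico, Finset.sum_sub_distrib, Finset.sum_const, Finset.card_range,
      nsmul_eq_mul, ← Finset.mul_sum, ← Finset.sum_div, hθ2] at h5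
    have h6 : (T : ℝ) * (2 * L / T / 2) = L := by field_simp
    rw [h6] at h5
    have h7 : √(2 * L * T) = θ * T := by
      rw [Real.sqrt_eq_iff_mul_self_eq (by positivity) (by positivity)]
      calc 2 * L * T = 2 * L / T * T ^ 2 := by field_simp
        _ = θ * T * (θ * T) := by rw [← hθ2]; ring
    rw [h7]
    have h8 : θ * (θ * T) = 2 * L := by
      rw [← mul_assoc, ← sq, hθ2]; field_simp
    set D := ∑ t ∈ Finset.range T, (∑ z, plan G.maxHist (μ t ω) z * G.visitWeight (ν t ω) G.maxLoss z -
      G.optimisticLossOf (μ t ω) (G.maxIx γ (fun t => μ t ω) (fun t => τ t ω) t) (τ t ω))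
    have h9 : θ * (D / G.H) ≤ θ * (θ * T) := by linarith
    have h10 := le_of_mul_le_mul_left h9 hθ
    rw [div_le_iff₀ hHr] at h10
    rw [mul_comm]
    exact h10
  have hunion : ∀ f : Fin G.H → G.Step → ℝ, (∀ h z, 0 ≤ f h z) → (∀ h z, f h z ≤ 1) →
      P (⋃ i ∈ (Finset.univ : Finset ((x : X) × A x)) ×ˢ Finset.range T, bad f i.1 i.2) ≤
        ENNReal.ofReal (totalActions A * T * Real.exp (-L)) := fun f hf0 hf1 => by
    refine (measure_biUnion_finset_le _ _).trans ?_
    refine (Finset.sum_le_sum fun i _ => hbad f hf0 hf1 i.1 i.2).trans_eq ?_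
    rw [Finset.sum_const, Finset.card_product, Finset.card_univ, card_sigma_eq_totalActions,
      Finset.card_range, nsmul_eq_mul, ENNReal.ofReal_mul (by positivity), ← Nat.cast_mul,
      ENNReal.ofReal_natCast]
  have hfeas : P {ω | ¬ ∀ t < T, G.Feasible (τ t ω)} = 0 := hplay.ae_feasible
  refine (measure_mono hsub).trans ((measure_union_le _ _).trans ?_)
  refine (add_le_add ((measure_union_le _ _).trans (add_le_add hfeas.le ((measure_union_le _ _).trans
    (add_le_add (hunion _ (fun _ _ => zero_le_one) fun _ _ => le_rfl)
      (hunion _ G.maxLoss_nonneg G.maxLoss_le_one))))) hbadP).trans ?_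
  rw [zero_add, ← ENNReal.ofReal_add (by positivity) (by positivity),
    ← ENNReal.ofReal_add (by positivity) (by positivity)]
  refine ENNReal.ofReal_le_ofReal ?_
  -- Two families of nT events and one further event make 2nT + 1 ≤ 3nT, the 3 inside ι'.
  have h1 : (1 : ℝ) ≤ totalActions A := by exact_mod_cast G.one_le_totalActions
  have h2 : (1 : ℝ) ≤ T := by exact_mod_cast hT
  have h3 : 1 ≤ (totalActions A : ℝ) * T := by nlinarith
  nlinarith [Real.exp_pos (-L)]

end Concentration

end Game

/-! ### Time averages and the high-probability regret bound. -/

namespace AdaptiveFTRL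

lemma gammaParam_pos {n H T : ℕ} (hn : 1 ≤ n) (hH : 0 < H) (hT : 1 ≤ T) {δ : ℝ}
    (hδ : δ ∈ Set.Ioo (0 : ℝ) 1) : 0 < gammaParam n H T δ := by
  have h1 := one_le_iota hn hT hδ
  have h2 := two_le_lam hT
  rw [gammaParam]
  positivity

lemma etaParam_pos {n T : ℕ} (hn : 1 ≤ n) (hT : 1 ≤ T) {δ : ℝ} (hδ : δ ∈ Set.Ioo (0 : ℝ) 1) :
    0 < etaParam n T δ := by
  have h1 := one_le_iota hn hT hδ
  have h2 := two_le_lam hT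
  rw [etaParam]
  positivity

lemma exp_neg_iota {n T : ℕ} (hn : 1 ≤ n) (hT : 1 ≤ T) {δ : ℝ} (hδ : 0 < δ) :
    Real.exp (-iota n T δ) = δ / (3 * n * T) := by
  rw [iota, Real.exp_neg, Real.exp_log (by positivity), inv_div]

section Average

variable {X : Type*} {A : X → Type*} [∀ x, Fintype (A x)]

lemma exists_isAverage {hist : X → List ((x : X) × A x)} (ht : IsTree hist) {T : ℕ} (hT : 0 < T)
    {μ : ℕ → Policy A} (hμ : ∀ t < T, ∀ x a, 0 < μ t x a) : ∃ m, IsAverage hist T μ m := by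
  have hT' : (T : ℝ) ≠ 0 := by exact_mod_cast hT.ne'
  have hpos : ∀ x, 0 < ∑ t ∈ Finset.range T, reachPlan hist (μ t) x := fun x =>
    Finset.sum_pos (fun t ht => reachPlan_pos (hμ t (Finset.mem_range.1 ht)) x) ⟨0, by simpa⟩
  -- The average policy weighs each episode by its reach of `x`; full support of the policies keeps
  -- the denominator positive.
  let m : Policy A := fun x => ⟨fun a => (∑ t ∈ Finset.range T, plan hist (μ t) ⟨x, a⟩) /
    ∑ t ∈ Finset.range T, reachPlan hist (μ t) x,
    fun a => div_nonneg (Finset.sum_nonneg fun t _ => plan_nonneg hist (μ t) _) (hpos x).le, by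
      rw [← Finset.sum_div, Finset.sum_comm]
      simp_rw [sum_plan]
      exact div_self (hpos x).ne'⟩
  have key : ∀ x, reachPlan hist m x = (∑ t ∈ Finset.range T, reachPlan hist (μ t) x) / T →
      ∀ a, plan hist m ⟨x, a⟩ = (∑ t ∈ Finset.range T, plan hist (μ t) ⟨x, a⟩) / T := by
    intro x hx a
    have h := (hpos x).ne'
    rw [plan_eq, hx]
    have hm : m x a = (∑ t ∈ Finset.range T, plan hist (μ t) ⟨x, a⟩) /
      ∑ t ∈ Finset.range T, reachPlan hist (μ t) x := rfl
    rw [hm]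
    field_simp
  refine ⟨m, fun z => key z.1 ?_ z.2⟩
  refine ht.induction (p := fun x => reachPlan hist m x =
    (∑ t ∈ Finset.range T, reachPlan hist (μ t) x) / T) (fun x hx => ?_) (fun x w hx ih => ?_) z.1
  · simp [reachPlan_root _ hx, hT']
  · simp_rw [reachPlan_child _ hx]
    exact key w.1 ih w.2

end Average

end AdaptiveFTRL

namespace Game

open AdaptiveFTRL

variable {S X Y : Type*} {A : X → Type*} {B : Y → Type*} [Fintype S] [Fintype X]
  [∀ x, Fintype (A x)] [∀ y, Fintype (B y)] [∀ x, Nonempty (A x)] {G : Game S A B}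

omit [∀ y, Fintype (B y)] in
-- Full support is inherited from the exponential form of the minimizer. The exponential moment
-- bound needs it, since it divides by the plan, and so does the existence of averages.
lemma PerfectRecall.policy_pos_of_run (hG : G.PerfectRecall) {T : ℕ} {δ : ℝ}
    (hδ : δ ∈ Set.Ioo (0 : ℝ) 1) {μ : ℕ → Policy A} {τ : ℕ → G.Traj}
    (hrun : G.MaxRunsAdaptiveFTRL T δ μ τ) {t : ℕ} (ht : t < T) (x : X) (a : A x) :
    0 < μ t x a := by
  have hn := G.one_le_totalActions
  exact (isMinOn_regularizedLoss hG.isTree (learningRate_pos _ _ _ (gammaParam_pos hn G.H_pos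
    (by omega) hδ) (etaParam_pos hn (by omega) hδ) t) uniformPolicy_pos (hrun t ht)).1 x a

variable [∀ y, Nonempty (B y)]

lemma PerfectRecall.value_of_isAverage (hG : G.PerfectRecall) {T : ℕ} (hT : 0 < T)
    {μ : ℕ → Policy A} {m : Policy A} (hm : IsAverage G.maxHist T μ m) (ν : Policy B) :
    T * G.value m ν = ∑ t ∈ Finset.range T, G.value (μ t) ν := by
  have hT' : (T : ℝ) ≠ 0 := by exact_mod_cast hT.ne'
  simp_rw [hG.value_eq ν]
  rw [Finset.sum_sub_distrib, Finset.sum_comm, mul_sub, Finset.mul_sum]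
  congr 1
  · simp
  · refine Finset.sum_congr rfl fun z _ => ?_
    rw [hm z, ← Finset.sum_mul]
    field_simp

variable {Ω : Type*} {mΩ : MeasurableSpace Ω} {P : Measure Ω} [IsProbabilityMeasure P]
  {𝓕 : Filtration ℕ mΩ} {T : ℕ} {μ : ℕ → Ω → Policy A} {ν : ℕ → Ω → Policy B}
  {τ : ℕ → Ω → G.Traj}

/-- The regret bound at level `κ` fails with probability at most `3 n T exp (-κ ι')`. -/
lemma IsPlay.measure_not_regret_le (hplay : G.IsPlay P 𝓕 T μ ν τ) (hG : G.PerfectRecall)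
    (hT : 1 ≤ T) {δ κ : ℝ} (hδ : δ ∈ Set.Ioo (0 : ℝ) 1) (hκ : 1 ≤ κ) (hκ2 : κ ≤ 2)
    (hμ : ∀ ω, G.MaxRunsAdaptiveFTRL T δ (fun t => μ t ω) (fun t => τ t ω)) :
    P {ω | ¬ ∀ m, ∑ t ∈ Finset.range T, (G.value m (ν t ω) - G.value (μ t ω) (ν t ω)) ≤
      6 * κ * (G.H * √(iota (totalActions A) T δ * lam T * totalActions A * T))} ≤
      ENNReal.ofReal (3 * totalActions A * T * Real.exp (-(κ * iota (totalActions A) T δ))) := by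
  have hn := G.one_le_totalActions
  have hι := one_le_iota hn hT hδ
  refine (measure_mono fun ω hω => ?_).trans (hplay.measure_not_concentrated_le hG hT
    (gammaParam_pos hn G.H_pos hT hδ) (L := κ * iota (totalActions A) T δ) (by positivity)
    fun t ht ω => hG.policy_pos_of_run hδ (hμ ω) ht)
  exact fun h => hω fun m => h.2.tuned_regret_le hG hT hδ hκ hκ2 h.1 (hμ ω) m

/-- A set whose complement has outer measure at most `δ` has measure at least `1 - δ`. -/
lemma one_sub_le_measureReal {s : Set Ω} {δ : ℝ} (hδ : 0 ≤ δ)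
    (h : P sᶜ ≤ ENNReal.ofReal δ) : 1 - δ ≤ P.real s := by
  have h1 : P.real (Set.univ : Set Ω) ≤ P.real s + P.real sᶜ := by
    rw [← Set.union_compl_self s]
    exact measureReal_union_le s sᶜ
  have h2 : P.real sᶜ ≤ δ := ENNReal.toReal_le_of_le_ofReal hδ h
  rw [probReal_univ] at h1
  linarith

/-- High-probability regret bound of Adaptive-FTRL for the max-player. -/
lemma IsPlay.one_sub_le_regretMax_le (hplay : G.IsPlay P 𝓕 T μ ν τ) (hG : G.PerfectRecall)
    (hT : 1 ≤ T) {δ : ℝ} (hδ : δ ∈ Set.Ioo (0 : ℝ) 1)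
    (hμ : ∀ ω, G.MaxRunsAdaptiveFTRL T δ (fun t => μ t ω) (fun t => τ t ω)) :
    1 - δ ≤ P.real {ω | G.regretMax T (fun t => μ t ω) (fun t => ν t ω) ≤
      6 * G.H * √(iota (totalActions A) T δ * lam T * totalActions A * T)} := by
  have hn := G.one_le_totalActions
  have h := hplay.measure_not_regret_le hG hT hδ le_rfl one_le_two hμ
  -- At level κ = 1 the failure probability 3nT exp (-ι') is exactly δ.
  rw [one_mul, exp_neg_iota hn hT hδ.1, mul_div_cancel₀ _ (by positivity)] at h
  refine one_sub_le_measureReal hδ.1.le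
    ((measure_mono (Set.compl_subset_comm.2 fun ω hm => ?_)).trans h)
  simp only [Set.mem_compl_iff, Set.mem_ofPred_eq, not_not] at hm
  have : Nonempty (Policy A) := ⟨uniformPolicy A⟩
  refine ciSup_le fun m => (hm m).trans_eq ?_
  ring

end Game

/-! ### Exchanging the players, and the duality gap. -/

namespace Game

open AdaptiveFTRL

variable {S X Y : Type*} {A : X → Type*} {B : Y → Type*} [Fintype S]

/-- The game with the roles of the players exchanged. -/
def swap (G : Game S A B) : Game S B A where
  xOf := G.yOf
  yOf := G.xOf
  H := G.H
  H_pos := G.H_pos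
  p₀ := G.p₀
  p h s b a := G.p h s a b
  r h s b a := ⟨1 - G.r h s a b, sub_nonneg.2 (G.r h s a b).2.2, sub_le_self _ (G.r h s a b).2.1⟩

variable {G : Game S A B}

/-- The trajectories of the game with exchanged roles. -/
def swapTraj (G : Game S A B) : G.Traj ≃ G.swap.Traj where
  toFun τ h := ⟨(τ h).1, (τ h).2.2, (τ h).2.1⟩
  invFun τ h := ⟨(τ h).1, (τ h).2.2, (τ h).2.1⟩
  left_inv _ := rfl
  right_inv _ := rfl

lemma swap_isMaxHistory (y : Y) (l : List ((y : Y) × B y)) :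
    G.swap.IsMaxHistory y l ↔ G.IsMinHistory y l :=
  ⟨fun ⟨τ, h, hτ⟩ => ⟨G.swapTraj.symm τ, h, hτ⟩, fun ⟨τ, h, hτ⟩ => ⟨G.swapTraj τ, h, hτ⟩⟩

lemma swap_isMinHistory (x : X) (l : List ((x : X) × A x)) :
    G.swap.IsMinHistory x l ↔ G.IsMaxHistory x l :=
  ⟨fun ⟨τ, h, hτ⟩ => ⟨G.swapTraj.symm τ, h, hτ⟩, fun ⟨τ, h, hτ⟩ => ⟨G.swapTraj τ, h, hτ⟩⟩

lemma swap_maxHist : G.swap.maxHist = G.minHist := by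
  funext y
  exact congrArg Classical.epsilon (funext fun l => propext (swap_isMaxHistory y l))

lemma PerfectRecall.swap (hG : G.PerfectRecall) : G.swap.PerfectRecall :=
  ⟨fun y => by simpa only [swap_isMaxHistory] using hG.2 y,
    fun x => by simpa only [swap_isMinHistory] using hG.1 x⟩

variable [∀ x, Fintype (A x)] [∀ y, Fintype (B y)]

lemma swap_trajProb (μ : Policy A) (ν : Policy B) (τ : G.Traj) :
    G.swap.trajProb ν μ (G.swapTraj τ) = G.trajProb μ ν τ := by
  refine congrArg (G.p₀ (τ ⟨0, G.H_pos⟩).1 * ·) (Finset.prod_congr rfl fun h _ => ?_)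
  exact congrArg (· * G.stepProb τ h) (mul_comm _ _)

lemma swap_value (μ : Policy A) (ν : Policy B) : G.swap.value ν μ = G.H - G.value μ ν := by
  classical
  have h1 : ∀ τ, ∑ h, G.swap.reward (G.swapTraj τ) h = G.H - ∑ h, G.reward τ h := fun τ => by
    change ∑ h : Fin G.H, (1 - G.reward τ h) = _
    rw [Finset.sum_sub_distrib]
    simp
  have h2 := G.expect_const μ ν G.H
  rw [← h2]
  unfold value expect
  rw [← Finset.sum_sub_distrib, ← G.swapTraj.sum_comp]
  exact Finset.sum_congr (by congr!) fun τ _ => by rw [swap_trajProb, h1, mul_sub]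

lemma IsPlay.swap {Ω : Type*} {mΩ : MeasurableSpace Ω} {P : Measure Ω} {𝓕 : Filtration ℕ mΩ}
    {T : ℕ} {μ : ℕ → Ω → Policy A} {ν : ℕ → Ω → Policy B} {τ : ℕ → Ω → G.Traj}
    (hplay : G.IsPlay P 𝓕 T μ ν τ) :
    G.swap.IsPlay P 𝓕 T ν μ fun t ω => G.swapTraj (τ t ω) := by
  have hpre : ∀ t z, (fun ω => G.swapTraj (τ t ω)) ⁻¹' {z} = τ t ⁻¹' {G.swapTraj.symm z} := by
    intro t z
    ext ω
    simp [Equiv.eq_symm_apply]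
  refine ⟨hplay.measurable_min, hplay.measurable_max, fun t ht z => ?_, fun t ht z => ?_⟩
  · rw [hpre]
    exact hplay.measurable_traj t ht _
  · rw [hpre]
    filter_upwards [hplay.law_traj t ht (G.swapTraj.symm z)] with ω hω
    rw [hω, ← swap_trajProb, Equiv.apply_symm_apply]

omit [∀ x, Fintype (A x)] in
lemma MinRunsAdaptiveFTRL.swap [Fintype Y] [∀ y, Nonempty (B y)] {T : ℕ} {δ : ℝ}
    {ν : ℕ → Policy B} {τ : ℕ → G.Traj} (h : G.MinRunsAdaptiveFTRL T δ ν τ) :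
    G.swap.MaxRunsAdaptiveFTRL T δ ν fun t => G.swapTraj (τ t) := by
  unfold MaxRunsAdaptiveFTRL
  have hloss : (fun t h => 1 - G.swap.reward (G.swapTraj (τ t)) h) =
      fun t h => G.reward (τ t) h := by
    funext t h
    exact sub_sub_cancel 1 (G.reward (τ t) h)
  rw [swap_maxHist, hloss]
  exact h

section Gap

variable [Fintype X] [Fintype Y] [∀ x, Nonempty (A x)] [∀ y, Nonempty (B y)]

/-- The duality gap of a time-averaged profile is at most the average regret of both players. -/
lemma PerfectRecall.isOptimalProfile_of_regret_le (hG : G.PerfectRecall) {T : ℕ} (hT : 0 < T)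
    {μ : ℕ → Policy A} {ν : ℕ → Policy B} {μbar : Policy A} {νbar : Policy B}
    (hμ : IsAverage G.maxHist T μ μbar) (hν : IsAverage G.minHist T ν νbar) {c d ε : ℝ}
    (hc : ∀ m, ∑ t ∈ Finset.range T, (G.value m (ν t) - G.value (μ t) (ν t)) ≤ c)
    (hd : ∀ m, ∑ t ∈ Finset.range T, (G.swap.value m (μ t) - G.swap.value (ν t) (μ t)) ≤ d)
    (hε : c + d ≤ ε * T) : G.IsOptimalProfile ε μbar νbar := by
  intro m n
  have hT' : (0 : ℝ) < T := by exact_mod_cast hT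
  have h1 := hG.value_of_isAverage hT hμ n
  rw [← swap_maxHist] at hν
  have h2 := hG.swap.value_of_isAverage hT hν m
  simp_rw [swap_value] at h2 hd
  have h3 := hc m
  have h4 := hd n
  simp only [Finset.sum_sub_distrib, Finset.sum_const, Finset.card_range, nsmul_eq_mul] at h2 h3 h4
  -- In the sum of the two regrets the values of the played profiles cancel, which leaves T times
  -- the duality gap of the averages.
  refine le_of_mul_le_mul_right ?_ hT'
  linarith

end Gap

end Game

/-! ### Constants of the sample complexity. -/

namespace AdaptiveFTRL

/-- With M = 1/δ + T, each of the factors 3, n, T and 1/δ is at most M, so the logarithm is at most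
4 log M. -/
lemma iota_le {n T : ℕ} (hn : 1 ≤ n) (hT : 2 ≤ T) (hnT : n ≤ T) {δ : ℝ}
    (hδ : δ ∈ Set.Ioo (0 : ℝ) 1) : iota n T δ ≤ 4 * Real.log (1 / δ + T) := by
  have hT' : (2 : ℝ) ≤ T := by exact_mod_cast hT
  have hn' : (0 : ℝ) < n := by exact_mod_cast hn
  have hnT' : (n : ℝ) ≤ T := by exact_mod_cast hnT
  have hδ0 := hδ.1
  have h1 : 1 ≤ 1 / δ := by
    rw [le_div_iff₀ hδ0]
    linarith [hδ.2]
  set M := 1 / δ + T with hM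
  rw [show 4 * Real.log M = Real.log (M ^ 4) by rw [Real.log_pow]; norm_num, iota]
  refine Real.log_le_log (by positivity) ?_
  calc 3 * n * T / δ = 3 * n * T * (1 / δ) := by ring
    _ ≤ M * M * M * M := by gcongr <;> linarith
    _ = M ^ 4 := by ring

lemma lam_le {T : ℕ} (hT : 2 ≤ T) : lam T ≤ 4.4 * Real.log T := by
  have hT' : (2 : ℝ) ≤ T := by exact_mod_cast hT
  have h2 := Real.log_two_gt_d9
  have h3 : Real.log 2 ≤ Real.log T := Real.log_le_log (by norm_num) hT'
  have h4 : Real.log (1 + T) ≤ 2 * Real.log T := by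
    rw [show 2 * Real.log T = Real.log ((T : ℝ) ^ 2) by rw [Real.log_pow]; norm_num]
    exact Real.log_le_log (by positivity) (by nlinarith)
  have h5 : Real.logb 2 (1 + T) ≤ 4.4 * Real.log T - 1 := by
    rw [Real.logb, div_le_iff₀ (by linarith)]
    nlinarith
  rw [lam]
  linarith

/-- With enough episodes, the regret bound at level `2` is at most half the target accuracy. -/
lemma tuned_regret_le_half {n N H T : ℕ} (hn : 1 ≤ n) (hnN : n ≤ N) (hH : 0 < H) (hT : 2 ≤ T)
    {δ ε : ℝ} (hδ : δ ∈ Set.Ioo (0 : ℝ) 1) (hε : 0 < ε) (hεH : ε ≤ H)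
    (hTε : 20000 * (H ^ 2 * N * Real.log (1 / δ + T) * Real.log T / ε ^ 2) ≤ T) :
    6 * 2 * (H * √(iota n T δ * lam T * n * T)) ≤ ε / 2 * T := by
  have hδ0 := hδ.1
  have hT' : (2 : ℝ) ≤ T := by exact_mod_cast hT
  have hn' : (1 : ℝ) ≤ n := by exact_mod_cast hn
  have hnN' : (n : ℝ) ≤ N := by exact_mod_cast hnN
  have hH' : (0 : ℝ) < H := by exact_mod_cast hH
  have h1 : 1 ≤ 1 / δ := by
    rw [le_div_iff₀ hδ0]
    linarith [hδ.2]
  have hM : 1 ≤ Real.log (1 / δ + T) := by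
    rw [Real.le_log_iff_exp_le (by positivity)]
    linarith [Real.exp_one_lt_d9]
  have hlT : 0.5 ≤ Real.log T := by
    have := Real.log_le_log (by norm_num) hT'
    linarith [Real.log_two_gt_d9]
  rw [← mul_div_assoc, div_le_iff₀ (by positivity)] at hTε
  have hK : 0.5 ≤ Real.log (1 / δ + T) * Real.log T := by nlinarith
  -- Here ε ≤ H is used: the lower bound on T then forces T to exceed the number of actions, as
  -- `iota_le` requires.
  have hnT : n ≤ T := by
    have h2 : (T : ℝ) * ε ^ 2 ≤ T * H ^ 2 := by gcongr
    have h3 : (H : ℝ) ^ 2 * (20000 * (N * (Real.log (1 / δ + T) * Real.log T))) ≤ H ^ 2 * T := by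
      linarith
    have h4 := le_of_mul_le_mul_left h3 (by positivity)
    have h5 : (N : ℝ) * 0.5 ≤ N * (Real.log (1 / δ + T) * Real.log T) := by gcongr
    have h6 : (n : ℝ) ≤ T := by linarith
    exact_mod_cast h6
  have hι := iota_le hn hT hnT hδ
  have hl := lam_le hT
  have hι0 := one_le_iota hn (by omega : 1 ≤ T) hδ
  have hl0 := two_le_lam (by omega : 1 ≤ T)
  have key : √(iota n T δ * lam T * n * T) ≤ ε * T / (24 * H) := by
    refine Real.sqrt_le_iff.2 ⟨by positivity, ?_⟩
    rw [div_pow, le_div_iff₀ (by positivity)]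
    -- Here 4 · 4.4 · 24² = 10137.6 = 0.50688 · 20000, so the constant 20000 leaves a factor of
    -- almost 2 to spare.
    calc iota n T δ * lam T * n * T * (24 * H) ^ 2 ≤
        4 * Real.log (1 / δ + T) * (4.4 * Real.log T) * N * T * (24 * H) ^ 2 := by gcongr
      _ = 0.50688 * T * (20000 * (H ^ 2 * N * Real.log (1 / δ + T) * Real.log T)) := by ring
      _ ≤ 0.50688 * T * (T * ε ^ 2) := by gcongr
      _ ≤ 1 * T * (T * ε ^ 2) := by gcongr; norm_num
      _ = (ε * T) ^ 2 := by ring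
  calc 6 * 2 * (H * √(iota n T δ * lam T * n * T)) ≤ 6 * 2 * (H * (ε * T / (24 * H))) := by gcongr
    _ = ε / 2 * T := by field_simp; ring

lemma failure_prob_le_half {n T : ℕ} (hn : 1 ≤ n) (hT : 1 ≤ T) {δ : ℝ}
    (hδ : δ ∈ Set.Ioo (0 : ℝ) 1) : 3 * n * T * Real.exp (-(2 * iota n T δ)) ≤ δ / 2 := by
  have hn' : (1 : ℝ) ≤ n := by exact_mod_cast hn
  have hT' : (1 : ℝ) ≤ T := by exact_mod_cast hT
  have h1 : Real.exp (-(2 * iota n T δ)) = (δ / (3 * n * T)) ^ 2 := by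
    rw [← exp_neg_iota hn hT hδ.1, ← Real.exp_nat_mul]
    congr 1
    push_cast
    ring
  rw [h1]
  have h2 : 3 * n * T * (δ / (3 * n * T)) ^ 2 = δ ^ 2 / (3 * n * T) := by field_simp
  rw [h2, div_le_div_iff₀ (by positivity) (by norm_num)]
  have h3 : (1 : ℝ) ≤ n * T := by nlinarith
  nlinarith [hδ.1, hδ.2]

end AdaptiveFTRL

/-! ### Self-play. -/

namespace Game

open AdaptiveFTRL

variable {S X Y : Type*} {A : X → Type*} {B : Y → Type*} [Fintype S] [Fintype X] [Fintype Y]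
  [∀ x, Fintype (A x)] [∀ y, Fintype (B y)] [∀ x, Nonempty (A x)] [∀ y, Nonempty (B y)]
  {G : Game S A B}
  {Ω : Type*} {mΩ : MeasurableSpace Ω} {P : Measure Ω} [IsProbabilityMeasure P]
  {𝓕 : Filtration ℕ mΩ} {T : ℕ} {μ : ℕ → Ω → Policy A} {ν : ℕ → Ω → Policy B}
  {τ : ℕ → Ω → G.Traj}

/-- Sample complexity of Adaptive-FTRL in self-play. -/
lemma IsPlay.one_sub_le_isOptimalProfile (hplay : G.IsPlay P 𝓕 T μ ν τ) (hG : G.PerfectRecall)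
    (hT : 2 ≤ T) {δ : ℝ} (hδ : δ ∈ Set.Ioo (0 : ℝ) 1) {ε : ℝ} (hε : 0 < ε)
    (hμ : ∀ ω, G.MaxRunsAdaptiveFTRL T δ (fun t => μ t ω) (fun t => τ t ω))
    (hν : ∀ ω, G.MinRunsAdaptiveFTRL T δ (fun t => ν t ω) (fun t => τ t ω))
    (hTε : 20000 * (G.H ^ 2 * (totalActions A + totalActions B) *
      Real.log (1 / δ + T) * Real.log T / ε ^ 2) ≤ T) :
    1 - δ ≤ P.real {ω |
      (∃ μbar, IsAverage G.maxHist T (fun t => μ t ω) μbar) ∧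
      (∃ νbar, IsAverage G.minHist T (fun t => ν t ω) νbar) ∧
      ∀ μbar νbar, IsAverage G.maxHist T (fun t => μ t ω) μbar →
        IsAverage G.minHist T (fun t => ν t ω) νbar → G.IsOptimalProfile ε μbar νbar} := by
  have hν' := fun ω => (hν ω).swap
  have hnA := G.one_le_totalActions
  have hnB := G.swap.one_le_totalActions
  -- Level κ = 2 for both players: each fails with probability at most 3nT exp (-2ι') = δ²/(3nT) ≤
  -- δ/2.
  have hA := hplay.measure_not_regret_le hG (by omega) hδ one_le_two le_rfl hμ
  have hB := hplay.swap.measure_not_regret_le hG.swap (by omega) hδ one_le_two le_rfl hν'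
  refine one_sub_le_measureReal hδ.1.le ((measure_mono (Set.compl_subset_comm.2 fun ω hω => ?_)).trans
    ((measure_union_le _ _).trans ((add_le_add hA hB).trans ?_)))
  · simp only [Set.mem_compl_iff, Set.mem_union, Set.mem_ofPred_eq, not_or, not_not] at hω
    refine ⟨exists_isAverage hG.isTree (by omega) fun t ht => hG.policy_pos_of_run hδ (hμ ω) ht, ?_, ?_⟩
    · rw [← swap_maxHist]
      exact exists_isAverage hG.swap.isTree (by omega) fun t ht =>
        hG.swap.policy_pos_of_run hδ (hν' ω) ht
    · intro μbar νbar hμbar hνbar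
      -- For ε > H the claim is trivial, because values lie in [0, H].
      rcases le_or_gt ε G.H with hεH | hεH
      · refine hG.isOptimalProfile_of_regret_le (by omega) hμbar hνbar hω.1 hω.2 ?_
        have h1 := tuned_regret_le_half hnA (Nat.le_add_right _ (totalActions B)) G.H_pos hT hδ hε hεH
          (by push_cast; exact hTε)
        have h2 := tuned_regret_le_half hnB (Nat.le_add_left _ (totalActions A)) G.H_pos hT hδ hε hεH
          (by push_cast; exact hTε)
        exact (add_le_add h1 h2).trans_eq (by ring)
      · intro m n
        linarith [value_le (G := G) m νbar, value_nonneg (G := G) μbar n]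
  · rw [← ENNReal.ofReal_add (by positivity) (by positivity)]
    refine ENNReal.ofReal_le_ofReal ?_
    have h1 := failure_prob_le_half hnA (by omega : 1 ≤ T) hδ
    have h2 := failure_prob_le_half hnB (by omega : 1 ≤ T) hδ
    linarith

end Game

theorem theorem6 :
    -- regret bound of the max-player against an arbitrary adaptive opponent
    (∀ {S X Y : Type*} {A : X → Type*} {B : Y → Type*}
        [Fintype S] [Fintype X] [Fintype Y] [∀ x, Fintype (A x)] [∀ y, Fintype (B y)]
        [∀ x, Nonempty (A x)] [∀ y, Nonempty (B y)]
        (G : Game S A B) (_hG : G.PerfectRecall)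
        {Ω : Type*} {mΩ : MeasurableSpace Ω} (P : Measure Ω) [IsProbabilityMeasure P]
        (𝓕 : Filtration ℕ mΩ) (T : ℕ) (_hT : 1 ≤ T) (δ : ℝ) (_hδ : δ ∈ Set.Ioo (0 : ℝ) 1)
        (μ : ℕ → Ω → Policy A) (ν : ℕ → Ω → Policy B) (τ : ℕ → Ω → G.Traj)
        (_hplay : G.IsPlay P 𝓕 T μ ν τ)
        (_hμ : ∀ ω, G.MaxRunsAdaptiveFTRL T δ (fun t => μ t ω) (fun t => τ t ω)),
      1 - δ ≤ P.real {ω | G.regretMax T (fun t => μ t ω) (fun t => ν t ω) ≤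
        6 * G.H * √(AdaptiveFTRL.iota (AdaptiveFTRL.totalActions A) T δ * AdaptiveFTRL.lam T *
          AdaptiveFTRL.totalActions A * T)}) ∧
    -- sample complexity of self-play, with an absolute constant
    (∃ C : ℝ, 0 < C ∧
      ∀ {S X Y : Type*} {A : X → Type*} {B : Y → Type*}
        [Fintype S] [Fintype X] [Fintype Y] [∀ x, Fintype (A x)] [∀ y, Fintype (B y)]
        [∀ x, Nonempty (A x)] [∀ y, Nonempty (B y)]
        (G : Game S A B) (_hG : G.PerfectRecall)
        {Ω : Type*} {mΩ : MeasurableSpace Ω} (P : Measure Ω) [IsProbabilityMeasure P]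
        (𝓕 : Filtration ℕ mΩ) (T : ℕ) (_hT : 2 ≤ T) (δ : ℝ) (_hδ : δ ∈ Set.Ioo (0 : ℝ) 1)
        (ε : ℝ) (_hε : 0 < ε)
        (μ : ℕ → Ω → Policy A) (ν : ℕ → Ω → Policy B) (τ : ℕ → Ω → G.Traj)
        (_hplay : G.IsPlay P 𝓕 T μ ν τ)
        (_hμ : ∀ ω, G.MaxRunsAdaptiveFTRL T δ (fun t => μ t ω) (fun t => τ t ω))
        (_hν : ∀ ω, G.MinRunsAdaptiveFTRL T δ (fun t => ν t ω) (fun t => τ t ω))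
        (_hTε : C * (G.H ^ 2 * (AdaptiveFTRL.totalActions A + AdaptiveFTRL.totalActions B) *
          Real.log (1 / δ + T) * Real.log T / ε ^ 2) ≤ T),
      1 - δ ≤ P.real {ω |
        (∃ μbar, AdaptiveFTRL.IsAverage G.maxHist T (fun t => μ t ω) μbar) ∧
        (∃ νbar, AdaptiveFTRL.IsAverage G.minHist T (fun t => ν t ω) νbar) ∧
        ∀ μbar νbar, AdaptiveFTRL.IsAverage G.maxHist T (fun t => μ t ω) μbar →
          AdaptiveFTRL.IsAverage G.minHist T (fun t => ν t ω) νbar →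
          G.IsOptimalProfile ε μbar νbar}) := by
  refine ⟨?_, 20000, by norm_num, ?_⟩
  · intro S X Y A B _ _ _ _ _ _ _ G hG Ω mΩ P _ 𝓕 T hT δ hδ μ ν τ hplay hμ
    exact hplay.one_sub_le_regretMax_le hG hT hδ hμ
  · intro S X Y A B _ _ _ _ _ _ _ G hG Ω mΩ P _ 𝓕 T hT δ hδ ε hε μ ν τ hplay hμ hν hTε
    exact hplay.one_sub_le_isOptimalProfile hG hT hδ hε hμ hν hTε
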